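/- **Definitions.** For a bicategory $B$ let $\mathrm{biHH}(B)$ be the pseudocolimit (colimit in the $(2,1)$-category of categories) of the 2-truncated cyclic bar diagram with levels $$\coprod_{X_0}B(X_0,X_0),\qquad \coprod_{X_0,X_1}B(X_0,X_1)\times B(X_1,X_0),\qquad \coprod_{X_0,X_1,X_2}B(X_0,X_1)\times B(X_1,X_2)\times B(X_2,X_0),$$ with face maps $d_0(F,G)=FG$, $d_1(F,G)=GF$, $d_0(F,G,H)=(FG,H)$, $d_1(F,G,H)=(F,GH)$, $d_2(F,G,H)=(HF,G)$ and degeneracies $s_0(F)=(F,\mathrm{id})$, $s_0(F,G)=(F,\mathrm{id},G)$, $s_1(F,G)=(F,G,\mathrm{id})$ (composition written in diagrammatic order), where the simplicial identities hold up to the associators and unitors of $B$. It is functorial in pseudofunctors. Let $\mathrm{Adj}$ be the free adjunction: the strict 2-category freely generated by objects $0,1$, 1-cells $f:0\to 1$, $g:1\to 0$ and 2-cells $\mathrm{id}_0\Rightarrow fg$, $gf\Rightarrow \mathrm{id}_1$ (diagrammatic order) subject to the two triangle identities. Let $\mathrm{Mon}$ and $\mathrm{CoMon}$ be its full sub-2-categories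 on the object $0$ and on the object $1$. Let $\Lambda_\infty$ be the paracyclic category: its objects are $0,1,2,\dots$ and a morphism $n\to m$ is a non-decreasing function $\varphi:\mathbb Z\to\mathbb Z$ with $\varphi(l+n+1)=\varphi(l)+m+1$ for all $l$. It is self-dual through the functor $\Lambda_\infty^{op}\to\Lambda_\infty$ that is the identity on objects and sends $\varphi$ to its left adjoint $j\mapsto\min\{i: j\le\varphi(i)\}$. Write $\mathcal C^{\lhd}$ (resp. $\mathcal C^{\rhd}$) for $\mathcal C$ with a new initial (resp. terminal) object adjoined. **Theorem.** There are equivalences of categories $$(\Lambda_\infty)^{\lhd}\simeq \mathrm{biHH}(\mathrm{Mon}),\qquad (\Lambda_\infty)^{\lhd\rhd}\simeq\mathrm{biHH}(\mathrm{Adj}),\qquad (\Lambda_\infty^{op})^{\rhd}\simeq\mathrm{biHH}(\mathrm{CoMon})$$ which are compatible: in the diagram $$\begin{array}{ccccc}\mathrm{biHH}(\mathrm{Mon})&\hookrightarrow&\mathrm{biHH}(\mathrm{Adj})&\hookleftarrow&\mathrm{biHH}(\mathrm{CoMon})\\ \uparrow\simeq&&\uparrow\simeq&&\uparrow\simeq\\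 (\Lambda_\infty)^{\lhd}&\hookrightarrow&(\Lambda_\infty)^{\lhd\rhd}&\hookleftarrow&(\Lambda_\infty^{op})^{\rhd}\end{array}$$ both squares commute up to natural isomorphism. Here the upper functors are induced by the inclusions $\mathrm{Mon}\subset\mathrm{Adj}\supset\mathrm{CoMon}$ and are fully faithful; the lower left functor is the canonical inclusion, and the lower right functor is obtained from $\Lambda_\infty^{op}\to\Lambda_\infty\hookrightarrow(\Lambda_\infty)^{\lhd}$, the self-duality followed by the inclusion, by adjoining a terminal object. -/

import Mathlib

open CategoryTheory Bicategory

universe w v u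

/-! ### The cyclic bar diagram of a bicategory and its Hochschild homology -/

namespace BiHH

/-- The three simplicial levels `[0]`, `[1]`, `[2]`. -/
inductive Lvl : Type
  | zero | one | two

/-- The generating operators between the levels of a `2`-truncated simplicial object:
all face maps `d i` and all degeneracy maps `s i`. -/
inductive Op : Lvl → Lvl → Type
  /-- `d₀` on level one -/
  | d10 : Op .one .zero
  /-- `d₁` on level one -/
  | d11 : Op .one .zero
  /-- `s₀` on level zero -/
  | s00 : Op .zero .one
  /-- `d₀` on level two -/
  | d20 : Op .two .one
  /-- `d₁` on level two -/
  | d21 : Op .two .one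
  /-- `d₂` on level two -/
  | d22 : Op .two .one
  /-- `s₀` on level one -/
  | s10 : Op .one .two
  /-- `s₁` on level one -/
  | s11 : Op .one .two

/-- The simplicial identities of the form `b ∘ a = b' ∘ a'`
(in `Square a b a' b'` the operator `a` is applied before `b`, and `a'` before `b'`). -/
inductive Square : ∀ {k l l' m : Lvl}, Op k l → Op l m → Op k l' → Op l' m → Type
  /-- `d₀ d₀ = d₀ d₁` -/
  | d0d0 : Square .d20 .d10 .d21 .d10
  /-- `d₁ d₀ = d₀ d₂` -/
  | d1d0 : Square .d20 .d11 .d22 .d10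
  /-- `d₁ d₁ = d₁ d₂` -/
  | d1d1 : Square .d21 .d11 .d22 .d11
  /-- `d₂ s₀ = s₀ d₁` -/
  | d2s0 : Square .s10 .d22 .d11 .s00
  /-- `d₀ s₁ = s₀ d₀` -/
  | d0s1 : Square .s11 .d20 .d10 .s00
  /-- `s₀ s₀ = s₁ s₀` -/
  | s0s0 : Square .s00 .s10 .s00 .s11

/-- The simplicial identities of the form `b ∘ a = id` (the operator `a` is applied first). -/
inductive Triangle : ∀ {k l : Lvl}, Op k l → Op l k → Type
  /-- `d₀ s₀ = id` on level zero -/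
  | d0s0 : Triangle .s00 .d10
  /-- `d₁ s₀ = id` on level zero -/
  | d1s0 : Triangle .s00 .d11
  /-- `d₀ s₀ = id` on level one -/
  | d0s0' : Triangle .s10 .d20
  /-- `d₁ s₀ = id` on level one -/
  | d1s0' : Triangle .s10 .d21
  /-- `d₁ s₁ = id` on level one -/
  | d1s1' : Triangle .s11 .d21
  /-- `d₂ s₁ = id` on level one -/
  | d2s1' : Triangle .s11 .d22

variable (B : Type u) [Bicategory.{w, v} B]

/-- The levels of the cyclic bar diagram:
`∐ B(X₀,X₀)`, `∐ B(X₀,X₁) × B(X₁,X₀)` and `∐ B(X₀,X₁) × B(X₁,X₂) × B(X₂,X₀)`. -/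
def Level : Lvl → Type (max u v)
  | .zero => Σ X : B, (X ⟶ X)
  | .one => Σ X : B × B, (X.1 ⟶ X.2) × (X.2 ⟶ X.1)
  | .two => Σ X : B × B × B, (X.1 ⟶ X.2.1) × (X.2.1 ⟶ X.2.2) × (X.2.2 ⟶ X.1)

/-- Each level is a coproduct (in the category of categories) of products of categories of
`1`-cells and `2`-cells. -/
instance Level.category : ∀ k : Lvl, Category.{max u v w} (Level B k)
  | .zero => inferInstanceAs (Category (Σ X : B, (X ⟶ X)))
  | .one => inferInstanceAs (Category (Σ X : B × B, (X.1 ⟶ X.2) × (X.2 ⟶ X.1)))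
  | .two => inferInstanceAs (Category
      (Σ X : B × B × B, (X.1 ⟶ X.2.1) × (X.2.1 ⟶ X.2.2) × (X.2.2 ⟶ X.1)))


section

variable {B}
variable {a b c : B}

/-- Horizontal composition of `2`-cells. -/
def hcomp {F F' : a ⟶ b} {G G' : b ⟶ c} (α : F ⟶ F') (β : G ⟶ G') : F ≫ G ⟶ F' ≫ G' :=
  α ▷ G ≫ F' ◁ β

@[simp]
theorem hcomp_id (F : a ⟶ b) (G : b ⟶ c) : hcomp (𝟙 F) (𝟙 G) = 𝟙 (F ≫ G) := by
  simp [hcomp]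

@[simp]
theorem hcomp_comp {F F' F'' : a ⟶ b} {G G' G'' : b ⟶ c} (α : F ⟶ F') (α' : F' ⟶ F'')
    (β : G ⟶ G') (β' : G' ⟶ G'') :
    hcomp (α ≫ α') (β ≫ β') = hcomp α β ≫ hcomp α' β' := by
  simp [hcomp, ← whisker_exchange_assoc]

theorem hcomp_associator {d : B} {F F' : a ⟶ b} {G G' : b ⟶ c} {H H' : c ⟶ d}
    (α : F ⟶ F') (β : G ⟶ G') (γ : H ⟶ H') :
    hcomp (hcomp α β) γ ≫ (α_ F' G' H').hom = (α_ F G H).hom ≫ hcomp α (hcomp β γ) := by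
  simp [hcomp]

theorem hcomp_associator_inv {d : B} {F F' : a ⟶ b} {G G' : b ⟶ c} {H H' : c ⟶ d}
    (α : F ⟶ F') (β : G ⟶ G') (γ : H ⟶ H') :
    hcomp α (hcomp β γ) ≫ (α_ F' G' H').inv = (α_ F G H).inv ≫ hcomp (hcomp α β) γ := by
  simp [hcomp]

theorem hcomp_rightUnitor {F F' : a ⟶ b} (α : F ⟶ F') :
    hcomp α (𝟙 (𝟙 b)) ≫ (ρ_ F').hom = (ρ_ F).hom ≫ α := by
  simp [hcomp]

theorem hcomp_leftUnitor {F F' : a ⟶ b} (α : F ⟶ F') :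
    hcomp (𝟙 (𝟙 a)) α ≫ (λ_ F').hom = (λ_ F).hom ≫ α := by
  simp [hcomp]

end

/-- The face and degeneracy functors of the cyclic bar diagram:
`d₀(F,G) = FG`, `d₁(F,G) = GF`, `s₀(F) = (F,U)`,
`d₀(F,G,H) = (FG,H)`, `d₁(F,G,H) = (F,GH)`, `d₂(F,G,H) = (HF,G)`,
`s₀(F,G) = (F,U,G)`, `s₁(F,G) = (F,G,U)`. -/
def op : ∀ {k l : Lvl}, Op k l → (Level B k ⥤ Level B l)
  | _, _, .d10 => Sigma.desc fun X : B × B =>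
      ({ obj := fun F => F.1 ≫ F.2
         map := fun α => hcomp α.1 α.2 } :
        (X.1 ⟶ X.2) × (X.2 ⟶ X.1) ⥤ (X.1 ⟶ X.1)) ⋙
      Sigma.incl (C := fun X : B => (X ⟶ X)) X.1
  | _, _, .d11 => Sigma.desc fun X : B × B =>
      ({ obj := fun F => F.2 ≫ F.1
         map := fun α => hcomp α.2 α.1 } :
        (X.1 ⟶ X.2) × (X.2 ⟶ X.1) ⥤ (X.2 ⟶ X.2)) ⋙
      Sigma.incl (C := fun X : B => (X ⟶ X)) X.2
  | _, _, .s00 => Sigma.desc fun X : B =>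
      ({ obj := fun F => (F, 𝟙 X)
         map := fun α => (α, 𝟙 (𝟙 X)) } :
        (X ⟶ X) ⥤ (X ⟶ X) × (X ⟶ X)) ⋙
      Sigma.incl (C := fun X : B × B => (X.1 ⟶ X.2) × (X.2 ⟶ X.1)) (X, X)
  | _, _, .d20 => Sigma.desc fun X : B × B × B =>
      ({ obj := fun F => (F.1 ≫ F.2.1, F.2.2)
         map := fun α => (hcomp α.1 α.2.1, α.2.2) } :
        (X.1 ⟶ X.2.1) × (X.2.1 ⟶ X.2.2) × (X.2.2 ⟶ X.1) ⥤ (X.1 ⟶ X.2.2) × (X.2.2 ⟶ X.1)) ⋙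
      Sigma.incl (C := fun X : B × B => (X.1 ⟶ X.2) × (X.2 ⟶ X.1)) (X.1, X.2.2)
  | _, _, .d21 => Sigma.desc fun X : B × B × B =>
      ({ obj := fun F => (F.1, F.2.1 ≫ F.2.2)
         map := fun α => (α.1, hcomp α.2.1 α.2.2) } :
        (X.1 ⟶ X.2.1) × (X.2.1 ⟶ X.2.2) × (X.2.2 ⟶ X.1) ⥤ (X.1 ⟶ X.2.1) × (X.2.1 ⟶ X.1)) ⋙
      Sigma.incl (C := fun X : B × B => (X.1 ⟶ X.2) × (X.2 ⟶ X.1)) (X.1, X.2.1)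
  | _, _, .d22 => Sigma.desc fun X : B × B × B =>
      ({ obj := fun F => (F.2.2 ≫ F.1, F.2.1)
         map := fun α => (hcomp α.2.2 α.1, α.2.1) } :
        (X.1 ⟶ X.2.1) × (X.2.1 ⟶ X.2.2) × (X.2.2 ⟶ X.1) ⥤ (X.2.2 ⟶ X.2.1) × (X.2.1 ⟶ X.2.2)) ⋙
      Sigma.incl (C := fun X : B × B => (X.1 ⟶ X.2) × (X.2 ⟶ X.1)) (X.2.2, X.2.1)
  | _, _, .s10 => Sigma.desc fun X : B × B =>
      ({ obj := fun F => (F.1, 𝟙 X.2, F.2)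
         map := fun α => (α.1, 𝟙 (𝟙 X.2), α.2) } :
        (X.1 ⟶ X.2) × (X.2 ⟶ X.1) ⥤ (X.1 ⟶ X.2) × (X.2 ⟶ X.2) × (X.2 ⟶ X.1)) ⋙
      Sigma.incl (C := fun X : B × B × B => (X.1 ⟶ X.2.1) × (X.2.1 ⟶ X.2.2) × (X.2.2 ⟶ X.1))
        (X.1, X.2, X.2)
  | _, _, .s11 => Sigma.desc fun X : B × B =>
      ({ obj := fun F => (F.1, F.2, 𝟙 X.1)
         map := fun α => (α.1, α.2, 𝟙 (𝟙 X.1)) } :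
        (X.1 ⟶ X.2) × (X.2 ⟶ X.1) ⥤ (X.1 ⟶ X.2) × (X.2 ⟶ X.1) × (X.1 ⟶ X.1)) ⋙
      Sigma.incl (C := fun X : B × B × B => (X.1 ⟶ X.2.1) × (X.2.1 ⟶ X.2.2) × (X.2.2 ⟶ X.1))
        (X.1, X.2, X.1)


/-- The associativity isomorphisms (or identities) by which the cyclic bar diagram satisfies
the simplicial identities `b ∘ a = b' ∘ a'`. -/
def squareIso : ∀ {k l l' m : Lvl} {a : Op k l} {b : Op l m} {a' : Op k l'} {b' : Op l' m},
    Square a b a' b' → (op B a ⋙ op B b ≅ op B a' ⋙ op B b')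
  | _, _, _, _, _, _, _, _, .d0d0 => Sigma.natIso fun _ => NatIso.ofComponents
      (fun F => (Sigma.incl _).mapIso (α_ F.1 F.2.1 F.2.2))
      (fun _ => congrArg Sigma.SigmaHom.mk (hcomp_associator _ _ _))
  | _, _, _, _, _, _, _, _, .d1d0 => Sigma.natIso fun _ => NatIso.ofComponents
      (fun F => (Sigma.incl _).mapIso (α_ F.2.2 F.1 F.2.1).symm)
      (fun _ => congrArg Sigma.SigmaHom.mk (hcomp_associator_inv _ _ _))
  | _, _, _, _, _, _, _, _, .d1d1 => Sigma.natIso fun _ => NatIso.ofComponents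
      (fun F => (Sigma.incl _).mapIso (α_ F.2.1 F.2.2 F.1))
      (fun _ => congrArg Sigma.SigmaHom.mk (hcomp_associator _ _ _))
  | _, _, _, _, _, _, _, _, .d2s0 => Sigma.natIso fun _ => Iso.refl _
  | _, _, _, _, _, _, _, _, .d0s1 => Sigma.natIso fun _ => Iso.refl _
  | _, _, _, _, _, _, _, _, .s0s0 => Sigma.natIso fun _ => Iso.refl _

/-- The unit isomorphisms by which the cyclic bar diagram satisfies
the simplicial identities `b ∘ a = id`. -/
def triangleIso : ∀ {k l : Lvl} {a : Op k l} {b : Op l k},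
    Triangle a b → (op B a ⋙ op B b ≅ 𝟭 (Level B k))
  | _, _, _, _, .d0s0 => Sigma.natIso fun _ => NatIso.ofComponents
      (fun F => (Sigma.incl _).mapIso (ρ_ F))
      (fun _ => congrArg Sigma.SigmaHom.mk (hcomp_rightUnitor _))
  | _, _, _, _, .d1s0 => Sigma.natIso fun _ => NatIso.ofComponents
      (fun F => (Sigma.incl _).mapIso (λ_ F))
      (fun _ => congrArg Sigma.SigmaHom.mk (hcomp_leftUnitor _))
  | _, _, _, _, .d0s0' => Sigma.natIso fun _ => NatIso.ofComponents
      (fun F => (Sigma.incl _).mapIso (Iso.prod (ρ_ F.1) (Iso.refl F.2)))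
      (fun _ => congrArg Sigma.SigmaHom.mk
        (Prod.ext (hcomp_rightUnitor _) ((Category.comp_id _).trans (Category.id_comp _).symm)))
  | _, _, _, _, .d1s0' => Sigma.natIso fun _ => NatIso.ofComponents
      (fun F => (Sigma.incl _).mapIso (Iso.prod (Iso.refl F.1) (λ_ F.2)))
      (fun _ => congrArg Sigma.SigmaHom.mk
        (Prod.ext ((Category.comp_id _).trans (Category.id_comp _).symm) (hcomp_leftUnitor _)))
  | _, _, _, _, .d1s1' => Sigma.natIso fun _ => NatIso.ofComponents
      (fun F => (Sigma.incl _).mapIso (Iso.prod (Iso.refl F.1) (ρ_ F.2)))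
      (fun _ => congrArg Sigma.SigmaHom.mk
        (Prod.ext ((Category.comp_id _).trans (Category.id_comp _).symm) (hcomp_rightUnitor _)))
  | _, _, _, _, .d2s1' => Sigma.natIso fun _ => NatIso.ofComponents
      (fun F => (Sigma.incl _).mapIso (Iso.prod (λ_ F.1) (Iso.refl F.2)))
      (fun _ => congrArg Sigma.SigmaHom.mk
        (Prod.ext (hcomp_leftUnitor _) ((Category.comp_id _).trans (Category.id_comp _).symm)))

/-- An object of one of the levels of the cyclic bar diagram. -/
structure Vertex where
  /-- the level -/
  {lvl : Lvl}
  /-- the object -/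
  obj : Level B lvl

variable {B} in
/-- Generating morphisms of the pseudocolimit of the cyclic bar diagram: the morphisms of the
levels, and for every operator `a` and every object `x` a morphism `glue a x : x ⟶ a x` with a
formal inverse `unglue a x`. -/
inductive Gen : Vertex B → Vertex B → Type (max u v w)
  | cell {k : Lvl} {x y : Level B k} (f : x ⟶ y) : Gen ⟨x⟩ ⟨y⟩
  | glue {k l : Lvl} (a : Op k l) (x : Level B k) : Gen ⟨x⟩ ⟨(op B a).obj x⟩
  | unglue {k l : Lvl} (a : Op k l) (x : Level B k) : Gen ⟨(op B a).obj x⟩ ⟨x⟩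

instance : Quiver.{max u v w} (Vertex B) where
  Hom := Gen

section

variable {B}
variable {k l : Lvl}

/-- The vertex of an object, as an object of the free category. -/
abbrev pt (x : Level B k) : Paths (Vertex B) := (Paths.of (Vertex B)).obj ⟨x⟩

/-- The generator given by a morphism of a level, in the free category. -/
abbrev cell {x y : Level B k} (f : x ⟶ y) : pt x ⟶ pt y :=
  (Paths.of (Vertex B)).map (Gen.cell f : (⟨x⟩ : Vertex B) ⟶ ⟨y⟩)

/-- The generator `x ⟶ a x`, in the free category. -/
abbrev glue (a : Op k l) (x : Level B k) : pt x ⟶ pt ((op B a).obj x) :=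
  (Paths.of (Vertex B)).map (Gen.glue a x : (⟨x⟩ : Vertex B) ⟶ ⟨(op B a).obj x⟩)

/-- The generator `a x ⟶ x`, in the free category. -/
abbrev unglue (a : Op k l) (x : Level B k) : pt ((op B a).obj x) ⟶ pt x :=
  (Paths.of (Vertex B)).map (Gen.unglue a x : (⟨(op B a).obj x⟩ : Vertex B) ⟶ ⟨x⟩)

end

/-- The relations of the pseudocolimit of the cyclic bar diagram: every level maps functorially to
the pseudocolimit, `glue a` is a natural isomorphism between the functor on the source level of
`a` and the composite of `a` with the functor on its target level, and these natural isomorphisms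
are compatible with the isomorphisms that witness the simplicial identities. -/
inductive Rel : HomRel (Paths (Vertex B))
  | cell_id {k : Lvl} (x : Level B k) : Rel (cell (𝟙 x)) (𝟙 (pt x))
  | cell_comp {k : Lvl} {x y z : Level B k} (f : x ⟶ y) (g : y ⟶ z) :
      Rel (cell (f ≫ g)) (cell f ≫ cell g)
  | glue_unglue {k l : Lvl} (a : Op k l) (x : Level B k) :
      Rel (glue a x ≫ unglue a x) (𝟙 (pt x))
  | unglue_glue {k l : Lvl} (a : Op k l) (x : Level B k) :
      Rel (unglue a x ≫ glue a x) (𝟙 (pt ((op B a).obj x)))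
  | glue_naturality {k l : Lvl} (a : Op k l) {x y : Level B k} (f : x ⟶ y) :
      Rel (cell f ≫ glue a y) (glue a x ≫ cell ((op B a).map f))
  | square {k l l' m : Lvl} {a : Op k l} {b : Op l m} {a' : Op k l'} {b' : Op l' m}
      (s : Square a b a' b') (x : Level B k) :
      Rel (glue a x ≫ glue b ((op B a).obj x) ≫ cell ((squareIso B s).hom.app x))
        (glue a' x ≫ glue b' ((op B a').obj x))
  | triangle {k l : Lvl} {a : Op k l} {b : Op l k} (t : Triangle a b) (x : Level B k) :
      Rel (glue a x ≫ glue b ((op B a).obj x) ≫ cell ((triangleIso B t).hom.app x)) (𝟙 (pt x))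

end BiHH

/-- The Hochschild homology of a bicategory `B`: the pseudocolimit (colimit in the `(2,1)`-category
of categories) of the cyclic bar diagram of `B`. It suffices to use the `2`-truncated diagram, since
the inclusion of the `2`-truncated simplex category is final for colimits in a `(2,1)`-category. -/
abbrev biHH (B : Type u) [Bicategory.{w, v} B] : Type (max u v) :=
  CategoryTheory.Quotient (BiHH.Rel B)

namespace BiHH

section

variable (B : Type u) [Bicategory.{w, v} B]

/-- The functor from a level of the cyclic bar diagram to the Hochschild homology. -/
def ι (k : Lvl) : Level B k ⥤ biHH B where
  obj x := (CategoryTheory.Quotient.functor (Rel B)).obj (pt x)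
  map f := (CategoryTheory.Quotient.functor (Rel B)).map (cell f)
  map_id x := (CategoryTheory.Quotient.sound _ (Rel.cell_id x)).trans (CategoryTheory.Functor.map_id _ _)
  map_comp f g :=
    (CategoryTheory.Quotient.sound _ (Rel.cell_comp f g)).trans (Functor.map_comp _ _ _)

/-- The natural isomorphism `ι k ≅ op a ⋙ ι l` in the universal pseudo-cocone. -/
def glueIso {k l : Lvl} (a : Op k l) : ι B k ≅ op B a ⋙ ι B l :=
  NatIso.ofComponents
    (fun x =>
      { hom := (CategoryTheory.Quotient.functor (Rel B)).map (glue a x)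
        inv := (CategoryTheory.Quotient.functor (Rel B)).map (unglue a x)
        hom_inv_id := ((Functor.map_comp _ _ _).symm.trans
          (CategoryTheory.Quotient.sound _ (Rel.glue_unglue a x))).trans (CategoryTheory.Functor.map_id _ _)
        inv_hom_id := ((Functor.map_comp _ _ _).symm.trans
          (CategoryTheory.Quotient.sound _ (Rel.unglue_glue a x))).trans (CategoryTheory.Functor.map_id _ _) })
    (fun f => ((Functor.map_comp _ _ _).symm.trans
      (CategoryTheory.Quotient.sound _ (Rel.glue_naturality a f))).trans (Functor.map_comp _ _ _))

theorem glueIso_square {k l l' m : Lvl} {a : Op k l} {b : Op l m} {a' : Op k l'} {b' : Op l' m}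
    (s : Square a b a' b') (x : Level B k) :
    (glueIso B a).hom.app x ≫ (glueIso B b).hom.app ((op B a).obj x) ≫
        (ι B m).map ((squareIso B s).hom.app x) =
      (glueIso B a').hom.app x ≫ (glueIso B b').hom.app ((op B a').obj x) :=
  CategoryTheory.Quotient.sound _ (Rel.square s x)

theorem glueIso_triangle {k l : Lvl} {a : Op k l} {b : Op l k} (t : Triangle a b)
    (x : Level B k) :
    (glueIso B a).hom.app x ≫ (glueIso B b).hom.app ((op B a).obj x) ≫
        (ι B k).map ((triangleIso B t).hom.app x) = 𝟙 ((ι B k).obj x) :=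
  CategoryTheory.Quotient.sound _ (Rel.triangle t x)

end

section Desc

variable {B : Type u} [Bicategory.{w, v} B]
variable {D : Type*} [Category* D] (φ : ∀ k : Lvl, Level B k ⥤ D)
  (θ : ∀ {k l : Lvl} (a : Op k l), φ k ≅ op B a ⋙ φ l)

/-- The prefunctor underlying `desc`. -/
def descGen : Vertex B ⥤q D where
  obj x := (φ x.lvl).obj x.obj
  map
    | .cell f => (φ _).map f
    | .glue a x => (θ a).hom.app x
    | .unglue a x => (θ a).inv.app x

/-- The functor out of the Hochschild homology given by a pseudo-cocone on the cyclic bar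
diagram. -/
def desc
    (hs : ∀ {k l l' m : Lvl} {a : Op k l} {b : Op l m} {a' : Op k l'} {b' : Op l' m}
      (s : Square a b a' b') (x : Level B k),
      (θ a).hom.app x ≫ (θ b).hom.app ((op B a).obj x) ≫
          (φ m).map ((squareIso B s).hom.app x) =
        (θ a').hom.app x ≫ (θ b').hom.app ((op B a').obj x))
    (ht : ∀ {k l : Lvl} {a : Op k l} {b : Op l k} (t : Triangle a b) (x : Level B k),
      (θ a).hom.app x ≫ (θ b).hom.app ((op B a).obj x) ≫
          (φ k).map ((triangleIso B t).hom.app x) = 𝟙 ((φ k).obj x)) :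
    biHH B ⥤ D :=
  CategoryTheory.Quotient.lift (Rel B) (Paths.lift (descGen φ θ)) (by
    intro x y f g h
    cases h with
    | cell_id x =>
      show 𝟙 _ ≫ (φ _).map (𝟙 _) = 𝟙 _
      simp
    | cell_comp f g =>
      show 𝟙 _ ≫ (φ _).map (f ≫ g) = (𝟙 _ ≫ (φ _).map f) ≫ (φ _).map g
      simp
    | glue_unglue a x =>
      show (𝟙 _ ≫ (θ a).hom.app x) ≫ (θ a).inv.app x = 𝟙 _
      simp
    | unglue_glue a x =>
      show (𝟙 _ ≫ (θ a).inv.app _) ≫ (θ a).hom.app _ = 𝟙 _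
      simp
    | glue_naturality a f =>
      show (𝟙 _ ≫ (φ _).map f) ≫ (θ a).hom.app _ =
        (𝟙 _ ≫ (θ a).hom.app _) ≫ (op B a ⋙ φ _).map f
      simp only [Category.id_comp]
      exact (θ a).hom.naturality f
    | @square _ _ _ _ a b a' b' s x =>
      show ((𝟙 _ ≫ (θ a).hom.app x) ≫ (θ b).hom.app _) ≫ (φ _).map ((squareIso B s).hom.app x) =
        (𝟙 _ ≫ (θ a').hom.app x) ≫ (θ b').hom.app _
      simp only [Category.id_comp, Category.assoc]
      exact hs s x
    | @triangle _ _ a b t x =>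
      show ((𝟙 _ ≫ (θ a).hom.app x) ≫ (θ b).hom.app _) ≫
        (φ _).map ((triangleIso B t).hom.app x) = 𝟙 _
      simp only [Category.id_comp, Category.assoc]
      exact ht t x)

end Desc

section Functoriality

universe w' v' u'

variable {B : Type u} [Bicategory.{w, v} B] {C : Type u'} [Bicategory.{w', v'} C]
variable (P : Pseudofunctor B C)

/-- The functor induced by a pseudofunctor on a level of the cyclic bar diagram. -/
def levelMap : ∀ k : Lvl, Level B k ⥤ Level C k
  | .zero => Sigma.desc fun X : B => P.mapFunctor X X ⋙
      Sigma.incl (C := fun X : C => (X ⟶ X)) (P.obj X)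
  | .one => Sigma.desc fun X : B × B =>
      (P.mapFunctor X.1 X.2).prod (P.mapFunctor X.2 X.1) ⋙
      Sigma.incl (C := fun X : C × C => (X.1 ⟶ X.2) × (X.2 ⟶ X.1)) (P.obj X.1, P.obj X.2)
  | .two => Sigma.desc fun X : B × B × B =>
      (P.mapFunctor X.1 X.2.1).prod
        ((P.mapFunctor X.2.1 X.2.2).prod (P.mapFunctor X.2.2 X.1)) ⋙
      Sigma.incl (C := fun X : C × C × C => (X.1 ⟶ X.2.1) × (X.2.1 ⟶ X.2.2) × (X.2.2 ⟶ X.1))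
        (P.obj X.1, P.obj X.2.1, P.obj X.2.2)

theorem slide {E : Type*} [Category E] {x y : E} (f : x ⟶ y) : f ≫ 𝟙 y = 𝟙 x ≫ f :=
  (Category.comp_id f).trans (Category.id_comp f).symm

theorem mapId_slide (X : B) :
    𝟙 (𝟙 (P.obj X)) ≫ (P.mapId X).inv = (P.mapId X).inv ≫ P.map₂ (𝟙 (𝟙 X)) := by
  simp

theorem hcomp_mapComp_inv {a b c : B} {F F' : a ⟶ b} {G G' : b ⟶ c} (α : F ⟶ F') (β : G ⟶ G') :
    hcomp (P.map₂ α) (P.map₂ β) ≫ (P.mapComp F' G').inv =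
      (P.mapComp F G).inv ≫ P.map₂ (hcomp α β) := by
  simp [hcomp]

theorem map_associator {a b c d : B} (F : a ⟶ b) (G : b ⟶ c) (H : c ⟶ d) :
    hcomp (P.mapComp F G).inv (𝟙 (P.map H)) ≫ (P.mapComp (F ≫ G) H).inv ≫
        P.map₂ (α_ F G H).hom =
      (α_ (P.map F) (P.map G) (P.map H)).hom ≫ hcomp (𝟙 (P.map F)) (P.mapComp G H).inv ≫
        (P.mapComp F (G ≫ H)).inv := by
  simp [hcomp, Bicategory.inv_hom_whiskerRight_assoc]

theorem map_associator_inv {a b c d : B} (F : a ⟶ b) (G : b ⟶ c) (H : c ⟶ d) :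
    hcomp (𝟙 (P.map F)) (P.mapComp G H).inv ≫ (P.mapComp F (G ≫ H)).inv ≫
        P.map₂ (α_ F G H).inv =
      (α_ (P.map F) (P.map G) (P.map H)).inv ≫ hcomp (P.mapComp F G).inv (𝟙 (P.map H)) ≫
        (P.mapComp (F ≫ G) H).inv := by
  rw [← cancel_epi (α_ (P.map F) (P.map G) (P.map H)).hom, Iso.hom_inv_id_assoc]
  have h := map_associator P F G H
  have h' := congrArg (· ≫ P.map₂ (α_ F G H).inv) h
  simp only [Category.assoc, ← P.map₂_comp, Iso.hom_inv_id, P.map₂_id, Category.comp_id] at h'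
  exact h'.symm

theorem map_rightUnitor {a b : B} (F : a ⟶ b) :
    hcomp (𝟙 (P.map F)) (P.mapId b).inv ≫ (P.mapComp F (𝟙 b)).inv ≫ P.map₂ (ρ_ F).hom =
      (ρ_ (P.map F)).hom := by
  simp [hcomp]

theorem map_leftUnitor {a b : B} (F : a ⟶ b) :
    hcomp (P.mapId a).inv (𝟙 (P.map F)) ≫ (P.mapComp (𝟙 a) F).inv ≫ P.map₂ (λ_ F).hom =
      (λ_ (P.map F)).hom := by
  simp [hcomp]

/-- The compatibility isomorphism of `levelMap` with `d10`. -/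
def opIso_d10 : levelMap P .one ⋙ op C .d10 ≅ op B .d10 ⋙ levelMap P .zero :=
  Sigma.natIso fun _ => NatIso.ofComponents
      (fun F => (Sigma.incl _).mapIso (P.mapComp F.1 F.2).symm)
      (fun _ => congrArg Sigma.SigmaHom.mk (hcomp_mapComp_inv P _ _))

/-- The compatibility isomorphism of `levelMap` with `d11`. -/
def opIso_d11 : levelMap P .one ⋙ op C .d11 ≅ op B .d11 ⋙ levelMap P .zero :=
  Sigma.natIso fun _ => NatIso.ofComponents
      (fun F => (Sigma.incl _).mapIso (P.mapComp F.2 F.1).symm)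
      (fun _ => congrArg Sigma.SigmaHom.mk (hcomp_mapComp_inv P _ _))

/-- The compatibility isomorphism of `levelMap` with `s00`. -/
def opIso_s00 : levelMap P .zero ⋙ op C .s00 ≅ op B .s00 ⋙ levelMap P .one :=
  Sigma.natIso fun X => NatIso.ofComponents
      (fun F => (Sigma.incl _).mapIso (Iso.prod (Iso.refl (P.map F)) (P.mapId X).symm))
      (fun _ => congrArg Sigma.SigmaHom.mk (Prod.ext (slide _) (mapId_slide P _)))

/-- The compatibility isomorphism of `levelMap` with `d20`. -/
def opIso_d20 : levelMap P .two ⋙ op C .d20 ≅ op B .d20 ⋙ levelMap P .one :=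
  Sigma.natIso fun _ => NatIso.ofComponents
      (fun F => (Sigma.incl _).mapIso
        (Iso.prod (P.mapComp F.1 F.2.1).symm (Iso.refl (P.map F.2.2))))
      (fun _ => congrArg Sigma.SigmaHom.mk (Prod.ext (hcomp_mapComp_inv P _ _) (slide _)))

/-- The compatibility isomorphism of `levelMap` with `d21`. -/
def opIso_d21 : levelMap P .two ⋙ op C .d21 ≅ op B .d21 ⋙ levelMap P .one :=
  Sigma.natIso fun _ => NatIso.ofComponents
      (fun F => (Sigma.incl _).mapIso
        (Iso.prod (Iso.refl (P.map F.1)) (P.mapComp F.2.1 F.2.2).symm))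
      (fun _ => congrArg Sigma.SigmaHom.mk (Prod.ext (slide _) (hcomp_mapComp_inv P _ _)))

/-- The compatibility isomorphism of `levelMap` with `d22`. -/
def opIso_d22 : levelMap P .two ⋙ op C .d22 ≅ op B .d22 ⋙ levelMap P .one :=
  Sigma.natIso fun _ => NatIso.ofComponents
      (fun F => (Sigma.incl _).mapIso
        (Iso.prod (P.mapComp F.2.2 F.1).symm (Iso.refl (P.map F.2.1))))
      (fun _ => congrArg Sigma.SigmaHom.mk (Prod.ext (hcomp_mapComp_inv P _ _) (slide _)))

/-- The compatibility isomorphism of `levelMap` with `s10`. -/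
def opIso_s10 : levelMap P .one ⋙ op C .s10 ≅ op B .s10 ⋙ levelMap P .two :=
  Sigma.natIso fun X => NatIso.ofComponents
      (fun F => (Sigma.incl _).mapIso
        (Iso.prod (Iso.refl (P.map F.1)) (Iso.prod (P.mapId X.2).symm (Iso.refl (P.map F.2)))))
      (fun _ => congrArg Sigma.SigmaHom.mk (Prod.ext (slide _) (Prod.ext (mapId_slide P _) (slide _))))

/-- The compatibility isomorphism of `levelMap` with `s11`. -/
def opIso_s11 : levelMap P .one ⋙ op C .s11 ≅ op B .s11 ⋙ levelMap P .two :=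
  Sigma.natIso fun X => NatIso.ofComponents
      (fun F => (Sigma.incl _).mapIso
        (Iso.prod (Iso.refl (P.map F.1)) (Iso.prod (Iso.refl (P.map F.2)) (P.mapId X.1).symm)))
      (fun _ => congrArg Sigma.SigmaHom.mk (Prod.ext (slide _) (Prod.ext (slide _) (mapId_slide P _))))

/-- The functors `levelMap` commute with the operators, up to the structure isomorphisms of the
pseudofunctor. -/
def opIso : ∀ {k l : Lvl} (a : Op k l), levelMap P k ⋙ op C a ≅ op B a ⋙ levelMap P l
  | _, _, .d10 => opIso_d10 P
  | _, _, .d11 => opIso_d11 P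
  | _, _, .s00 => opIso_s00 P
  | _, _, .d20 => opIso_d20 P
  | _, _, .d21 => opIso_d21 P
  | _, _, .d22 => opIso_d22 P
  | _, _, .s10 => opIso_s10 P
  | _, _, .s11 => opIso_s11 P

theorem square_compat {k l l' m : Lvl} {a : Op k l} {b : Op l m} {a' : Op k l'}
    {b' : Op l' m} (s : Square a b a' b') (x : Level B k) :
    (op C b).map ((opIso P a).hom.app x) ≫ (opIso P b).hom.app ((op B a).obj x) ≫
        (levelMap P m).map ((squareIso B s).hom.app x) =
      (squareIso C s).hom.app ((levelMap P k).obj x) ≫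
        (op C b').map ((opIso P a').hom.app x) ≫ (opIso P b').hom.app ((op B a').obj x) := by
  cases s with
  | d0d0 =>
    obtain ⟨_, F, G, H⟩ := x
    exact congrArg Sigma.SigmaHom.mk (map_associator P F G H)
  | d1d0 =>
    obtain ⟨_, F, G, H⟩ := x
    exact congrArg Sigma.SigmaHom.mk (map_associator_inv P H F G)
  | d1d1 =>
    obtain ⟨_, F, G, H⟩ := x
    exact congrArg Sigma.SigmaHom.mk (map_associator P G H F)
  | d2s0 =>
    obtain ⟨X, F, G⟩ := x
    exact congrArg Sigma.SigmaHom.mk (Prod.ext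
      (show hcomp (𝟙 (P.map G)) (𝟙 (P.map F)) ≫ (P.mapComp G F).inv ≫ P.map₂ (𝟙 (G ≫ F)) =
        𝟙 _ ≫ (P.mapComp G F).inv ≫ 𝟙 (P.map (G ≫ F)) by simp)
      (show (P.mapId X.2).inv ≫ 𝟙 _ ≫ P.map₂ (𝟙 (𝟙 X.2)) =
        𝟙 _ ≫ 𝟙 _ ≫ (P.mapId X.2).inv by simp))
  | d0s1 =>
    obtain ⟨X, F, G⟩ := x
    exact congrArg Sigma.SigmaHom.mk (Prod.ext
      (show hcomp (𝟙 (P.map F)) (𝟙 (P.map G)) ≫ (P.mapComp F G).inv ≫ P.map₂ (𝟙 (F ≫ G)) =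
        𝟙 _ ≫ (P.mapComp F G).inv ≫ 𝟙 (P.map (F ≫ G)) by simp)
      (show (P.mapId X.1).inv ≫ 𝟙 _ ≫ P.map₂ (𝟙 (𝟙 X.1)) =
        𝟙 _ ≫ 𝟙 _ ≫ (P.mapId X.1).inv by simp))
  | s0s0 =>
    obtain ⟨X, F⟩ := x
    exact congrArg Sigma.SigmaHom.mk (Prod.ext
      (show 𝟙 (P.map F) ≫ 𝟙 (P.map F) ≫ P.map₂ (𝟙 F) = 𝟙 _ ≫ 𝟙 (P.map F) ≫ 𝟙 (P.map F) by simp)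
      (Prod.ext
        (show 𝟙 _ ≫ (P.mapId X).inv ≫ P.map₂ (𝟙 (𝟙 X)) = 𝟙 _ ≫ (P.mapId X).inv ≫ 𝟙 _ by simp)
        (show (P.mapId X).inv ≫ 𝟙 _ ≫ P.map₂ (𝟙 (𝟙 X)) = 𝟙 _ ≫ 𝟙 _ ≫ (P.mapId X).inv by simp)))

theorem triangle_compat {k l : Lvl} {a : Op k l} {b : Op l k}
    (t : Triangle a b) (x : Level B k) :
    (op C b).map ((opIso P a).hom.app x) ≫ (opIso P b).hom.app ((op B a).obj x) ≫
        (levelMap P k).map ((triangleIso B t).hom.app x) =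
      (triangleIso C t).hom.app ((levelMap P k).obj x) := by
  cases t with
  | d0s0 =>
    obtain ⟨_, F⟩ := x
    exact congrArg Sigma.SigmaHom.mk (map_rightUnitor P F)
  | d1s0 =>
    obtain ⟨_, F⟩ := x
    exact congrArg Sigma.SigmaHom.mk (map_leftUnitor P F)
  | d0s0' =>
    obtain ⟨_, F, G⟩ := x
    exact congrArg Sigma.SigmaHom.mk
      (Prod.ext (map_rightUnitor P F)
        (show 𝟙 (P.map G) ≫ 𝟙 (P.map G) ≫ P.map₂ (𝟙 G) = 𝟙 (P.map G) by simp))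
  | d1s0' =>
    obtain ⟨_, F, G⟩ := x
    exact congrArg Sigma.SigmaHom.mk
      (Prod.ext (show 𝟙 (P.map F) ≫ 𝟙 (P.map F) ≫ P.map₂ (𝟙 F) = 𝟙 (P.map F) by simp)
        (map_leftUnitor P G))
  | d1s1' =>
    obtain ⟨_, F, G⟩ := x
    exact congrArg Sigma.SigmaHom.mk
      (Prod.ext (show 𝟙 (P.map F) ≫ 𝟙 (P.map F) ≫ P.map₂ (𝟙 F) = 𝟙 (P.map F) by simp)
        (map_rightUnitor P G))
  | d2s1' =>
    obtain ⟨_, F, G⟩ := x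
    exact congrArg Sigma.SigmaHom.mk
      (Prod.ext (map_leftUnitor P F)
        (show 𝟙 (P.map G) ≫ 𝟙 (P.map G) ≫ P.map₂ (𝟙 G) = 𝟙 (P.map G) by simp))

theorem square_aux {E : Type*} [Category* E] {x₀ x₁ x₂ x₃ x₄ x₅ y y' x₁' x₂' x₃' : E}
    {gA : x₀ ⟶ x₁} {oA : x₁ ⟶ x₂} {gB : x₂ ⟶ x₃} {oB : x₃ ⟶ x₄} {L : x₄ ⟶ x₅}
    {gB₁ : x₁ ⟶ y} {OA : y ⟶ x₃} {S : y ⟶ y'} {gA' : x₀ ⟶ x₁'} {oA' : x₁' ⟶ x₂'}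
    {gB' : x₂' ⟶ x₃'} {oB' : x₃' ⟶ x₅} {gB₁' : x₁' ⟶ y'} {OA' : y' ⟶ x₃'}
    (n : oA ≫ gB = gB₁ ≫ OA) (n' : oA' ≫ gB' = gB₁' ≫ OA')
    (e : OA ≫ oB ≫ L = S ≫ OA' ≫ oB') (h : gA ≫ gB₁ ≫ S = gA' ≫ gB₁') :
    (gA ≫ oA) ≫ (gB ≫ oB) ≫ L = (gA' ≫ oA') ≫ gB' ≫ oB' := by
  simp only [Category.assoc]
  rw [reassoc_of% n, e, reassoc_of% h, reassoc_of% n']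

theorem triangle_aux {E : Type*} [Category* E] {x₀ x₁ x₂ x₃ x₄ y : E}
    {gA : x₀ ⟶ x₁} {oA : x₁ ⟶ x₂} {gB : x₂ ⟶ x₃} {oB : x₃ ⟶ x₄} {L : x₄ ⟶ x₀}
    {gB₁ : x₁ ⟶ y} {OA : y ⟶ x₃} {S : y ⟶ x₀}
    (n : oA ≫ gB = gB₁ ≫ OA) (e : OA ≫ oB ≫ L = S) (h : gA ≫ gB₁ ≫ S = 𝟙 x₀) :
    (gA ≫ oA) ≫ (gB ≫ oB) ≫ L = 𝟙 x₀ := by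
  simp only [Category.assoc]
  rw [reassoc_of% n, e, h]

/-- The functor induced by a pseudofunctor on Hochschild homology. -/
def map : biHH B ⥤ biHH C :=
  desc (fun k => levelMap P k ⋙ ι C k)
    (fun {k l} a => Functor.isoWhiskerLeft (levelMap P k) (glueIso C a) ≪≫
      Functor.isoWhiskerRight (opIso P a) (ι C l))
    (fun {_ _ _ m a b a' b'} s x => square_aux
      ((glueIso C b).hom.naturality ((opIso P a).hom.app x))
      ((glueIso C b').hom.naturality ((opIso P a').hom.app x))
      (by
        have e := congrArg (ι C m).map (square_compat P s x)
        simp only [Functor.map_comp] at e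
        exact e)
      (glueIso_square C s ((levelMap P _).obj x)))
    (fun {k _ a b} t x => triangle_aux
      ((glueIso C b).hom.naturality ((opIso P a).hom.app x))
      (by
        have e := congrArg (ι C k).map (triangle_compat P t x)
        simp only [Functor.map_comp] at e
        exact e)
      (glueIso_triangle C t ((levelMap P _).obj x)))

end Functoriality

end BiHH

/-! ### The free adjunction -/

/-- The objects of the free adjunction. -/
inductive FreeAdj : Type
  | zero | one

namespace FreeAdj

/-- The generating `1`-cells of the free adjunction. -/
inductive Arrow : FreeAdj → FreeAdj → Type
  /-- the left adjoint -/
  | f : Arrow .zero .one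
  /-- the right adjoint -/
  | g : Arrow .one .zero

instance : Quiver FreeAdj where
  Hom := Arrow

/-- The `1`-cells of the free adjunction: the morphisms of the free category on `f` and `g`,
that is, paths of composable generators. -/
abbrev Word (a b : FreeAdj) : Type := Quiver.Path a b

/-- The generating `1`-cell `f : 0 ⟶ 1`. -/
abbrev wf : Word .zero .one := Quiver.Hom.toPath (V := FreeAdj) Arrow.f

/-- The generating `1`-cell `g : 1 ⟶ 0`. -/
abbrev wg : Word .one .zero := Quiver.Hom.toPath (V := FreeAdj) Arrow.g

/-- Formal composites of `2`-cells of the free adjunction: they are generated from the unit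
`u : id ⟶ f g` and the counit `c : g f ⟶ id` under identities, vertical composition, and
whiskering from the left and from the right. (`eqTo` is the identity `2`-cell between two equal
`1`-cells.) -/
inductive Cell : ∀ {a b : FreeAdj}, Word a b → Word a b → Type
  | eqTo {a b : FreeAdj} {p q : Word a b} (h : p = q) : Cell p q
  | vcomp {a b : FreeAdj} {p q r : Word a b} (α : Cell p q) (β : Cell q r) : Cell p r
  | wl {a b c : FreeAdj} (p : Word a b) {q r : Word b c} (α : Cell q r) : Cell (p.comp q) (p.comp r)
  | wr {a b c : FreeAdj} {p q : Word a b} (α : Cell p q) (r : Word b c) : Cell (p.comp r) (q.comp r)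
  | unit : Cell (Quiver.Path.nil : Word .zero .zero) (wf.comp wg)
  | counit : Cell (wg.comp wf) (Quiver.Path.nil : Word .one .one)

open Quiver.Path (nil)

/-- The relations between formal composites of `2`-cells of the free adjunction: the axioms of a
strict `2`-category (compatibility with vertical composition and whiskering, the category axioms,
the whiskering axioms, the interchange law) and the two triangle identities. -/
inductive Rel : ∀ {a b : FreeAdj} {p q : Word a b}, Cell p q → Cell p q → Prop
  | vcomp_left {a b : FreeAdj} {p q r : Word a b} (α : Cell p q) {β β' : Cell q r} :
      Rel β β' → Rel (.vcomp α β) (.vcomp α β')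
  | vcomp_right {a b : FreeAdj} {p q r : Word a b} {α α' : Cell p q} (β : Cell q r) :
      Rel α α' → Rel (.vcomp α β) (.vcomp α' β)
  | wl_congr {a b c : FreeAdj} (p : Word a b) {q r : Word b c} {α α' : Cell q r} :
      Rel α α' → Rel (.wl p α) (.wl p α')
  | wr_congr {a b c : FreeAdj} {p q : Word a b} {α α' : Cell p q} (r : Word b c) :
      Rel α α' → Rel (.wr α r) (.wr α' r)
  | id_comp {a b : FreeAdj} {p q : Word a b} (α : Cell p q) : Rel (.vcomp (.eqTo rfl) α) α
  | comp_id {a b : FreeAdj} {p q : Word a b} (α : Cell p q) : Rel (.vcomp α (.eqTo rfl)) α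
  | assoc {a b : FreeAdj} {p q r s : Word a b} (α : Cell p q) (β : Cell q r) (γ : Cell r s) :
      Rel (.vcomp (.vcomp α β) γ) (.vcomp α (.vcomp β γ))
  | wl_id {a b c : FreeAdj} (p : Word a b) (q : Word b c) :
      Rel (.wl p (.eqTo (rfl : q = q))) (.eqTo rfl)
  | wl_vcomp {a b c : FreeAdj} (p : Word a b) {q r s : Word b c} (α : Cell q r) (β : Cell r s) :
      Rel (.wl p (.vcomp α β)) (.vcomp (.wl p α) (.wl p β))
  | id_wl {a b : FreeAdj} {p q : Word a b} (α : Cell p q) :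
      Rel (.wl nil α)
        (.vcomp (.eqTo (Quiver.Path.nil_comp p))
          (.vcomp α (.eqTo (Quiver.Path.nil_comp q).symm)))
  | comp_wl {a b c d : FreeAdj} (p : Word a b) (q : Word b c) {r s : Word c d} (α : Cell r s) :
      Rel (.wl (p.comp q) α)
        (.vcomp (.eqTo (Quiver.Path.comp_assoc p q r))
          (.vcomp (.wl p (.wl q α)) (.eqTo (Quiver.Path.comp_assoc p q s).symm)))
  | id_wr {a b c : FreeAdj} (p : Word a b) (q : Word b c) :
      Rel (.wr (.eqTo (rfl : p = p)) q) (.eqTo rfl)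
  | vcomp_wr {a b c : FreeAdj} {p q r : Word a b} (α : Cell p q) (β : Cell q r) (s : Word b c) :
      Rel (.wr (.vcomp α β) s) (.vcomp (.wr α s) (.wr β s))
  | wr_id {a b : FreeAdj} {p q : Word a b} (α : Cell p q) :
      Rel (.wr α nil)
        (.vcomp (.eqTo (Quiver.Path.comp_nil p))
          (.vcomp α (.eqTo (Quiver.Path.comp_nil q).symm)))
  | wr_comp {a b c d : FreeAdj} {p q : Word a b} (α : Cell p q) (r : Word b c) (s : Word c d) :
      Rel (.wr α (r.comp s))
        (.vcomp (.eqTo (Quiver.Path.comp_assoc p r s).symm)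
          (.vcomp (.wr (.wr α r) s) (.eqTo (Quiver.Path.comp_assoc q r s))))
  | wl_wr {a b c d : FreeAdj} (p : Word a b) {q r : Word b c} (α : Cell q r) (s : Word c d) :
      Rel (.wr (.wl p α) s)
        (.vcomp (.eqTo (Quiver.Path.comp_assoc p q s))
          (.vcomp (.wl p (.wr α s)) (.eqTo (Quiver.Path.comp_assoc p r s).symm)))
  | exchange {a b c : FreeAdj} {p q : Word a b} {r s : Word b c} (α : Cell p q) (β : Cell r s) :
      Rel (.vcomp (.wl p β) (.wr α s)) (.vcomp (.wr α r) (.wl q β))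
  | left_triangle :
      Rel (.vcomp (.wr .unit wf) (.vcomp (.eqTo (Quiver.Path.comp_assoc wf wg wf))
          (.wl wf .counit)))
        (.eqTo rfl)
  | right_triangle :
      Rel (.vcomp (.wl wg .unit) (.vcomp (.eqTo (Quiver.Path.comp_assoc wg wf wg).symm)
          (.wr .counit wg)))
        (.eqTo rfl)

/-- The `2`-cells of the free adjunction. -/
def Cell₂ {a b : FreeAdj} (p q : Word a b) : Type := Quot (Rel (p := p) (q := q))

instance homCategory (a b : FreeAdj) : Category (Word a b) where
  Hom p q := Cell₂ p q
  id p := Quot.mk _ (.eqTo rfl)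
  comp := Quot.map₂ Cell.vcomp (fun α _ _ h => .vcomp_left α h) (fun _ _ β h => .vcomp_right β h)
  id_comp := by rintro _ _ ⟨α⟩; exact Quot.sound (.id_comp α)
  comp_id := by rintro _ _ ⟨α⟩; exact Quot.sound (.comp_id α)
  assoc := by rintro _ _ _ _ ⟨α⟩ ⟨β⟩ ⟨γ⟩; exact Quot.sound (.assoc α β γ)

/-- Whiskering of a `2`-cell from the left. -/
def whiskerL {a b c : FreeAdj} (p : Word a b) {q r : Word b c} (α : q ⟶ r) : p.comp q ⟶ p.comp r :=
  Quot.map (Cell.wl p) (fun _ _ h => .wl_congr p h) α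

/-- Whiskering of a `2`-cell from the right. -/
def whiskerR {a b c : FreeAdj} {p q : Word a b} (α : p ⟶ q) (r : Word b c) : p.comp r ⟶ q.comp r :=
  Quot.map (fun α => Cell.wr α r) (fun _ _ h => .wr_congr r h) α

theorem whiskerL_eqToHom {a b c : FreeAdj} (p : Word a b) {q r : Word b c} (h : q = r) :
    whiskerL p (eqToHom h) = eqToHom (congrArg p.comp h) := by
  subst h; exact Quot.sound (.wl_id p q)

theorem whiskerR_eqToHom {a b c : FreeAdj} {p q : Word a b} (h : p = q) (r : Word b c) :
    whiskerR (eqToHom h) r = eqToHom (congrArg (·.comp r) h) := by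
  subst h; exact Quot.sound (.id_wr p r)

theorem mk_eqTo {a b : FreeAdj} {p q : Word a b} (h : p = q) :
    (Quot.mk _ (.eqTo h) : Cell₂ p q) = (eqToHom h : p ⟶ q) := by
  subst h; rfl

theorem mk_conj {a b : FreeAdj} {p p' q q' : Word a b} (h : p = p') (α : Cell p' q') (h' : q' = q) :
    (Quot.mk _ (.vcomp (.eqTo h) (.vcomp α (.eqTo h'))) : Cell₂ p q) =
      eqToHom h ≫ (Quot.mk _ α : Cell₂ p' q') ≫ eqToHom h' := by
  subst h h'; rfl

/-- The free adjunction: the strict `2`-category which is freely generated by objects `0`, `1`,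
`1`-cells `f : 0 ⟶ 1` and `g : 1 ⟶ 0` and `2`-cells `id ⟶ f g` and `g f ⟶ id`, subject to the
triangle identities. -/
instance : Bicategory FreeAdj where
  Hom a b := Word a b
  id _ := nil
  comp p q := Quiver.Path.comp p q
  homCategory := homCategory
  whiskerLeft := whiskerL
  whiskerRight := whiskerR
  associator p q r := eqToIso (Quiver.Path.comp_assoc p q r)
  leftUnitor p := eqToIso (Quiver.Path.nil_comp p)
  rightUnitor p := eqToIso (Quiver.Path.comp_nil p)
  whiskerLeft_id p q := Quot.sound (.wl_id p q)
  whiskerLeft_comp := by rintro _ _ _ p _ _ _ ⟨α⟩ ⟨β⟩; exact Quot.sound (.wl_vcomp p α β)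
  id_whiskerLeft := by
    rintro _ _ _ _ ⟨α⟩
    exact (Quot.sound (.id_wl α)).trans (mk_conj _ _ _)
  comp_whiskerLeft := by
    rintro _ _ _ _ p q _ _ ⟨α⟩
    exact (Quot.sound (.comp_wl p q α)).trans (mk_conj _ _ _)
  id_whiskerRight p q := Quot.sound (.id_wr p q)
  comp_whiskerRight := by rintro _ _ _ _ _ _ ⟨α⟩ ⟨β⟩ r; exact Quot.sound (.vcomp_wr α β r)
  whiskerRight_id := by
    rintro _ _ _ _ ⟨α⟩
    exact (Quot.sound (.wr_id α)).trans (mk_conj _ _ _)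
  whiskerRight_comp := by
    rintro _ _ _ _ _ _ ⟨α⟩ r s
    exact (Quot.sound (.wr_comp α r s)).trans (mk_conj _ _ _)
  whisker_assoc := by
    rintro _ _ _ _ p _ _ ⟨α⟩ s
    exact (Quot.sound (.wl_wr p α s)).trans (mk_conj _ _ _)
  whisker_exchange := by rintro _ _ _ _ _ _ _ ⟨α⟩ ⟨β⟩; exact Quot.sound (.exchange α β)
  pentagon p q r s := by
    simp [eqToIso, whiskerL_eqToHom, whiskerR_eqToHom]
  triangle p q := by
    have h := whiskerR_eqToHom (Quiver.Path.comp_nil p) q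
    simp only [eqToIso, whiskerL_eqToHom, eqToHom_trans]
    exact h.symm

instance : Bicategory.Strict FreeAdj where
  id_comp := Quiver.Path.nil_comp
  comp_id := Quiver.Path.comp_nil
  assoc := Quiver.Path.comp_assoc

end FreeAdj

/-- The free monad: the full sub-`2`-category of the free adjunction on the object `0`. -/
abbrev FreeMon : Type := InducedBicategory FreeAdj (fun _ : Unit => FreeAdj.zero)

/-- The free comonad: the full sub-`2`-category of the free adjunction on the object `1`. -/
abbrev FreeCoMon : Type := InducedBicategory FreeAdj (fun _ : Unit => FreeAdj.one)

/-- The inclusion of the free monad into the free adjunction. -/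
abbrev FreeMon.incl : Pseudofunctor FreeMon FreeAdj := InducedBicategory.forget.toPseudofunctor

/-- The inclusion of the free comonad into the free adjunction. -/
abbrev FreeCoMon.incl : Pseudofunctor FreeCoMon FreeAdj := InducedBicategory.forget.toPseudofunctor

/-! ### The paracyclic category -/

/-- The paracyclic category `Λ_∞`. Its objects are the natural numbers `n`. -/
structure Paracyclic : Type where
  /-- the underlying natural number -/
  deg : ℕ

namespace Paracyclic

/-- A morphism `n ⟶ m` of the paracyclic category is a monotone function `φ : ℤ → ℤ` such that
`φ (l + n + 1) = φ l + m + 1` for all `l`. -/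
@[ext]
structure Hom (X Y : Paracyclic) : Type where
  /-- the underlying function -/
  toFun : ℤ → ℤ
  monotone : Monotone toFun
  shift : ∀ l : ℤ, toFun (l + X.deg + 1) = toFun l + Y.deg + 1

instance : Category Paracyclic where
  Hom := Hom
  id X := ⟨id, monotone_id, fun _ => rfl⟩
  comp φ ψ := ⟨ψ.toFun ∘ φ.toFun, ψ.monotone.comp φ.monotone, fun l => by
    simp only [Function.comp_apply, φ.shift, ψ.shift]⟩

@[ext]
theorem hom_ext {X Y : Paracyclic} {φ ψ : X ⟶ Y} (h : ∀ l, φ.toFun l = ψ.toFun l) : φ = ψ :=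
  Hom.ext (funext h)

@[simp]
theorem id_toFun (X : Paracyclic) (l : ℤ) : Hom.toFun (𝟙 X) l = l := rfl

@[simp]
theorem comp_toFun {X Y Z : Paracyclic} (φ : X ⟶ Y) (ψ : Y ⟶ Z) (l : ℤ) :
    (φ ≫ ψ).toFun l = ψ.toFun (φ.toFun l) := rfl

theorem shift_mul {X Y : Paracyclic} (φ : X ⟶ Y) (l k : ℤ) :
    φ.toFun (l + k * (X.deg + 1)) = φ.toFun l + k * (Y.deg + 1) := by
  have h (l : ℤ) : φ.toFun (l + (X.deg + 1)) = φ.toFun l + (Y.deg + 1) := by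
    rw [← add_assoc, φ.shift, add_assoc]
  induction k with
  | zero => simp
  | succ i ih => rw [add_one_mul, ← add_assoc, h, ih]; ring
  | pred i ih =>
    have := h (l + (-(i : ℤ) - 1) * (X.deg + 1))
    rw [show l + (-(i : ℤ) - 1) * (X.deg + 1) + (X.deg + 1) = l + -(i : ℤ) * (X.deg + 1) by ring,
      ih] at this
    linarith

theorem exists_isLeast {X Y : Paracyclic} (φ : X ⟶ Y) (j : ℤ) :
    ∃ i, IsLeast {i : ℤ | j ≤ φ.toFun i} i := by
  have hY : (0 : ℤ) < Y.deg + 1 := by positivity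
  have hne : ∃ i : ℤ, j ≤ φ.toFun i := by
    refine ⟨0 + |j - φ.toFun 0| * (X.deg + 1), ?_⟩
    rw [shift_mul]
    nlinarith [le_abs_self (j - φ.toFun 0), abs_nonneg (j - φ.toFun 0)]
  have hbd : ∀ i : ℤ, j ≤ φ.toFun i → -(|φ.toFun 0 - j| + 1) * (X.deg + 1) ≤ i := by
    intro i hi
    by_contra! hlt
    have h1 := φ.monotone hlt.le
    have h2 := shift_mul φ 0 (-(|φ.toFun 0 - j| + 1))
    rw [zero_add] at h2
    rw [h2] at h1
    nlinarith [le_abs_self (φ.toFun 0 - j), abs_nonneg (φ.toFun 0 - j)]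
  obtain ⟨i, hi, hmin⟩ := Int.exists_least_of_bdd ⟨_, hbd⟩ hne
  exact ⟨i, hi, fun _ h => hmin _ h⟩

/-- The function `j ↦ min {i | j ≤ φ i}`, that is, the left adjoint of the monotone function `φ`. -/
noncomputable def dualFun {X Y : Paracyclic} (φ : X ⟶ Y) (j : ℤ) : ℤ :=
  (exists_isLeast φ j).choose

theorem dualFun_le_iff {X Y : Paracyclic} (φ : X ⟶ Y) (j i : ℤ) :
    dualFun φ j ≤ i ↔ j ≤ φ.toFun i := by
  have h := (exists_isLeast φ j).choose_spec
  exact ⟨fun hi => h.1.trans (φ.monotone hi), fun hi => h.2 hi⟩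

/-- The dual `φ^† : m ⟶ n` of a morphism `φ : n ⟶ m`: it is the left adjoint of `φ`. -/
noncomputable def dual {X Y : Paracyclic} (φ : X ⟶ Y) : Y ⟶ X where
  toFun := dualFun φ
  monotone j j' h := (dualFun_le_iff φ _ _).2 (h.trans ((dualFun_le_iff φ _ _).1 le_rfl))
  shift j := by
    refine eq_of_forall_ge_iff fun i => ?_
    rw [dualFun_le_iff, show dualFun φ j + X.deg + 1 ≤ i ↔ dualFun φ j ≤ i - X.deg - 1 by omega,
      dualFun_le_iff]
    have h := φ.shift (i - X.deg - 1)
    rw [show i - X.deg - 1 + X.deg + 1 = i by ring] at h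
    omega

/-- The self-duality of the paracyclic category: it is the identity on objects, and it sends a
morphism to its left adjoint. -/
noncomputable def duality : Paracyclicᵒᵖ ⥤ Paracyclic where
  obj X := X.unop
  map φ := dual φ.unop
  map_id _ := hom_ext fun _ => eq_of_forall_ge_iff fun _ => dualFun_le_iff _ _ _
  map_comp _ _ := hom_ext fun _ => eq_of_forall_ge_iff fun _ =>
    (dualFun_le_iff _ _ _).trans ((dualFun_le_iff _ _ _).trans (dualFun_le_iff _ _ _)).symm

end Paracyclic

/-!
The Hochschild homology of a bicategory has a small presentation: every object comes from level
zero, and every morphism is a composite of `2`-cells between endomorphisms and of rotations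
`F G ≅ G F` or their inverses (`BiHH.zig`). The rotations are natural and satisfy a hexagon identity
and a unit identity, and such data define functors on the Hochschild homology
(`BiHH.CyclicCocone.functor`).

A `2`-cell of the free adjunction acts on those regions of its string diagram which are labelled by
the object `1`. This gives a monotone function `ℤ → ℤ` (`FreeAdj.fn`). A `2`-cell is determined by
its function (`FreeAdj.fn_injective`), and the functions which occur are described by elementary
conditions (`FreeAdj.exists_fn_eq`). Both facts come from a normal form of `2`-cells (`FreeAdj.nf`),
a consequence of naturality and of the triangle identities.

Sending a word with `N` letters `g` to the object of `Λ_∞`, with initial and terminal object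
adjoined, on which functions have period `N`, a `2`-cell to the periodic extension of its function,
and a rotation to a translation, one gets a functor `FreeAdj.toTarget` from `biHH FreeAdj` to
`WithTerminal (WithInitial Paracyclic)`. Here the empty word on the object `0` goes to the initial
object, and the empty word on the object `1` to the terminal object.

That this functor is an equivalence rests on normal forms for the morphisms between words. All
rotations between words on one object are powers of the rotation by one step
(`FreeAdj.Rotations.τ_eq_step_zpow`). Further, a `2`-cell splits along an occurrence of the object
`0` in its target, and along an occurrence of the object `1` in its source. Hence rotations can be
moved past `2`-cells: on the object `0`, every morphism is a power of a step followed by a `2`-cell,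
and on the object `1`, it is a `2`-cell followed by a power of a step. A periodic monotone function
decomposes uniquely in both of these ways, according to where it becomes nonnegative and according
to its value at `0`. This proves full faithfulness on the words on `0`, in `biHH FreeMon` as well as
in `biHH FreeAdj`, and on the words on `1` in `biHH FreeCoMon`. In `biHH FreeAdj`, a nonempty word
on `1` is isomorphic to a word on `0`, and the empty word on `1` is terminal
(`FreeAdj.Rotations.eq_toTerminal`).

Since `toTarget` and its restrictions to `biHH FreeMon` and `biHH FreeCoMon` are fully faithful, so
are the functors induced by the inclusions. The remaining equivalences and the two squares follow by
comparison of essential images (`CategoryTheory.Functor.exists_equivalence_of_essImage`), because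
the self-duality of `Λ_∞` is fully faithful.
-/

namespace FreeAdj

open Quiver.Path (nil)

/-! ### Two-cells of the free adjunction -/

section Whiskering

variable {a b c d : FreeAdj}

theorem whiskerL_id (p : Word a b) (q : Word b c) : whiskerL p (𝟙 q) = 𝟙 (p.comp q) :=
  Bicategory.whiskerLeft_id (B := FreeAdj) p q

theorem whiskerR_id (p : Word a b) (q : Word b c) : whiskerR (𝟙 p) q = 𝟙 (p.comp q) :=
  Bicategory.id_whiskerRight (B := FreeAdj) p q

theorem whiskerL_comp (p : Word a b) {q r s : Word b c} (α : q ⟶ r) (β : r ⟶ s) :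
    whiskerL p (α ≫ β) = whiskerL p α ≫ whiskerL p β :=
  Bicategory.whiskerLeft_comp (B := FreeAdj) p α β

theorem whiskerR_comp {p q r : Word a b} (α : p ⟶ q) (β : q ⟶ r) (s : Word b c) :
    whiskerR (α ≫ β) s = whiskerR α s ≫ whiskerR β s :=
  Bicategory.comp_whiskerRight (B := FreeAdj) α β s

theorem whisker_swap {p q : Word a b} {r s : Word b c} (α : p ⟶ q) (β : r ⟶ s) :
    whiskerL p β ≫ whiskerR α s = whiskerR α r ≫ whiskerL q β :=
  Bicategory.whisker_exchange (B := FreeAdj) α β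

theorem whiskerL_nil {p q : Word a b} (α : p ⟶ q) :
    whiskerL nil α = eqToHom (Quiver.Path.nil_comp p) ≫ α ≫
      eqToHom (Quiver.Path.nil_comp q).symm :=
  Bicategory.id_whiskerLeft (B := FreeAdj) α

theorem whiskerR_nil {p q : Word a b} (α : p ⟶ q) : whiskerR α nil = α :=
  (Bicategory.whiskerRight_id (B := FreeAdj) α).trans
    ((Category.id_comp _).trans (Category.comp_id _))

theorem whiskerL_whiskerL (p : Word a b) (q : Word b c) {r s : Word c d} (α : r ⟶ s) :
    whiskerL (p.comp q) α = eqToHom (Quiver.Path.comp_assoc p q r) ≫ whiskerL p (whiskerL q α) ≫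
      eqToHom (Quiver.Path.comp_assoc p q s).symm :=
  Bicategory.comp_whiskerLeft (B := FreeAdj) p q α

theorem whiskerR_whiskerR {p q : Word a b} (α : p ⟶ q) (r : Word b c) (s : Word c d) :
    whiskerR α (r.comp s) = eqToHom (Quiver.Path.comp_assoc p r s).symm ≫
      whiskerR (whiskerR α r) s ≫ eqToHom (Quiver.Path.comp_assoc q r s) :=
  Bicategory.whiskerRight_comp (B := FreeAdj) α r s

theorem whiskerR_whiskerL (p : Word a b) {q r : Word b c} (α : q ⟶ r) (s : Word c d) :
    whiskerR (whiskerL p α) s = eqToHom (Quiver.Path.comp_assoc p q s) ≫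
      whiskerL p (whiskerR α s) ≫ eqToHom (Quiver.Path.comp_assoc p r s).symm :=
  Bicategory.whisker_assoc (B := FreeAdj) p α s

/-- Whiskering on the right by a generating `1`-cell. In this case the associators are identities
by definition. -/
def wr {p q : Word a b} (α : p ⟶ q) (e : Arrow b c) :
    (p.cons e : Word a c) ⟶ (q.cons e : Word a c) :=
  whiskerR α (Quiver.Hom.toPath (V := FreeAdj) e)

theorem wr_id (p : Word a b) (e : Arrow b c) : wr (𝟙 p) e = 𝟙 (p.cons e : Word a c) :=
  whiskerR_id _ _

theorem wr_comp {p q r : Word a b} (α : p ⟶ q) (β : q ⟶ r) (e : Arrow b c) :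
    wr (α ≫ β) e = wr α e ≫ wr β e :=
  whiskerR_comp _ _ _

theorem whiskerR_cons {p q : Word a b} (α : p ⟶ q) (r : Word b c) (e : Arrow c d) :
    whiskerR α (r.cons e) = wr (whiskerR α r) e :=
  (whiskerR_whiskerR α r (Quiver.Hom.toPath (V := FreeAdj) e)).trans
    ((Category.id_comp _).trans (Category.comp_id _))

theorem wr_whiskerL (p : Word a b) {q r : Word b c} (α : q ⟶ r) (e : Arrow c d) :
    wr (whiskerL p α) e = whiskerL p (wr α e) :=
  (whiskerR_whiskerL p α (Quiver.Hom.toPath (V := FreeAdj) e)).trans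
    ((Category.id_comp _).trans (Category.comp_id _))

end Whiskering

/-- The unit `id ⟶ f g`. -/
def unitCell : (nil : Word .zero .zero) ⟶ wf.comp wg := Quot.mk _ .unit

/-- The counit `g f ⟶ id`. -/
def counitCell : wg.comp wf ⟶ (nil : Word .one .one) := Quot.mk _ .counit

/-- The unit, inserted at the end of a word. -/
def unitEnd {a : FreeAdj} (p : Word a .zero) : p ⟶ ((p.cons .f).cons .g : Word a .zero) :=
  whiskerL p unitCell

/-- The counit, applied at the end of a word. -/
def counitEnd {a : FreeAdj} (p : Word a .one) : ((p.cons .g).cons .f : Word a .one) ⟶ p :=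
  whiskerL p counitCell

theorem whiskerL_unitEnd {a b : FreeAdj} (p : Word a b) (q : Word b .zero) :
    whiskerL p (unitEnd q) = unitEnd (p.comp q) :=
  ((whiskerL_whiskerL p q unitCell).trans ((Category.id_comp _).trans (Category.comp_id _))).symm

theorem whiskerL_counitEnd {a b : FreeAdj} (p : Word a b) (q : Word b .one) :
    whiskerL p (counitEnd q) = counitEnd (p.comp q) :=
  ((whiskerL_whiskerL p q counitCell).trans ((Category.id_comp _).trans (Category.comp_id _))).symm

theorem unitEnd_naturality {a : FreeAdj} {p q : Word a .zero} (α : p ⟶ q) :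
    α ≫ unitEnd q = unitEnd p ≫ wr (wr α .f) .g := by
  have h := whisker_swap α unitCell
  rw [whiskerR_nil] at h
  exact h.symm.trans (congrArg (unitEnd p ≫ ·) (whiskerR_cons α wf .g))

theorem counitEnd_naturality {a : FreeAdj} {p q : Word a .one} (α : p ⟶ q) :
    wr (wr α .g) .f ≫ counitEnd q = counitEnd p ≫ α := by
  have h := whisker_swap α counitCell
  rw [whiskerR_nil] at h
  exact (congrArg (· ≫ counitEnd q) (whiskerR_cons α wg .f)).symm.trans h.symm

theorem left_triangle_end {a : FreeAdj} (p : Word a .zero) :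
    wr (unitEnd p) .f ≫ counitEnd (p.cons .f) = 𝟙 (p.cons Arrow.f : Word a .one) := by
  have h : whiskerR unitCell wf ≫ counitEnd wf = 𝟙 wf :=
    (congrArg (_ ≫ ·) (Category.id_comp (counitEnd wf)).symm).trans
      (Quot.sound Rel.left_triangle)
  have h' := congrArg (whiskerL p) h
  refine Eq.trans ?_ (h'.trans (whiskerL_id _ _))
  exact (congrArg₂ (· ≫ ·) (wr_whiskerL p unitCell .f) (whiskerL_counitEnd p wf).symm).trans
    (whiskerL_comp p _ _).symm

theorem right_triangle_end {a : FreeAdj} (p : Word a .one) :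
    unitEnd (p.cons .g) ≫ wr (counitEnd p) .g = 𝟙 (p.cons Arrow.g : Word a .zero) := by
  have h : unitEnd wg ≫ whiskerR counitCell wg = 𝟙 wg :=
    (congrArg (_ ≫ ·) (Category.id_comp (wr counitCell Arrow.g)).symm).trans
      (Quot.sound Rel.right_triangle)
  have h' := congrArg (whiskerL p) h
  refine Eq.trans ?_ (h'.trans (whiskerL_id _ _))
  exact (congrArg₂ (· ≫ ·) (whiskerL_unitEnd p wg).symm (wr_whiskerL p counitCell .g)).trans
    (whiskerL_comp p _ _).symm

/-- The elementary `2`-cells: whiskerings of the unit and of the counit. The recursion runs over the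
part of the word which follows the unit or counit. -/
inductive Elem : ∀ {a b : FreeAdj} {p q : Word a b}, (p ⟶ q) → Prop
  | unit {a : FreeAdj} (p : Word a .zero) : Elem (unitEnd p)
  | counit {a : FreeAdj} (p : Word a .one) : Elem (counitEnd p)
  | wr {a b c : FreeAdj} {p q : Word a b} {α : p ⟶ q} (h : Elem α) (e : Arrow b c) :
      Elem (wr α e)

/-- The composites of elementary `2`-cells. -/
inductive Gen : ∀ {a b : FreeAdj} {p q : Word a b}, (p ⟶ q) → Prop
  | id {a b : FreeAdj} (p : Word a b) : Gen (𝟙 p)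
  | snoc {a b : FreeAdj} {p q r : Word a b} {α : p ⟶ q} {β : q ⟶ r} (h : Gen α) (h' : Elem β) :
      Gen (α ≫ β)

theorem Elem.whiskerL {a b : FreeAdj} {p q : Word a b} {α : p ⟶ q} (h : Elem α) {c : FreeAdj}
    (r : Word c a) : Elem (whiskerL r α) := by
  induction h with
  | unit p => rw [whiskerL_unitEnd]; exact .unit _
  | counit p => rw [whiskerL_counitEnd]; exact .counit _
  | wr _ e ih => rw [← wr_whiskerL]; exact .wr ih e

theorem Gen.comp {a b : FreeAdj} {p q r : Word a b} {α : p ⟶ q} {β : q ⟶ r} (h : Gen α)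
    (h' : Gen β) : Gen (α ≫ β) := by
  induction h' with
  | id => rwa [Category.comp_id]
  | snoc _ e ih => rw [← Category.assoc]; exact .snoc ih e

theorem Gen.whiskerL {a b : FreeAdj} {p q : Word a b} {α : p ⟶ q} (h : Gen α) {c : FreeAdj}
    (r : Word c a) : Gen (whiskerL r α) := by
  induction h with
  | id => rw [whiskerL_id]; exact .id _
  | snoc _ e ih => rw [whiskerL_comp]; exact .snoc ih (e.whiskerL r)

theorem Gen.wr {a b : FreeAdj} {p q : Word a b} {α : p ⟶ q} (h : Gen α) {c : FreeAdj}
    (e : Arrow b c) : Gen (wr α e) := by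
  induction h with
  | id => rw [wr_id]; exact .id _
  | snoc _ e' ih => rw [wr_comp]; exact .snoc ih (e'.wr e)

theorem Gen.whiskerR {a b : FreeAdj} {p q : Word a b} {α : p ⟶ q} (h : Gen α) {c : FreeAdj}
    (r : Word b c) : Gen (whiskerR α r) := by
  induction r with
  | nil => rwa [whiskerR_nil]
  | cons r e ih => rw [whiskerR_cons]; exact ih.wr e

theorem Gen.eqToHom {a b : FreeAdj} {p q : Word a b} (h : p = q) : Gen (eqToHom h) := by
  subst h; exact .id _

theorem Elem.gen {a b : FreeAdj} {p q : Word a b} {α : p ⟶ q} (h : Elem α) : Gen α := by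
  rw [← Category.id_comp α]; exact .snoc (.id _) h

theorem gen_mk {a b : FreeAdj} {p q : Word a b} (α : Cell p q) : Gen (Quot.mk _ α : p ⟶ q) := by
  induction α with
  | eqTo h => exact (mk_eqTo h) ▸ Gen.eqToHom h
  | vcomp α β ihα ihβ => exact ihα.comp ihβ
  | wl p α ih => exact ih.whiskerL p
  | wr α r ih => exact ih.whiskerR r
  | unit =>
    have h := (Elem.unit (nil : Word .zero .zero)).gen
    change Gen unitCell
    exact ((whiskerL_nil unitCell).trans ((Category.id_comp _).trans (Category.comp_id _))) ▸ h
  | counit =>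
    have h := (Elem.counit (nil : Word .one .one)).gen
    change Gen counitCell
    exact ((whiskerL_nil counitCell).trans ((Category.id_comp _).trans (Category.comp_id _))) ▸ h

/-- Every `2`-cell of the free adjunction is a composite of elementary ones. -/
theorem gen {a b : FreeAdj} {p q : Word a b} (α : p ⟶ q) : Gen α := by
  induction α using Quot.ind with
  | mk α => exact gen_mk α

/-! ### Splitting of two-cells -/

theorem exists_split_target_elem {a b : FreeAdj} {x y : Word a b} {β : x ⟶ y} (e : Elem β) :
    ∀ (p : Word a .zero) (q : Word .zero b) (h : y = p.comp q),
      ∃ (p' : Word a .zero) (q' : Word .zero b) (h' : x = p'.comp q') (α₁ : p' ⟶ p) (α₂ : q' ⟶ q),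
        β ≫ eqToHom h = eqToHom h' ≫ whiskerR α₁ q' ≫ whiskerL p α₂ := by
  induction e with
  | unit x =>
    intro p q h
    cases q with
    | nil =>
      cases h
      refine ⟨x, nil, rfl, unitEnd x, 𝟙 _, ?_⟩
      rw [whiskerR_nil, whiskerL_id]
      exact ((Category.id_comp _).trans rfl).symm
    | cons q e =>
      change Arrow _ _ at e
      cases e
      cases q with
      | cons q e =>
        change Arrow _ _ at e
        cases e
        cases h
        refine ⟨p, q, rfl, 𝟙 _, unitEnd q, ?_⟩
        rw [whiskerR_id, whiskerL_unitEnd]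
        exact (Category.comp_id _).trans ((Category.id_comp _).trans (Category.id_comp _)).symm
  | counit x =>
    intro p q h
    cases q with
    | cons q e =>
      change Arrow _ _ at e
      cases e
      cases h
      refine ⟨p, ((q.cons .f).cons .g).cons .f, rfl, 𝟙 _, counitEnd (q.cons .f), ?_⟩
      rw [whiskerR_id, whiskerL_counitEnd]
      exact (Category.comp_id _).trans ((Category.id_comp _).trans (Category.id_comp _)).symm
  | @wr b c x y β e k ih =>
    intro p q h
    cases q with
    | nil =>
      cases h
      refine ⟨_, nil, rfl, FreeAdj.wr β k, 𝟙 _, ?_⟩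
      rw [whiskerR_nil, whiskerL_id]
      exact ((Category.id_comp _).trans rfl).symm
    | cons q k' =>
      obtain rfl : _ = _ := Quiver.Path.obj_eq_of_cons_eq_cons h
      cases h
      obtain ⟨p', q', rfl, α₁, α₂, h⟩ := ih p q rfl
      refine ⟨p', q'.cons k, rfl, α₁, FreeAdj.wr α₂ k, ?_⟩
      rw [whiskerR_cons, ← wr_whiskerL]
      have h₁ := congrArg (FreeAdj.wr · k) h
      simp only [eqToHom_refl, Category.comp_id, Category.id_comp] at h₁ ⊢
      exact (Category.comp_id _).trans ((h₁.trans (wr_comp _ _ _)).trans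
        (Category.id_comp _).symm)

/-- A `2`-cell to a composite `p q` over the object `0` is the horizontal composite of a `2`-cell to
`p` and a `2`-cell to `q`: an elementary `2`-cell does not produce anything across an object `0`. -/
theorem exists_split_target {a b : FreeAdj} {x : Word a b} {p : Word a .zero} {q : Word .zero b}
    (α : x ⟶ p.comp q) :
    ∃ (p' : Word a .zero) (q' : Word .zero b) (h : x = p'.comp q') (α₁ : p' ⟶ p) (α₂ : q' ⟶ q),
        α = eqToHom h ≫ whiskerR α₁ q' ≫ whiskerL p α₂ := by
  suffices H : ∀ {x y : Word a b} {β : x ⟶ y} (_ : Gen β) (p : Word a .zero) (q : Word .zero b)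
      (h : y = p.comp q), ∃ (p' : Word a .zero) (q' : Word .zero b) (h' : x = p'.comp q')
        (α₁ : p' ⟶ p) (α₂ : q' ⟶ q),
        β ≫ eqToHom h = eqToHom h' ≫ whiskerR α₁ q' ≫ whiskerL p α₂ by
    obtain ⟨p', q', h', α₁, α₂, h⟩ := H (gen α) p q rfl
    exact ⟨p', q', h', α₁, α₂, by simpa using h⟩
  intro x y β g
  induction g with
  | id =>
    rintro p q rfl
    exact ⟨p, q, rfl, 𝟙 _, 𝟙 _, by simp [whiskerR_id, whiskerL_id]⟩
  | snoc _ e ih =>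
    intro p q h
    obtain ⟨p', q', rfl, β₁, β₂, h'⟩ := exists_split_target_elem e p q h
    obtain ⟨p'', q'', rfl, α₁, α₂, h''⟩ := ih p' q' rfl
    refine ⟨p'', q'', rfl, α₁ ≫ β₁, α₂ ≫ β₂, ?_⟩
    simp only [eqToHom_refl, Category.comp_id, Category.id_comp] at h' h'' ⊢
    rw [Category.assoc, h', h'', whiskerR_comp, whiskerL_comp, Category.assoc, Category.assoc,
      ← Category.assoc (whiskerL p' α₂), whisker_swap, Category.assoc]

theorem exists_split_source_elem {a b : FreeAdj} {x y : Word a b} {β : x ⟶ y} (e : Elem β) :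
    ∀ (p : Word a .one) (q : Word .one b) (h : p.comp q = x),
      ∃ (p' : Word a .one) (q' : Word .one b) (h' : p'.comp q' = y) (α₁ : p ⟶ p') (α₂ : q ⟶ q'),
        eqToHom h ≫ β = (whiskerR α₁ q ≫ whiskerL p' α₂) ≫ eqToHom h' := by
  induction e with
  | unit x =>
    intro p q h
    cases q with
    | cons q e =>
      change Arrow _ _ at e
      cases e
      cases h
      refine ⟨p, ((q.cons .g).cons .f).cons .g, rfl, 𝟙 _, unitEnd (q.cons .g), ?_⟩
      rw [whiskerR_id, whiskerL_unitEnd]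
      exact (Category.id_comp _).trans ((Category.comp_id _).trans (Category.id_comp _)).symm
  | counit x =>
    intro p q h
    cases q with
    | nil =>
      cases h
      refine ⟨x, nil, rfl, counitEnd x, 𝟙 _, ?_⟩
      rw [whiskerR_nil, whiskerL_id]
      exact (Category.id_comp _).trans ((Category.comp_id _).trans (Category.comp_id _)).symm
    | cons q e =>
      change Arrow _ _ at e
      cases e
      cases q with
      | cons q e =>
        change Arrow _ _ at e
        cases e
        cases h
        refine ⟨p, q, rfl, 𝟙 _, counitEnd q, ?_⟩
        rw [whiskerR_id, whiskerL_counitEnd]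
        exact (Category.id_comp _).trans ((Category.comp_id _).trans (Category.id_comp _)).symm
  | @wr b c x y β e k ih =>
    intro p q h
    cases q with
    | nil =>
      cases h
      refine ⟨_, nil, rfl, FreeAdj.wr β k, 𝟙 _, ?_⟩
      rw [whiskerR_nil, whiskerL_id]
      exact (Category.id_comp _).trans ((Category.comp_id _).trans (Category.comp_id _)).symm
    | cons q k' =>
      obtain rfl : _ = _ := Quiver.Path.obj_eq_of_cons_eq_cons h
      cases h
      obtain ⟨p', q', rfl, α₁, α₂, h⟩ := ih p q rfl
      refine ⟨p', q'.cons k', rfl, α₁, FreeAdj.wr α₂ k', ?_⟩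
      rw [whiskerR_cons, ← wr_whiskerL]
      have h₁ := congrArg (FreeAdj.wr · k') h
      simp only [eqToHom_refl, Category.comp_id, Category.id_comp] at h₁ ⊢
      exact (Category.id_comp _).trans ((h₁.trans (wr_comp _ _ _)).trans
        (Category.comp_id _).symm)

/-- A `2`-cell from a composite `p q` over the object `1` is the horizontal composite of a `2`-cell
from `p` and a `2`-cell from `q`: an elementary `2`-cell does not consume anything across an
object `1`. -/
theorem exists_split_source {a b : FreeAdj} {y : Word a b} {p : Word a .one} {q : Word .one b}
    (α : p.comp q ⟶ y) :
    ∃ (p' : Word a .one) (q' : Word .one b) (h : p'.comp q' = y) (α₁ : p ⟶ p') (α₂ : q ⟶ q'),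
        α = (whiskerR α₁ q ≫ whiskerL p' α₂) ≫ eqToHom h := by
  suffices H : ∀ {x y : Word a b} {β : x ⟶ y} (_ : Gen β) (p : Word a .one) (q : Word .one b)
      (h : p.comp q = x), ∃ (p' : Word a .one) (q' : Word .one b) (h' : p'.comp q' = y)
        (α₁ : p ⟶ p') (α₂ : q ⟶ q'),
        eqToHom h ≫ β = (whiskerR α₁ q ≫ whiskerL p' α₂) ≫ eqToHom h' by
    obtain ⟨p', q', h', α₁, α₂, h⟩ := H (gen α) p q rfl
    exact ⟨p', q', h', α₁, α₂, by simpa using h⟩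
  intro x y β g
  induction g with
  | id =>
    rintro p q rfl
    exact ⟨p, q, rfl, 𝟙 _, 𝟙 _, by simp [whiskerR_id, whiskerL_id]⟩
  | snoc _ e ih =>
    intro p q h
    obtain ⟨p', q', rfl, α₁, α₂, h'⟩ := ih p q h
    obtain ⟨p'', q'', rfl, β₁, β₂, h''⟩ := exists_split_source_elem e p' q' rfl
    refine ⟨p'', q'', rfl, α₁ ≫ β₁, α₂ ≫ β₂, ?_⟩
    simp only [eqToHom_refl, Category.comp_id, Category.id_comp] at h' h'' ⊢
    rw [← Category.assoc, h', h'', whiskerR_comp, whiskerL_comp, Category.assoc, Category.assoc,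
      ← Category.assoc (whiskerL p' α₂), whisker_swap, Category.assoc]

/-- Of two factorizations of a word, one refines the other. -/
theorem comp_eq_comp {a b b' c : FreeAdj} {p : Word a b} {q : Word b c} {p' : Word a b'}
    {q' : Word b' c} (h : p.comp q = p'.comp q') :
    (∃ s : Word b b', p' = p.comp s ∧ q = s.comp q') ∨
      ∃ s : Word b' b, p = p'.comp s ∧ q' = s.comp q := by
  induction q with
  | nil => exact .inr ⟨q', h, rfl⟩
  | cons q e ih =>
    cases q' with
    | nil => exact .inl ⟨q.cons e, h.symm, rfl⟩
    | cons q' e' =>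
      obtain rfl : _ = _ := Quiver.Path.obj_eq_of_cons_eq_cons h
      have h₁ := eq_of_heq (Quiver.Path.heq_of_cons_eq_cons h)
      obtain rfl := eq_of_heq (Quiver.Path.hom_heq_of_cons_eq_cons h)
      obtain ⟨s, rfl, rfl⟩ | ⟨s, rfl, rfl⟩ := ih h₁
      · exact .inl ⟨s, rfl, rfl⟩
      · exact .inr ⟨s, rfl, rfl⟩

end FreeAdj

namespace FreeAdj

open Quiver.Path (nil)

/-! ### Two-cells as monotone functions -/

/-- The number of generators `g` in a generating `1`-cell. -/
def Arrow.wt : ∀ {a b : FreeAdj}, Arrow a b → ℕ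
  | _, _, .f => 0
  | _, _, .g => 1

/-- The number of generators `g` in a word. -/
def wt {a : FreeAdj} : ∀ {b : FreeAdj}, Word a b → ℕ
  | _, .nil => 0
  | _, .cons p e => wt p + Arrow.wt e

@[simp] theorem wt_nil (a : FreeAdj) : wt (nil : Word a a) = 0 := rfl

@[simp] theorem wt_cons_f {a : FreeAdj} (p : Word a .zero) :
    wt (p.cons Arrow.f : Word a .one) = wt p := rfl

@[simp] theorem wt_cons_g {a : FreeAdj} (p : Word a .one) :
    wt (p.cons Arrow.g : Word a .zero) = wt p + 1 := rfl

@[simp] theorem wt_comp {a b c : FreeAdj} (p : Word a b) (q : Word b c) :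
    wt (p.comp q) = wt p + wt q := by
  induction q with
  | nil => rfl
  | cons q e ih => change wt (p.comp q) + Arrow.wt e = _ + (wt q + Arrow.wt e); omega

/-- A word between different objects without `g` goes from `0` to `1`. -/
theorem eq_of_wt_eq_zero {a b : FreeAdj} (p : Word a b) (h : wt p = 0) :
    a = b ∨ (a = .zero ∧ b = .one) := by
  induction p with
  | nil => exact .inl rfl
  | @cons b c p e ih =>
    change Arrow b c at e
    cases e with
    | f =>
      obtain rfl | ⟨-, h⟩ := ih h
      · exact .inr ⟨rfl, rfl⟩
      · cases h
    | g => simp at h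

theorem eq_nil_of_wt_eq_zero {a : FreeAdj} (p : Word a a) (h : wt p = 0) : p = nil := by
  cases p with
  | nil => rfl
  | @cons b _ p e =>
    change Arrow b a at e
    cases e with
    | f => obtain h | ⟨h, -⟩ := eq_of_wt_eq_zero p h <;> cases h
    | g => simp at h

/-- A word is determined by its endpoints and its number of letters `g`, since the letters `f` and
`g` alternate. -/
theorem eq_of_wt_eq {a : FreeAdj} : ∀ {b : FreeAdj} (p q : Word a b), wt p = wt q → p = q
  | _, .nil, q, h => (eq_nil_of_wt_eq_zero q h.symm).symm
  | _, .cons p e, .nil, h => eq_nil_of_wt_eq_zero _ h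
  | _, .cons p .f, .cons q .f, h => by rw [eq_of_wt_eq p q h]
  | _, .cons p .g, .cons q .g, h => by rw [eq_of_wt_eq p q (by simpa using h)]

/-- The monotone function of a formal composite of `2`-cells. The regions of the string diagram of a
word that are labelled by the object `1` are numbered from left to right, starting with `0`, and a
`2`-cell carries regions of its source to regions of its target. To the left of its support, the
function is the identity, and to the right, it is a translation. -/
def Cell.fn : ∀ {a b : FreeAdj} {p q : Word a b}, Cell p q → ℤ → ℤ
  | _, _, _, _, .eqTo _ => id
  | _, _, _, _, .vcomp α β => β.fn ∘ α.fn
  | _, _, _, _, .wl p α => fun l => α.fn (l - wt p) + wt p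
  | _, _, _, _, .wr α _ => α.fn
  | _, _, _, _, .unit => fun l => if l < 0 then l else l + 1
  | _, _, _, _, .counit => fun l => if l ≤ 0 then l else l - 1

/-- The conditions which characterize the functions of the `2`-cells between words `a → b` with
`N` and `M` generators `g`. The function is the identity on the negative numbers and a translation
from `N` onwards. If `a = 1`, the leftmost region has the number `0` and is preserved. If `b = 0`,
the regions have the numbers `0, …, N - 1`, and are sent to the numbers `0, …, M - 1`. -/
structure Good (a b : FreeAdj) (N M : ℕ) (φ : ℤ → ℤ) : Prop where
  mono : Monotone φ
  neg : ∀ l < 0, φ l = l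
  nonneg : ∀ l, 0 ≤ l → 0 ≤ φ l
  zero : a = .one → φ 0 = 0
  ge : ∀ l : ℤ, N ≤ l → φ l = l - N + M
  lt : b = .zero → ∀ l < (N : ℤ), φ l < M

theorem Good.le {a b : FreeAdj} {N M : ℕ} {φ : ℤ → ℤ} (h : Good a b N M φ) {l : ℤ} (hl : l ≤ N) :
    φ l ≤ M := by
  have h₁ := h.mono hl
  have h₂ := h.ge N le_rfl
  omega

theorem good_id (a b : FreeAdj) (N : ℕ) : Good a b N N id where
  mono := monotone_id
  neg _ _ := rfl
  nonneg _ h := h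
  zero _ := rfl
  ge l _ := by simp
  lt _ _ h := h

theorem Good.comp {a b : FreeAdj} {N M K : ℕ} {φ ψ : ℤ → ℤ} (h : Good a b N M φ)
    (h' : Good a b M K ψ) : Good a b N K (ψ ∘ φ) where
  mono := h'.mono.comp h.mono
  neg l hl := by simp [h.neg l hl, h'.neg l hl]
  nonneg l hl := h'.nonneg _ (h.nonneg l hl)
  zero ha := by simp [h.zero ha, h'.zero ha]
  ge l hl := by
    have h₁ := h.ge l hl
    have h₂ := h'.ge (φ l) (by omega)
    simp only [Function.comp_apply]; omega
  lt hb l hl := h'.lt hb _ (h.lt hb l hl)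

theorem Good.whiskerL {a b c : FreeAdj} {N M : ℕ} {φ : ℤ → ℤ} (h : Good b c N M φ)
    (p : Word a b) : Good a c (wt p + N) (wt p + M) (fun l => φ (l - wt p) + wt p) where
  mono l l' hl := by have := h.mono (show l - wt p ≤ l' - wt p by omega); simp only; omega
  neg l hl := by have := h.neg (l - wt p) (by omega); omega
  nonneg l hl := by
    by_cases hp : l < wt p
    · have := h.neg (l - wt p) (by omega); omega
    · have := h.nonneg (l - wt p) (by omega); omega
  zero ha := by
    subst ha
    by_cases hp : wt p = 0
    · obtain rfl | ⟨h₀, -⟩ := eq_of_wt_eq_zero p hp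
      · have := h.zero rfl
        simp [hp, this]
      · cases h₀
    · have := h.neg (0 - wt p) (by omega); omega
  ge l hl := by have := h.ge (l - wt p) (by omega); push_cast; omega
  lt hc l hl := by have := h.lt hc (l - wt p) (by omega); push_cast; omega

theorem Good.whiskerR {a b c : FreeAdj} {N M : ℕ} {φ : ℤ → ℤ} (h : Good a b N M φ)
    (r : Word b c) : Good a c (N + wt r) (M + wt r) φ where
  mono := h.mono
  neg := h.neg
  nonneg := h.nonneg
  zero := h.zero
  ge l hl := by have := h.ge l (by omega); push_cast; omega
  lt hc l hl := by
    subst hc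
    by_cases hl' : (N : ℤ) ≤ l
    · have := h.ge l hl'; push_cast; omega
    · by_cases hr : wt r = 0
      · obtain rfl | ⟨-, h₀⟩ := eq_of_wt_eq_zero r hr
        · have := h.lt rfl l (by omega); omega
        · cases h₀
      · have := h.le (l := l) (by omega); push_cast; omega

theorem good_unit : Good .zero .zero 0 1 (fun l => if l < 0 then l else l + 1) := by
  refine ⟨fun l l' h => ?_, fun l h => ?_, fun l h => ?_, fun h => ?_, fun l h => ?_,
    fun _ l h => ?_⟩
  · split_ifs <;> omega
  · simp [h]
  · split_ifs <;> omega
  · cases h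
  · split_ifs <;> push_cast <;> omega
  · split_ifs <;> push_cast at * <;> omega

theorem good_counit : Good .one .one 1 0 (fun l => if l ≤ 0 then l else l - 1) := by
  refine ⟨fun l l' h => ?_, fun l h => ?_, fun l h => ?_, fun h => ?_, fun l h => ?_,
    fun h l _ => ?_⟩
  · split_ifs <;> omega
  · split_ifs <;> omega
  · split_ifs <;> omega
  · simp
  · split_ifs <;> push_cast at * <;> omega
  · cases h

theorem Cell.good {a b : FreeAdj} {p q : Word a b} (α : Cell p q) :
    Good a b (wt p) (wt q) α.fn := by
  induction α with
  | eqTo h => subst h; exact good_id _ _ _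
  | vcomp α β ihα ihβ => exact ihα.comp ihβ
  | wl p α ih => rw [wt_comp, wt_comp]; exact ih.whiskerL p
  | wr α r ih => rw [wt_comp, wt_comp]; exact ih.whiskerR r
  | unit => exact good_unit
  | counit => exact good_counit

/-- The interchange law for functions. Apart from translations, `φ` acts to the
left of `N` and `M` and `ψ` to the right. They meet only if `φ l = M` for some `l < N`, and this is
excluded by `Good.lt` if `b = 0`, and harmless by `Good.zero` if `b = 1`. -/
theorem Good.exchange {a b c : FreeAdj} {N M K L : ℕ} {φ ψ : ℤ → ℤ} (h : Good a b N M φ)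
    (h' : Good b c K L ψ) (l : ℤ) : φ (ψ (l - N) + N) = ψ (φ l - M) + M := by
  by_cases hl : (N : ℤ) ≤ l
  · have h₁ := h'.nonneg (l - N) (by omega)
    have h₂ := h.ge (ψ (l - N) + N) (by omega)
    have h₃ := h.ge l hl
    rw [h₂, h₃]
    ring_nf
  · have h₁ := h'.neg (l - N) (by omega)
    rw [h₁, sub_add_cancel]
    have h₂ := h.le (l := l) (by omega)
    by_cases h₃ : φ l < M
    · have := h'.neg (φ l - M) (by omega); omega
    · cases b with
      | zero => exact absurd (h.lt rfl l (by omega)) h₃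
      | one =>
        have h₄ : φ l - M = 0 := by omega
        rw [h₄, h'.zero rfl]; omega

theorem Rel.fn_eq {a b : FreeAdj} {p q : Word a b} {α β : Cell p q} (h : Rel α β) :
    α.fn = β.fn := by
  induction h with
  | vcomp_left α _ ih => simp only [Cell.fn, ih]
  | vcomp_right β _ ih => simp only [Cell.fn, ih]
  | wl_congr p _ ih => simp only [Cell.fn, ih]
  | wr_congr r _ ih => simp only [Cell.fn, ih]
  | wl_id | wl_vcomp | id_wl => funext l; simp [Cell.fn]
  | comp_wl => funext l; simp [Cell.fn, sub_sub, add_assoc, add_comm]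
  | exchange α β => funext l; exact α.good.exchange β.good l
  | left_triangle =>
    funext l
    simp only [Cell.fn, Function.comp_apply, id]
    simp only [wt, Arrow.wt, Quiver.Hom.toPath, Nat.cast_zero, sub_zero, add_zero]
    split_ifs <;> omega
  | right_triangle =>
    funext l
    simp only [Cell.fn, Function.comp_apply, id]
    simp only [wt, Arrow.wt, Quiver.Hom.toPath]
    push_cast
    split_ifs <;> omega
  | _ => rfl

/-- The monotone function of a `2`-cell. -/
def fn {a b : FreeAdj} {p q : Word a b} (α : p ⟶ q) : ℤ → ℤ :=
  Quot.lift Cell.fn (fun _ _ h => h.fn_eq) α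

theorem good {a b : FreeAdj} {p q : Word a b} (α : p ⟶ q) : Good a b (wt p) (wt q) (fn α) := by
  induction α using Quot.ind with
  | mk α => exact α.good

theorem fn_id {a b : FreeAdj} (p : Word a b) : fn (𝟙 p) = id := rfl

theorem fn_comp {a b : FreeAdj} {p q r : Word a b} (α : p ⟶ q) (β : q ⟶ r) :
    fn (α ≫ β) = fn β ∘ fn α := by
  induction α using Quot.ind
  induction β using Quot.ind
  rfl

theorem fn_whiskerL {a b c : FreeAdj} (p : Word a b) {q r : Word b c} (α : q ⟶ r) :
    fn (whiskerL p α) = fun l => fn α (l - wt p) + wt p := by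
  induction α using Quot.ind
  rfl

theorem fn_whiskerR {a b c : FreeAdj} {p q : Word a b} (α : p ⟶ q) (r : Word b c) :
    fn (whiskerR α r) = fn α := by
  induction α using Quot.ind
  rfl

theorem fn_wr {a b c : FreeAdj} {p q : Word a b} (α : p ⟶ q) (e : Arrow b c) :
    fn (wr α e) = fn α :=
  fn_whiskerR _ _

theorem fn_unitEnd {a : FreeAdj} (p : Word a .zero) :
    fn (unitEnd p) = fun l : ℤ => if l < wt p then l else l + 1 := by
  refine (fn_whiskerL p unitCell).trans (funext fun l => ?_)
  change (if l - wt p < 0 then l - wt p else l - wt p + 1) + wt p = _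
  split_ifs <;> omega

theorem fn_counitEnd {a : FreeAdj} (p : Word a .one) :
    fn (counitEnd p) = fun l : ℤ => if l ≤ wt p then l else l - 1 := by
  refine (fn_whiskerL p counitCell).trans (funext fun l => ?_)
  change (if l - wt p ≤ 0 then l - wt p else l - wt p - 1) + wt p = _
  split_ifs <;> omega

end FreeAdj

namespace FreeAdj

open Quiver.Path (nil)

/-! ### Normal forms of two-cells -/

/-- The `2`-cells in normal form. The recursion runs over the ends of the source and the target: a
unit at the end of the target, a common `g` at the end, or the transpose under the adjunction of
a `2`-cell whose target has an additional `g`. -/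
inductive NF : ∀ {a b : FreeAdj} {p q : Word a b}, (p ⟶ q) → Prop
  | nil (a : FreeAdj) : NF (𝟙 (nil : Word a a))
  | unit {a : FreeAdj} {p q : Word a .zero} {α : p ⟶ q} (h : NF α) : NF (α ≫ unitEnd q)
  | wrg {a : FreeAdj} {p q : Word a .one} {α : p ⟶ q} (h : NF α) : NF (wr α .g)
  | transpose {a : FreeAdj} {p : Word a .zero} {q : Word a .one}
      {α : p ⟶ (q.cons .g : Word a .zero)} (h : NF α) : NF (wr α .f ≫ counitEnd q)

theorem NF.id {a : FreeAdj} : ∀ {b : FreeAdj} (p : Word a b), NF (𝟙 p)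
  | _, .nil => .nil _
  | _, .cons p .g => by
    have h := (NF.id p).wrg
    rwa [wr_id] at h
  | _, .cons p .f => by
    have h := (NF.id p).unit.transpose
    rw [Category.id_comp, left_triangle_end] at h
    exact h

/-- The normal forms are closed under composition with elementary `2`-cells: by naturality, such a
`2`-cell moves past the unit or counit at the end, or it cancels against it by a triangle
identity. -/
theorem NF.comp_elem {a b : FreeAdj} {p q : Word a b} {α : p ⟶ q} (h : NF α) :
    ∀ {r : Word a b} {β : q ⟶ r}, Elem β → NF (α ≫ β) := by
  induction h with
  | nil =>
    intro r β e
    cases e with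
    | unit => exact (NF.nil _).unit
  | @unit p q α h ih =>
    intro r β e
    cases e with
    | unit => exact h.unit.unit
    | wr e =>
      cases e with
      | wr e =>
        rw [Category.assoc, ← unitEnd_naturality, ← Category.assoc]
        exact (ih e).unit
      | counit =>
        rw [Category.assoc, right_triangle_end, Category.comp_id]
        exact h
  | wrg h ih =>
    intro r β e
    cases e with
    | unit => exact h.wrg.unit
    | wr e =>
      rw [← wr_comp]
      exact (ih e).wrg
  | transpose h ih =>
    intro r β e
    rw [Category.assoc, ← counitEnd_naturality, ← Category.assoc, ← wr_comp]
    exact (ih (e.wr .g)).transpose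

/-- Every `2`-cell is in normal form. -/
theorem nf {a b : FreeAdj} {p q : Word a b} (α : p ⟶ q) : NF α := by
  have h := gen α
  induction h with
  | id => exact .id _
  | snoc _ e ih => exact ih.comp_elem e

/-- A `2`-cell is determined by its monotone function. The value at the last region of the source
tells apart the two kinds of normal forms between words which end at the object `0`: it is the last
region of the target if and only if there is a common `g` at the end. -/
theorem fn_injective {a b : FreeAdj} {p q : Word a b} {α β : p ⟶ q} (h : fn α = fn β) : α = β := by
  have hα := nf α
  have hβ := nf β
  induction hα with
  | nil => cases hβ; rfl
  | @unit p q α h₁ ih =>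
    cases hβ with
    | @unit _ _ β h₂ =>
      rw [ih (β := β) (funext fun l => ?_) h₂]
      have := congrFun h l
      simp only [fn_comp, fn_unitEnd, Function.comp_apply] at this
      split_ifs at this <;> omega
    | @wrg p _ β h₂ =>
      have := congrFun h (wt p)
      rw [fn_wr, (good β).ge _ le_rfl, fn_comp, fn_unitEnd] at this
      simp only [Function.comp_apply, wt_cons_f] at this
      split_ifs at this <;> omega
  | @wrg p q α h₁ ih =>
    cases hβ with
    | @unit _ q β h₂ =>
      have := congrFun h (wt p)
      rw [fn_wr, (good α).ge _ le_rfl, fn_comp, fn_unitEnd] at this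
      simp only [Function.comp_apply, wt_cons_f] at this
      split_ifs at this <;> omega
    | wrg h₂ =>
      rw [fn_wr, fn_wr] at h
      rw [ih h h₂]
  | @transpose p q α h₁ ih =>
    cases hβ with
    | @transpose _ _ β h₂ =>
      rw [ih (β := β) (funext fun l => ?_) h₂]
      have := congrFun h l
      simp only [fn_comp, fn_counitEnd, fn_wr, Function.comp_apply] at this
      by_cases hl : l < wt p
      · have h₃ := (good α).lt rfl l hl
        have h₄ := (good β).lt rfl l hl
        rw [wt_cons_g] at h₃ h₄
        split_ifs at this <;> omega
      · rw [(good α).ge _ (by omega), (good β).ge _ (by omega)]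

/-- Every function which satisfies the conditions is the function of a `2`-cell. The `2`-cell is
found in normal form. -/
theorem exists_fn_eq {a b : FreeAdj} (p q : Word a b) {φ : ℤ → ℤ}
    (h : Good a b (wt p) (wt q) φ) : ∃ α : p ⟶ q, fn α = φ := by
  -- transposition makes `q` longer and `p` shorter by one letter, whence the factor `2`
  induction hn : 2 * p.length + q.length using Nat.strong_induction_on generalizing b φ with
  | _ n ih =>
  subst hn
  cases b with
  | one =>
    cases p with
    | nil =>
      have h₀ : wt q = 0 := by
        have h₁ := h.ge 0 le_rfl
        have := h.zero rfl
        simp at h₁; omega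
      obtain rfl := eq_nil_of_wt_eq_zero q h₀
      refine ⟨𝟙 _, funext fun l => ?_⟩
      by_cases hl : l < 0
      · exact (h.neg l hl).symm
      · rw [h.ge l (by simpa using hl)]; simp [fn_id]
    | cons p e =>
    change Arrow _ _ at e
    cases e
    -- the source ends with `f`: the transpose has the same values on the regions of `p`, and the
    -- last region of the source, whose number is `wt p`, is omitted
    have h' : Good a .zero (wt p) (wt (q.cons Arrow.g : Word a .zero))
        (fun l => if l < wt p then φ l else φ l + 1) := by
      refine ⟨fun l l' hl => ?_, fun l hl => ?_, fun l hl => ?_, fun ha => ?_, fun l hl => ?_,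
        fun _ l hl => ?_⟩
      · have := h.mono hl
        split_ifs <;> omega
      · rw [if_pos (by omega)]; exact h.neg l hl
      · have := h.nonneg l hl
        split_ifs <;> omega
      · have := h.zero ha
        by_cases h₀ : wt p = 0
        · subst ha
          obtain h | ⟨h, -⟩ := eq_of_wt_eq_zero p h₀ <;> cases h
        · rw [if_pos (by omega)]; exact this
      · rw [if_neg (by omega)]
        have := h.ge l (by rw [wt_cons_f]; exact hl)
        rw [wt_cons_f] at this
        rw [wt_cons_g]; push_cast; omega
      · rw [if_pos hl]
        have := h.le (l := l) (by rw [wt_cons_f]; omega)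
        rw [wt_cons_g]; push_cast; omega
    obtain ⟨α, hα⟩ := ih _ (by simp [Quiver.Path.length]; omega) p (q.cons .g) h' rfl
    refine ⟨wr α .f ≫ counitEnd q, ?_⟩
    rw [fn_comp, fn_wr, fn_counitEnd, hα]
    funext l
    simp only [Function.comp_apply]
    by_cases hl : l < wt p
    · have := h.le (l := l) (by rw [wt_cons_f]; omega)
      rw [if_pos hl, if_pos this]
    · have := h.ge l (by rw [wt_cons_f]; omega)
      rw [wt_cons_f] at this
      rw [if_neg hl, if_neg (by omega)]; omega
  | zero =>
    cases q with
    | nil =>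
      have h₀ : wt p = 0 := by
        by_contra hp
        have h₁ := h.lt rfl 0 (by omega)
        have h₂ := h.nonneg 0 le_rfl
        simp at h₁; omega
      obtain rfl := eq_nil_of_wt_eq_zero p h₀
      refine ⟨𝟙 _, funext fun l => ?_⟩
      by_cases hl : l < 0
      · exact (h.neg l hl).symm
      · rw [h.ge l (by simpa using hl)]; simp [fn_id]
    | cons q e =>
    change Arrow _ _ at e
    cases e
    -- a common `g` is split off if the last region of the source goes to the last of the target
    by_cases hit : ∃ p' : Word a .one, p = p'.cons Arrow.g ∧ φ (wt p') = wt q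
    · obtain ⟨p, rfl, hp⟩ := hit
      have h' : Good a .one (wt p) (wt q) φ := by
        refine ⟨h.mono, h.neg, h.nonneg, h.zero, fun l hl => ?_, fun h => by cases h⟩
        by_cases hl' : l = wt p
        · rw [hl', hp]; omega
        · rw [h.ge l (by rw [wt_cons_g]; push_cast; omega), wt_cons_g, wt_cons_g]
          push_cast; omega
      obtain ⟨α, hα⟩ := ih _ (by simp [Quiver.Path.length]; omega) p q h' rfl
      exact ⟨wr α .g, by rw [fn_wr, hα]⟩
    -- otherwise nothing goes to the last region of the target, which is created by a unit
    · have hlt : ∀ l < (wt p : ℤ), φ l < wt q := by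
        intro l hl
        cases p with
        | nil =>
          rw [h.neg l (by simpa using hl)]; rw [wt_nil] at hl; omega
        | cons p e =>
          change Arrow _ _ at e
          cases e
          have h₁ := h.lt rfl (wt p) (by rw [wt_cons_g]; omega)
          have h₂ := h.mono (show l ≤ wt p by rw [wt_cons_g] at hl; omega)
          have h₃ : φ (wt p) ≠ wt q := fun h => hit ⟨p, rfl, h⟩
          rw [wt_cons_g] at h₁; push_cast at h₁; omega
      cases q with
      | nil =>
        exfalso
        cases p with
        | cons p e =>
        change Arrow _ _ at e
        cases e
        have := hlt 0 (by rw [wt_cons_g]; omega)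
        rw [h.zero rfl] at this
        simp at this
      | cons q e =>
      change Arrow _ _ at e
      cases e
      have h' : Good a .zero (wt p) (wt q) (fun l => if l < wt p then φ l else φ l - 1) := by
        refine ⟨fun l l' hl => ?_, fun l hl => ?_, fun l hl => ?_, fun ha => ?_, fun l hl => ?_,
          fun _ l hl => ?_⟩
        · have h₁ := h.mono hl
          split_ifs with h₂ h₃ h₃
          · exact h₁
          · have h₄ := hlt l h₂
            have h₅ := h.ge l' (by omega)
            simp only [wt_cons_g, wt_cons_f] at h₄ h₅
            push_cast at h₅; omega
          · omega
          · omega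
        · rw [if_pos (by omega)]; exact h.neg l hl
        · have h₁ := h.nonneg l hl
          split_ifs with h₂
          · exact h₁
          · have h₅ := h.ge l (by omega)
            simp only [wt_cons_g, wt_cons_f] at h₅
            push_cast at h₅; omega
        · have h₁ := h.zero ha
          by_cases h₀ : wt p = 0
          · subst ha
            obtain h | ⟨h, -⟩ := eq_of_wt_eq_zero p h₀ <;> cases h
          · rw [if_pos (by omega)]; exact h₁
        · rw [if_neg (by omega), h.ge l hl]
          simp only [wt_cons_g, wt_cons_f]; push_cast; omega
        · rw [if_pos hl]; exact hlt l hl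
      obtain ⟨α, hα⟩ := ih _ (by simp [Quiver.Path.length]) p q h' rfl
      refine ⟨α ≫ unitEnd q, ?_⟩
      rw [fn_comp, fn_unitEnd, hα]
      funext l
      simp only [Function.comp_apply]
      by_cases hl : l < wt p
      · have := hlt l hl
        rw [wt_cons_f] at this
        rw [if_pos hl, if_pos this]
      · have := h.ge l (by omega)
        simp only [wt_cons_g, wt_cons_f] at this
        push_cast at this
        rw [if_neg hl, if_neg (by omega)]; omega

end FreeAdj

namespace BiHH

/-! ### Level zero of the Hochschild homology -/

section

variable {B : Type u} [Bicategory.{w, v} B]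

/-- The functor from the category of endomorphisms of an object to the Hochschild homology. -/
def endo (X : B) : (X ⟶ X) ⥤ biHH B :=
  Sigma.incl (C := fun X : B => (X ⟶ X)) X ⋙ ι B .zero

/-- The object of the Hochschild homology given by an object of level one. -/
abbrev pt₁ {X Y : B} (F : X ⟶ Y) (G : Y ⟶ X) : biHH B := (ι B .one).obj ⟨(X, Y), F, G⟩

/-- The object of the Hochschild homology given by an object of level two. -/
abbrev pt₂ {X Y Z : B} (F : X ⟶ Y) (G : Y ⟶ Z) (H : Z ⟶ X) : biHH B :=
  (ι B .two).obj ⟨(X, Y, Z), F, G, H⟩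

/-- The gluing isomorphism along `d₀ : (F, G) ↦ F G`. -/
def glueD10 {X Y : B} (F : X ⟶ Y) (G : Y ⟶ X) : pt₁ F G ≅ (endo X).obj (F ≫ G) :=
  (glueIso B .d10).app ⟨(X, Y), F, G⟩

/-- The gluing isomorphism along `d₁ : (F, G) ↦ G F`. -/
def glueD11 {X Y : B} (F : X ⟶ Y) (G : Y ⟶ X) : pt₁ F G ≅ (endo Y).obj (G ≫ F) :=
  (glueIso B .d11).app ⟨(X, Y), F, G⟩

/-- The gluing isomorphism along `s₀ : F ↦ (F, id)`. -/
def glueS00 {X : B} (F : X ⟶ X) : (endo X).obj F ≅ pt₁ F (𝟙 X) :=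
  (glueIso B .s00).app ⟨X, F⟩

/-- The gluing isomorphism along `d₀ : (F, G, H) ↦ (F G, H)`. -/
def glueD20 {X Y Z : B} (F : X ⟶ Y) (G : Y ⟶ Z) (H : Z ⟶ X) : pt₂ F G H ≅ pt₁ (F ≫ G) H :=
  (glueIso B .d20).app ⟨(X, Y, Z), F, G, H⟩

/-- The gluing isomorphism along `d₁ : (F, G, H) ↦ (F, G H)`. -/
def glueD21 {X Y Z : B} (F : X ⟶ Y) (G : Y ⟶ Z) (H : Z ⟶ X) : pt₂ F G H ≅ pt₁ F (G ≫ H) :=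
  (glueIso B .d21).app ⟨(X, Y, Z), F, G, H⟩

/-- The gluing isomorphism along `d₂ : (F, G, H) ↦ (H F, G)`. -/
def glueD22 {X Y Z : B} (F : X ⟶ Y) (G : Y ⟶ Z) (H : Z ⟶ X) : pt₂ F G H ≅ pt₁ (H ≫ F) G :=
  (glueIso B .d22).app ⟨(X, Y, Z), F, G, H⟩

/-- The gluing isomorphism along `s₀ : (F, G) ↦ (F, id, G)`. -/
def glueS10 {X Y : B} (F : X ⟶ Y) (G : Y ⟶ X) : pt₁ F G ≅ pt₂ F (𝟙 Y) G :=
  (glueIso B .s10).app ⟨(X, Y), F, G⟩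

/-- The gluing isomorphism along `s₁ : (F, G) ↦ (F, G, id)`. -/
def glueS11 {X Y : B} (F : X ⟶ Y) (G : Y ⟶ X) : pt₁ F G ≅ pt₂ F G (𝟙 X) :=
  (glueIso B .s11).app ⟨(X, Y), F, G⟩

/-- A pair of `2`-cells, as a morphism of level one. -/
abbrev pair {X Y : B} {F F' : X ⟶ Y} {G G' : Y ⟶ X} (α : F ⟶ F') (β : G ⟶ G') :
    pt₁ F G ⟶ pt₁ F' G' :=
  (ι B .one).map (Sigma.SigmaHom.mk (α, β) :
    (⟨(X, Y), F, G⟩ : Level B .one) ⟶ ⟨(X, Y), F', G'⟩)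

theorem glueD10_naturality {X Y : B} {F F' : X ⟶ Y} {G G' : Y ⟶ X} (α : F ⟶ F') (β : G ⟶ G') :
    pair α β ≫ (glueD10 F' G').hom = (glueD10 F G).hom ≫ (endo X).map (hcomp α β) :=
  (glueIso B .d10).hom.naturality _

theorem glueD11_naturality {X Y : B} {F F' : X ⟶ Y} {G G' : Y ⟶ X} (α : F ⟶ F') (β : G ⟶ G') :
    pair α β ≫ (glueD11 F' G').hom = (glueD11 F G).hom ≫ (endo Y).map (hcomp β α) :=
  (glueIso B .d11).hom.naturality _

theorem glue_d0d0 {X Y Z : B} (F : X ⟶ Y) (G : Y ⟶ Z) (H : Z ⟶ X) :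
    (glueD20 F G H).hom ≫ (glueD10 (F ≫ G) H).hom ≫ (endo X).map (α_ F G H).hom =
      (glueD21 F G H).hom ≫ (glueD10 F (G ≫ H)).hom :=
  glueIso_square B .d0d0 ⟨(X, Y, Z), F, G, H⟩

theorem glue_d1d0 {X Y Z : B} (F : X ⟶ Y) (G : Y ⟶ Z) (H : Z ⟶ X) :
    (glueD20 F G H).hom ≫ (glueD11 (F ≫ G) H).hom ≫ (endo Z).map (α_ H F G).inv =
      (glueD22 F G H).hom ≫ (glueD10 (H ≫ F) G).hom :=
  glueIso_square B .d1d0 ⟨(X, Y, Z), F, G, H⟩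

theorem glue_d1d1 {X Y Z : B} (F : X ⟶ Y) (G : Y ⟶ Z) (H : Z ⟶ X) :
    (glueD21 F G H).hom ≫ (glueD11 F (G ≫ H)).hom ≫ (endo Y).map (α_ G H F).hom =
      (glueD22 F G H).hom ≫ (glueD11 (H ≫ F) G).hom :=
  glueIso_square B .d1d1 ⟨(X, Y, Z), F, G, H⟩

theorem glue_d0s1 {X Y : B} (F : X ⟶ Y) (G : Y ⟶ X) :
    (glueS11 F G).hom ≫ (glueD20 F G (𝟙 X)).hom = (glueD10 F G).hom ≫ (glueS00 (F ≫ G)).hom := by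
  have h := glueIso_square B .d0s1 ⟨(X, Y), F, G⟩
  refine Eq.trans (congrArg (_ ≫ ·) ?_) h
  refine (Category.comp_id _).symm.trans (congrArg (_ ≫ ·) ?_)
  exact (CategoryTheory.Functor.map_id (ι B .one) ⟨(X, X), F ≫ G, 𝟙 X⟩).symm

theorem glue_d0s0 {X : B} (F : X ⟶ X) :
    (glueS00 F).hom ≫ (glueD10 F (𝟙 X)).hom ≫ (endo X).map (ρ_ F).hom = 𝟙 _ :=
  glueIso_triangle B .d0s0 ⟨X, F⟩

theorem glue_d1s0 {X : B} (F : X ⟶ X) :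
    (glueS00 F).hom ≫ (glueD11 F (𝟙 X)).hom ≫ (endo X).map (λ_ F).hom = 𝟙 _ :=
  glueIso_triangle B .d1s0 ⟨X, F⟩

theorem glue_d0s0' {X Y : B} (F : X ⟶ Y) (G : Y ⟶ X) :
    (glueS10 F G).hom ≫ (glueD20 F (𝟙 Y) G).hom ≫ pair (ρ_ F).hom (𝟙 G) = 𝟙 _ :=
  glueIso_triangle B .d0s0' ⟨(X, Y), F, G⟩

/-- The cyclic rotation `F G ≅ G F` in the Hochschild homology. -/
def tau {X Y : B} (F : X ⟶ Y) (G : Y ⟶ X) : (endo X).obj (F ≫ G) ≅ (endo Y).obj (G ≫ F) :=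
  (glueD10 F G).symm ≪≫ glueD11 F G

theorem glueD10_tau {X Y : B} (F : X ⟶ Y) (G : Y ⟶ X) :
    (glueD10 F G).hom ≫ (tau F G).hom = (glueD11 F G).hom := by
  simp [tau]

theorem tau_naturality {X Y : B} {F F' : X ⟶ Y} {G G' : Y ⟶ X} (α : F ⟶ F') (β : G ⟶ G') :
    (endo X).map (hcomp α β) ≫ (tau F' G').hom = (tau F G).hom ≫ (endo Y).map (hcomp β α) := by
  rw [← cancel_epi (glueD10 F G).hom, ← Category.assoc, ← glueD10_naturality, Category.assoc,
    glueD10_tau, glueD11_naturality, ← Category.assoc, glueD10_tau]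

/-- The two ways to rotate a triple `F`, `G`, `H` to `G H F`: both are the comparison along level
two. -/
theorem tau_hexagon {X Y Z : B} (F : X ⟶ Y) (G : Y ⟶ Z) (H : Z ⟶ X) :
    (endo X).map (α_ F G H).hom ≫ (tau F (G ≫ H)).hom ≫ (endo Y).map (α_ G H F).hom =
      (tau (F ≫ G) H).hom ≫ (endo Z).map (α_ H F G).inv ≫ (tau (H ≫ F) G).hom := by
  rw [← cancel_epi (glueD10 (F ≫ G) H).hom, ← cancel_epi (glueD20 F G H).hom]
  have h₀ := glue_d0d0 F G H
  have h₁ := glue_d1d0 F G H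
  rw [reassoc_of% h₀, reassoc_of% glueD10_tau, glue_d1d1, reassoc_of% glueD10_tau, reassoc_of% h₁,
    glueD10_tau]

theorem tau_unit {X : B} (F : X ⟶ X) :
    (tau F (𝟙 X)).hom = (endo X).map ((ρ_ F).hom ≫ (λ_ F).inv) := by
  have h := glue_d0s0 F
  rw [← cancel_epi (glueD10 F (𝟙 X)).hom, ← cancel_epi (glueS00 F).hom, glueD10_tau,
    CategoryTheory.Functor.map_comp, reassoc_of% h, ← cancel_mono ((endo X).map (λ_ F).hom),
    Category.assoc, glue_d1s0, ← CategoryTheory.Functor.map_comp, Iso.inv_hom_id,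
    CategoryTheory.Functor.map_id]

/-! ### Generation by cells and rotations -/

/-- The functor from a level to level zero by which the objects of the level are identified with
objects of level zero. -/
def base : ∀ k : Lvl, Level B k ⥤ Level B .zero
  | .zero => 𝟭 _
  | .one => op B .d10
  | .two => op B .d20 ⋙ op B .d10

/-- In the Hochschild homology, every object is isomorphic to an object of level zero. -/
def baseIso : ∀ k : Lvl, ι B k ≅ base k ⋙ ι B .zero
  | .zero => (Functor.leftUnitor _).symm
  | .one => glueIso B .d10
  | .two => glueIso B .d20 ≪≫ Functor.isoWhiskerLeft (op B .d20) (glueIso B .d10)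

/-- The composites of cells of level zero, rotations and inverses of rotations. -/
inductive Zig : ∀ {x y : Level B .zero}, ((ι B .zero).obj x ⟶ (ι B .zero).obj y) → Prop
  | cell {x y : Level B .zero} (f : x ⟶ y) : Zig ((ι B .zero).map f)
  | tau {X Y : B} (F : X ⟶ Y) (G : Y ⟶ X) :
      Zig (x := ⟨X, F ≫ G⟩) (y := ⟨Y, G ≫ F⟩) (tau F G).hom
  | tau_inv {X Y : B} (F : X ⟶ Y) (G : Y ⟶ X) :
      Zig (x := ⟨Y, G ≫ F⟩) (y := ⟨X, F ≫ G⟩) (tau F G).inv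
  | comp {x y z : Level B .zero} {f : (ι B .zero).obj x ⟶ (ι B .zero).obj y}
      {g : (ι B .zero).obj y ⟶ (ι B .zero).obj z} (hf : Zig f) (hg : Zig g) : Zig (f ≫ g)

theorem Zig.id (x : Level B .zero) : Zig (𝟙 ((ι B .zero).obj x)) :=
  (CategoryTheory.Functor.map_id (ι B .zero) x) ▸ .cell _

/-- The gluing isomorphisms become composites of cells and rotations when their source and target
are identified with objects of level zero. -/
theorem exists_zig_glue {k l : Lvl} (a : Op k l) (x : Level B k) :
    ∃ e : (ι B .zero).obj ((base k).obj x) ≅ (ι B .zero).obj ((base l).obj ((op B a).obj x)),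
      Zig e.hom ∧ Zig e.inv ∧
        (glueIso B a).hom.app x ≫ (baseIso l).hom.app ((op B a).obj x) =
          (baseIso k).hom.app x ≫ e.hom := by
  cases a with
  | d10 => exact ⟨Iso.refl _, .id _, .id _, rfl⟩
  | d11 =>
    obtain ⟨⟨X, Y⟩, F, G⟩ := x
    exact ⟨BiHH.tau F G, .tau F G, .tau_inv F G,
      (Category.comp_id _).trans (glueD10_tau F G).symm⟩
  | s00 =>
    obtain ⟨X, F⟩ := x
    refine ⟨(endo X).mapIso (ρ_ F).symm, .cell _, .cell _, ?_⟩
    refine Eq.trans ?_ (Category.id_comp _).symm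
    change (glueS00 F).hom ≫ (glueD10 F (𝟙 X)).hom = (endo X).map (ρ_ F).inv
    rw [← cancel_mono ((endo X).map (ρ_ F).hom), Category.assoc, glue_d0s0,
      ← CategoryTheory.Functor.map_comp, Iso.inv_hom_id, CategoryTheory.Functor.map_id]
  | d20 => exact ⟨Iso.refl _, .id _, .id _, (Category.comp_id _).symm⟩
  | d21 =>
    obtain ⟨⟨X, Y, Z⟩, F, G, H⟩ := x
    exact ⟨(endo X).mapIso (α_ F G H), .cell _, .cell _,
      (glue_d0d0 F G H).symm.trans (Category.assoc _ _ _).symm⟩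
  | d22 =>
    obtain ⟨⟨X, Y, Z⟩, F, G, H⟩ := x
    refine ⟨BiHH.tau (F ≫ G) H ≪≫ (endo Z).mapIso (α_ H F G).symm,
      .comp (.tau _ _) (.cell _), .comp (.cell _) (.tau_inv _ _), ?_⟩
    refine (glue_d1d0 F G H).symm.trans ?_
    change _ = ((glueD20 F G H).hom ≫ (glueD10 (F ≫ G) H).hom) ≫ (BiHH.tau (F ≫ G) H).hom ≫
      (endo Z).map (α_ H F G).inv
    rw [Category.assoc, reassoc_of% glueD10_tau]
  | s10 =>
    obtain ⟨⟨X, Y⟩, F, G⟩ := x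
    refine ⟨(endo X).mapIso (whiskerRightIso (ρ_ F).symm G), .cell _, .cell _, ?_⟩
    change (glueS10 F G).hom ≫ (glueD20 F (𝟙 Y) G).hom ≫ (glueD10 (F ≫ 𝟙 Y) G).hom =
      (glueD10 F G).hom ≫ (endo X).map ((ρ_ F).inv ▷ G)
    rw [← cancel_mono ((endo X).map ((ρ_ F).hom ▷ G))]
    have h : (ρ_ F).hom ▷ G = hcomp (ρ_ F).hom (𝟙 G) := by simp [hcomp]
    have h' := glue_d0s0' F G
    simp only [Category.assoc]
    rw [← CategoryTheory.Functor.map_comp, inv_hom_whiskerRight, CategoryTheory.Functor.map_id,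
      h, ← glueD10_naturality, reassoc_of% h']
    exact (Category.comp_id _).symm
  | s11 =>
    obtain ⟨⟨X, Y⟩, F, G⟩ := x
    refine ⟨(endo X).mapIso (ρ_ (F ≫ G)).symm, .cell _, .cell _, ?_⟩
    change (glueS11 F G).hom ≫ (glueD20 F G (𝟙 X)).hom ≫ (glueD10 (F ≫ G) (𝟙 X)).hom =
      (glueD10 F G).hom ≫ (endo X).map (ρ_ (F ≫ G)).inv
    rw [← cancel_mono ((endo X).map (ρ_ (F ≫ G)).hom)]
    have h := glue_d0s1 F G
    simp only [Category.assoc]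
    rw [reassoc_of% h, glue_d0s0, ← CategoryTheory.Functor.map_comp, Iso.inv_hom_id,
      CategoryTheory.Functor.map_id]

/-- The object of level zero which represents an object of the Hochschild homology. -/
def baseObj (v : biHH B) : Level B .zero := (base (Vertex.lvl v.as)).obj (Vertex.obj v.as)

/-- Every object of the Hochschild homology is isomorphic to an object of level zero. -/
def baseObjIso (v : biHH B) : v ≅ (ι B .zero).obj (baseObj v) :=
  (baseIso (Vertex.lvl v.as)).app (Vertex.obj v.as)

theorem zig_gen {v w : Vertex B} (g : v ⟶ w) :
    Zig ((baseObjIso _).inv ≫ (CategoryTheory.Quotient.functor (Rel B)).map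
      ((Paths.of (Vertex B)).map g) ≫ (baseObjIso _).hom) := by
  change Gen v w at g
  cases g with
  | @cell k x y f =>
    have h : (ι B k).map f ≫ (baseIso k).hom.app y =
      (baseIso k).hom.app x ≫ (ι B .zero).map ((base k).map f) := (baseIso k).hom.naturality f
    change Zig (((baseIso k).app x).inv ≫ (ι B k).map f ≫ (baseIso k).hom.app y)
    have h' : ((baseIso k).app x).inv ≫ (ι B k).map f ≫ (baseIso k).hom.app y =
      (ι B .zero).map ((base k).map f) := (Iso.inv_comp_eq _).2 h
    rw [h']
    exact .cell _
  | @glue k l a x =>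
    obtain ⟨e, h₁, -, h₂⟩ := exists_zig_glue a x
    change Zig (((baseIso k).app x).inv ≫ (glueIso B a).hom.app x ≫ (baseIso l).hom.app _)
    have h' : ((baseIso k).app x).inv ≫ (glueIso B a).hom.app x ≫ (baseIso l).hom.app _ = e.hom :=
      (Iso.inv_comp_eq _).2 h₂
    rwa [h']
  | @unglue k l a x =>
    obtain ⟨e, -, h₁, h₂⟩ := exists_zig_glue a x
    change Zig (((baseIso l).app _).inv ≫ ((glueIso B a).app x).inv ≫ ((baseIso k).app x).hom)
    have h' : ((baseIso l).app _).inv ≫ ((glueIso B a).app x).inv ≫ ((baseIso k).app x).hom =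
        e.inv := by
      rw [Iso.inv_comp_eq, Iso.inv_comp_eq, ← Category.assoc, Iso.eq_comp_inv]
      exact h₂.symm
    rwa [h']

theorem zig_conj {v w : biHH B} (m : v ⟶ w) :
    Zig ((baseObjIso v).inv ≫ m ≫ (baseObjIso w).hom) := by
  obtain ⟨v⟩ := v
  obtain ⟨w⟩ := w
  obtain ⟨m, rfl⟩ := (CategoryTheory.Quotient.functor (Rel B)).map_surjective m
  refine Paths.induction (V := Vertex B) (P := fun {v w} m => Zig ((baseObjIso _).inv ≫
    (CategoryTheory.Quotient.functor (Rel B)).map m ≫ (baseObjIso _).hom)) (fun {v} => ?_)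
    (fun {u v w} m g ih => ?_) m
  · rw [CategoryTheory.Functor.map_id, Category.id_comp, Iso.inv_hom_id]
    exact .id _
  · have h' := ih.comp (zig_gen g)
    rw [CategoryTheory.Functor.map_comp]
    simpa only [Category.assoc, Iso.hom_inv_id_assoc] using h'

/-- Every morphism between objects of level zero is a composite of cells and rotations. -/
theorem zig {x y : Level B .zero} (m : (ι B .zero).obj x ⟶ (ι B .zero).obj y) : Zig m := by
  have h := zig_conj m
  change Zig (𝟙 _ ≫ m ≫ 𝟙 _) at h
  rwa [Category.id_comp, Category.comp_id] at h

end
end BiHH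

namespace BiHH

/-! ### Functors out of the Hochschild homology -/

/-- The data of a functor out of the Hochschild homology, on level zero: functors on the categories
of endomorphisms, and rotation isomorphisms `F G ≅ G F` subject to a hexagon identity and a unit
identity. -/
structure CyclicCocone (B : Type u) [Bicategory.{w, v} B] (D : Type*) [Category* D] where
  /-- the functors on the categories of endomorphisms -/
  Φ (X : B) : (X ⟶ X) ⥤ D
  /-- the rotations -/
  τ {X Y : B} (F : X ⟶ Y) (G : Y ⟶ X) : (Φ X).obj (F ≫ G) ≅ (Φ Y).obj (G ≫ F)
  naturality {X Y : B} {F F' : X ⟶ Y} {G G' : Y ⟶ X} (α : F ⟶ F') (β : G ⟶ G') :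
    (Φ X).map (hcomp α β) ≫ (τ F' G').hom = (τ F G).hom ≫ (Φ Y).map (hcomp β α)
  hexagon {X Y Z : B} (F : X ⟶ Y) (G : Y ⟶ Z) (H : Z ⟶ X) :
    (Φ X).map (α_ F G H).hom ≫ (τ F (G ≫ H)).hom ≫ (Φ Y).map (α_ G H F).hom =
      (τ (F ≫ G) H).hom ≫ (Φ Z).map (α_ H F G).inv ≫ (τ (H ≫ F) G).hom
  unit {X : B} (F : X ⟶ X) : (τ F (𝟙 X)).hom = (Φ X).map ((ρ_ F).hom ≫ (λ_ F).inv)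

namespace CyclicCocone

variable {B : Type u} [Bicategory.{w, v} B] {D : Type*} [Category* D] (c : CyclicCocone B D)

/-- The functors on the levels. -/
def onLevel : ∀ k : Lvl, Level B k ⥤ D
  | .zero => Sigma.desc c.Φ
  | .one => Sigma.desc fun X =>
      { obj := fun F => (c.Φ X.1).obj (F.1 ≫ F.2)
        map := fun α => (c.Φ X.1).map (hcomp α.1 α.2)
        map_id := fun F => (congrArg _ (hcomp_id F.1 F.2)).trans ((c.Φ X.1).map_id _)
        map_comp := fun α β => (congrArg _ (hcomp_comp α.1 β.1 α.2 β.2)).trans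
          ((c.Φ X.1).map_comp _ _) }
  | .two => Sigma.desc fun X =>
      { obj := fun F => (c.Φ X.1).obj ((F.1 ≫ F.2.1) ≫ F.2.2)
        map := fun α => (c.Φ X.1).map (hcomp (hcomp α.1 α.2.1) α.2.2)
        map_id := fun F => by
          refine (congrArg (c.Φ X.1).map ?_).trans ((c.Φ X.1).map_id _)
          exact (congrArg (hcomp · _) (hcomp_id F.1 F.2.1)).trans (hcomp_id _ _)
        map_comp := fun α β => by
          refine (congrArg (c.Φ X.1).map ?_).trans ((c.Φ X.1).map_comp _ _)
          exact (congrArg (hcomp · _) (hcomp_comp α.1 β.1 α.2.1 β.2.1)).trans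
            (hcomp_comp _ _ _ _) }

theorem map_rightUnitor_inv {X : B} {F G : X ⟶ X} (α : F ⟶ G) :
    (c.Φ X).map α ≫ (c.Φ X).map (ρ_ G).inv =
      (c.Φ X).map (ρ_ F).inv ≫ (c.Φ X).map (hcomp α (𝟙 (𝟙 X))) := by
  rw [← Functor.map_comp, ← Functor.map_comp]
  simp [hcomp]

theorem map_rightUnitor_inv_whiskerRight {X Y : B} {F F' : X ⟶ Y} {G G' : Y ⟶ X} (α : F ⟶ F')
    (β : G ⟶ G') :
    (c.Φ X).map (hcomp α β) ≫ (c.Φ X).map ((ρ_ F').inv ▷ G') =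
      (c.Φ X).map ((ρ_ F).inv ▷ G) ≫ (c.Φ X).map (hcomp (hcomp α (𝟙 (𝟙 Y))) β) := by
  have h₀ : α ≫ (ρ_ F').inv = (ρ_ F).inv ≫ hcomp α (𝟙 (𝟙 Y)) := by simp [hcomp]
  have h (K : X ⟶ Y) (L : Y ⟶ X) : (ρ_ K).inv ▷ L = hcomp (ρ_ K).inv (𝟙 L) := by simp [hcomp]
  rw [← Functor.map_comp, ← Functor.map_comp, h, h, ← hcomp_comp, ← hcomp_comp, h₀,
    Category.comp_id, Category.id_comp]

/-- The components of the isomorphisms of the pseudo-cocone. -/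
def glueApp : ∀ {k l : Lvl} (a : Op k l) (x : Level B k),
    (c.onLevel k).obj x ≅ (op B a ⋙ c.onLevel l).obj x
  | _, _, .d10, ⟨X, F, G⟩ => Iso.refl ((c.Φ X.1).obj (F ≫ G))
  | _, _, .d11, ⟨_, F, G⟩ => c.τ F G
  | _, _, .s00, ⟨X, F⟩ => (c.Φ X).mapIso (ρ_ F).symm
  | _, _, .d20, ⟨X, F, G, H⟩ => Iso.refl ((c.Φ X.1).obj ((F ≫ G) ≫ H))
  | _, _, .d21, ⟨X, F, G, H⟩ => (c.Φ X.1).mapIso (α_ F G H)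
  | _, _, .d22, ⟨X, F, G, H⟩ => c.τ (F ≫ G) H ≪≫ (c.Φ X.2.2).mapIso (α_ H F G).symm
  | _, _, .s10, ⟨X, F, G⟩ => (c.Φ X.1).mapIso (whiskerRightIso (ρ_ F).symm G)
  | _, _, .s11, ⟨X, F, G⟩ => (c.Φ X.1).mapIso (ρ_ (F ≫ G)).symm

theorem map_associator {X Y Z : B} {F F' : X ⟶ Y} {G G' : Y ⟶ Z} {H H' : Z ⟶ X}
    (α : F ⟶ F') (β : G ⟶ G') (γ : H ⟶ H') :
    (c.Φ X).map (hcomp (hcomp α β) γ) ≫ (c.Φ X).map (α_ F' G' H').hom =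
      (c.Φ X).map (α_ F G H).hom ≫ (c.Φ X).map (hcomp α (hcomp β γ)) := by
  rw [← Functor.map_comp, ← Functor.map_comp, hcomp_associator]

theorem naturality_associator {X Y Z : B} {F F' : X ⟶ Y} {G G' : Y ⟶ Z} {H H' : Z ⟶ X}
    (α : F ⟶ F') (β : G ⟶ G') (γ : H ⟶ H') :
    (c.Φ X).map (hcomp (hcomp α β) γ) ≫ (c.τ (F' ≫ G') H').hom ≫ (c.Φ Z).map (α_ H' F' G').inv =
      ((c.τ (F ≫ G) H).hom ≫ (c.Φ Z).map (α_ H F G).inv) ≫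
        (c.Φ Z).map (hcomp (hcomp γ α) β) := by
  rw [← Category.assoc, c.naturality, Category.assoc, Category.assoc, ← Functor.map_comp,
    ← Functor.map_comp, hcomp_associator_inv]

theorem glueApp_naturality {k l : Lvl} (a : Op k l) {x y : Level B k} (f : x ⟶ y) :
    (c.onLevel k).map f ≫ (c.glueApp a y).hom =
      (c.glueApp a x).hom ≫ (op B a ⋙ c.onLevel l).map f := by
  cases a with
  | d10 =>
    obtain @⟨⟨X, Y⟩, ⟨F, G⟩, ⟨F', G'⟩, ⟨α, β⟩⟩ := f
    exact (Category.comp_id _).trans (Category.id_comp _).symm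
  | d11 =>
    obtain @⟨⟨X, Y⟩, ⟨F, G⟩, ⟨F', G'⟩, ⟨α, β⟩⟩ := f
    exact c.naturality (X := X) (Y := Y) (F := F) (F' := F') (G := G) (G' := G') α β
  | s00 =>
    obtain @⟨X, F, G, α⟩ := f
    exact c.map_rightUnitor_inv (X := X) (F := F) (G := G) α
  | d20 =>
    obtain @⟨⟨X, Y, Z⟩, ⟨F, G, H⟩, ⟨F', G', H'⟩, ⟨α, β, γ⟩⟩ := f
    exact (Category.comp_id _).trans (Category.id_comp _).symm
  | d21 =>
    obtain @⟨⟨X, Y, Z⟩, ⟨F, G, H⟩, ⟨F', G', H'⟩, ⟨α, β, γ⟩⟩ := f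
    exact c.map_associator (X := X) (Y := Y) (Z := Z) (F := F) (F' := F') (G := G) (G' := G')
      (H := H) (H' := H') α β γ
  | d22 =>
    obtain @⟨⟨X, Y, Z⟩, ⟨F, G, H⟩, ⟨F', G', H'⟩, ⟨α, β, γ⟩⟩ := f
    exact c.naturality_associator (X := X) (Y := Y) (Z := Z) (F := F) (F' := F') (G := G) (G' := G')
      (H := H) (H' := H') α β γ
  | s10 =>
    obtain @⟨⟨X, Y⟩, ⟨F, G⟩, ⟨F', G'⟩, ⟨α, β⟩⟩ := f
    exact c.map_rightUnitor_inv_whiskerRight (X := X) (Y := Y) (F := F) (F' := F') (G := G)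
      (G' := G') α β
  | s11 =>
    obtain @⟨⟨X, Y⟩, ⟨F, G⟩, ⟨F', G'⟩, ⟨α, β⟩⟩ := f
    exact c.map_rightUnitor_inv (X := X) (F := F ≫ G) (G := F' ≫ G') (hcomp α β)

/-- The isomorphisms of the pseudo-cocone. -/
def glueIso {k l : Lvl} (a : Op k l) : c.onLevel k ≅ op B a ⋙ c.onLevel l :=
  NatIso.ofComponents (c.glueApp a) (c.glueApp_naturality a)

theorem comp_map_id {E : Type*} [Category* E] (K : E ⥤ D) {e : E} {x y : D} (f : x ⟶ y)
    (g : y ⟶ K.obj e) {h : x ⟶ K.obj e} (H : f ≫ g = h) : f ≫ g ≫ K.map (𝟙 e) = h := by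
  rw [CategoryTheory.Functor.map_id, Category.comp_id, H]

theorem glueIso_square {k l l' m : Lvl} {a : Op k l} {b : Op l m} {a' : Op k l'} {b' : Op l' m}
    (s : Square a b a' b') (x : Level B k) :
    (c.glueIso a).hom.app x ≫ (c.glueIso b).hom.app ((op B a).obj x) ≫
        (c.onLevel m).map ((squareIso B s).hom.app x) =
      (c.glueIso a').hom.app x ≫ (c.glueIso b').hom.app ((op B a').obj x) := by
  cases s with
  | d0d0 =>
    obtain ⟨⟨X, Y, Z⟩, F, G, H⟩ := x
    change 𝟙 _ ≫ 𝟙 _ ≫ (c.Φ X).map (α_ F G H).hom = (c.Φ X).map (α_ F G H).hom ≫ 𝟙 _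
    rw [Category.id_comp, Category.id_comp, Category.comp_id]
  | d1d0 =>
    obtain ⟨⟨X, Y, Z⟩, F, G, H⟩ := x
    change 𝟙 _ ≫ (c.τ (F ≫ G) H).hom ≫ (c.Φ Z).map (α_ H F G).inv =
      ((c.τ (F ≫ G) H).hom ≫ (c.Φ Z).map (α_ H F G).inv) ≫ 𝟙 _
    rw [Category.id_comp, Category.comp_id]
  | d1d1 =>
    obtain ⟨⟨X, Y, Z⟩, F, G, H⟩ := x
    exact (c.hexagon F G H).trans (Category.assoc _ _ _).symm
  | d2s0 =>
    obtain ⟨⟨X, Y⟩, F, G⟩ := x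
    refine comp_map_id (c.onLevel .one) _ _ ?_
    change (c.Φ X).map ((ρ_ F).inv ▷ G) ≫ (c.τ (F ≫ 𝟙 Y) G).hom ≫
      (c.Φ Y).map (α_ G F (𝟙 Y)).inv = (c.τ F G).hom ≫ (c.Φ Y).map (ρ_ (G ≫ F)).inv
    have h := c.naturality (ρ_ F).inv (𝟙 G)
    simp only [hcomp, Bicategory.whiskerLeft_id, Bicategory.id_whiskerRight, Category.comp_id,
      Category.id_comp] at h
    rw [reassoc_of% h, ← Functor.map_comp]
    simp
  | d0s1 =>
    obtain ⟨⟨X, Y⟩, F, G⟩ := x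
    refine comp_map_id (c.onLevel .one) _ _ ?_
    exact (Category.comp_id _).trans (Category.id_comp _).symm
  | s0s0 =>
    obtain ⟨X, F⟩ := x
    refine comp_map_id (c.onLevel .two) _ _ ?_
    change (c.Φ X).map (ρ_ F).inv ≫ (c.Φ X).map ((ρ_ F).inv ▷ (𝟙 X)) =
        (c.Φ X).map (ρ_ F).inv ≫ (c.Φ X).map (ρ_ (F ≫ 𝟙 X)).inv
    rw [← Functor.map_comp, ← Functor.map_comp]
    simp

theorem glueIso_triangle {k l : Lvl} {a : Op k l} {b : Op l k} (t : Triangle a b)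
    (x : Level B k) :
    (c.glueIso a).hom.app x ≫ (c.glueIso b).hom.app ((op B a).obj x) ≫
        (c.onLevel k).map ((triangleIso B t).hom.app x) = 𝟙 ((c.onLevel k).obj x) := by
  cases t with
  | d0s0 =>
    obtain ⟨X, F⟩ := x
    change (c.Φ X).map (ρ_ F).inv ≫ 𝟙 _ ≫ (c.Φ X).map (ρ_ F).hom = 𝟙 ((c.Φ X).obj F)
    rw [Category.id_comp, ← Functor.map_comp, Iso.inv_hom_id, CategoryTheory.Functor.map_id]
  | d1s0 =>
    obtain ⟨X, F⟩ := x
    change (c.Φ X).map (ρ_ F).inv ≫ (c.τ F (𝟙 X)).hom ≫ (c.Φ X).map (λ_ F).hom =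
      𝟙 ((c.Φ X).obj F)
    rw [c.unit, ← Functor.map_comp, ← Functor.map_comp]
    simp
  | d0s0' =>
    obtain ⟨⟨X, Y⟩, F, G⟩ := x
    change (c.Φ X).map ((ρ_ F).inv ▷ G) ≫ 𝟙 _ ≫ (c.Φ X).map (hcomp (ρ_ F).hom (𝟙 G)) =
      𝟙 ((c.Φ X).obj (F ≫ G))
    rw [Category.id_comp, ← Functor.map_comp]
    simp [hcomp]
  | d1s0' =>
    obtain ⟨⟨X, Y⟩, F, G⟩ := x
    change (c.Φ X).map ((ρ_ F).inv ▷ G) ≫ (c.Φ X).map (α_ F (𝟙 Y) G).hom ≫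
      (c.Φ X).map (hcomp (𝟙 F) (λ_ G).hom) = 𝟙 ((c.Φ X).obj (F ≫ G))
    rw [← Functor.map_comp, ← Functor.map_comp]
    simp [hcomp]
  | d1s1' =>
    obtain ⟨⟨X, Y⟩, F, G⟩ := x
    change (c.Φ X).map (ρ_ (F ≫ G)).inv ≫ (c.Φ X).map (α_ F G (𝟙 X)).hom ≫
      (c.Φ X).map (hcomp (𝟙 F) (ρ_ G).hom) = 𝟙 ((c.Φ X).obj (F ≫ G))
    rw [← Functor.map_comp, ← Functor.map_comp]
    simp [hcomp]
  | d2s1' =>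
    obtain ⟨⟨X, Y⟩, F, G⟩ := x
    change (c.Φ X).map (ρ_ (F ≫ G)).inv ≫ ((c.τ (F ≫ G) (𝟙 X)).hom ≫
      (c.Φ X).map (α_ (𝟙 X) F G).inv) ≫ (c.Φ X).map (hcomp (λ_ F).hom (𝟙 G)) =
        𝟙 ((c.Φ X).obj (F ≫ G))
    rw [c.unit, ← Functor.map_comp, ← Functor.map_comp, ← Functor.map_comp]
    simp [hcomp]

/-- The functor out of the Hochschild homology. -/
def functor : biHH B ⥤ D :=
  desc c.onLevel c.glueIso c.glueIso_square c.glueIso_triangle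

end CyclicCocone

section

variable {B : Type u} [Bicategory.{w, v} B] {D : Type*} [Category* D] (φ : ∀ k : Lvl, Level B k ⥤ D)
  (θ : ∀ {k l : Lvl} (a : Op k l), φ k ≅ op B a ⋙ φ l)
    (hs : ∀ {k l l' m : Lvl} {a : Op k l} {b : Op l m} {a' : Op k l'} {b' : Op l' m}
      (s : Square a b a' b') (x : Level B k),
      (θ a).hom.app x ≫ (θ b).hom.app ((op B a).obj x) ≫
          (φ m).map ((squareIso B s).hom.app x) =
        (θ a').hom.app x ≫ (θ b').hom.app ((op B a').obj x))
    (ht : ∀ {k l : Lvl} {a : Op k l} {b : Op l k} (t : Triangle a b) (x : Level B k),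
      (θ a).hom.app x ≫ (θ b).hom.app ((op B a).obj x) ≫
          (φ k).map ((triangleIso B t).hom.app x) = 𝟙 ((φ k).obj x))

theorem desc_map_glue {k l : Lvl} (a : Op k l) (x : Level B k) :
    (desc φ θ hs ht).map ((glueIso B a).hom.app x) = (θ a).hom.app x := Category.id_comp _

theorem desc_map_unglue {k l : Lvl} (a : Op k l) (x : Level B k) :
    (desc φ θ hs ht).map ((glueIso B a).inv.app x) = (θ a).inv.app x := Category.id_comp _

theorem desc_map_tau {X Y : B} (F : X ⟶ Y) (G : Y ⟶ X) :
    (desc φ θ hs ht).map (tau F G).hom =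
      (θ .d10).inv.app ⟨(X, Y), F, G⟩ ≫ (θ .d11).hom.app ⟨(X, Y), F, G⟩ :=
  (CategoryTheory.Functor.map_comp (desc φ θ hs ht) _ _).trans
    (congrArg₂ (· ≫ ·) (desc_map_unglue φ θ hs ht .d10 _) (desc_map_glue φ θ hs ht .d11 _))

end

namespace CyclicCocone

variable {B : Type u} [Bicategory.{w, v} B] {D : Type*} [Category* D] (c : CyclicCocone B D)

theorem functor_map_endo {X : B} {F G : X ⟶ X} (α : F ⟶ G) :
    c.functor.map ((endo X).map α) = (c.Φ X).map α := Category.id_comp _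

theorem functor_map_tau {X Y : B} (F : X ⟶ Y) (G : Y ⟶ X) :
    c.functor.map (tau F G).hom = (c.τ F G).hom :=
  (desc_map_tau _ _ _ _ F G).trans (Category.id_comp _)

end CyclicCocone

end BiHH

/-! ### The target category -/

namespace FreeAdj

/-- The paracyclic category with an initial and a terminal object adjoined. -/
abbrev Target : Type := WithTerminal (WithInitial Paracyclic)

/-- The object which corresponds to the words with `N` generators `g` on an object. -/
def tobj : FreeAdj → ℕ → Target
  | _, n + 1 => .of (.of ⟨n⟩)
  | .zero, 0 => .of .star
  | .one, 0 => .star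

/-- The conditions under which a function gives a morphism `tobj a N ⟶ tobj b M`. If `N = 0` or
`M = 0`, there is at most one such morphism, and the function is ignored. The last two conditions
express that this morphism exists. -/
structure Adm (a b : FreeAdj) (N M : ℕ) (φ : ℤ → ℤ) : Prop where
  mono : N ≠ 0 → M ≠ 0 → Monotone φ
  shift : N ≠ 0 → M ≠ 0 → ∀ l : ℤ, φ (l + N) = φ l + M
  target : M = 0 → N ≠ 0 → b = .one
  source : N = 0 → a = .one → M = 0 ∧ b = .one

/-- The morphism of the paracyclic category given by a function. -/
def Adm.hom {a b : FreeAdj} {n m : ℕ} (φ : ℤ → ℤ) (h : Adm a b (n + 1) (m + 1) φ) :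
    (⟨n⟩ : Paracyclic) ⟶ ⟨m⟩ where
  toFun := φ
  monotone := h.mono n.succ_ne_zero m.succ_ne_zero
  shift l := by
    have := h.shift n.succ_ne_zero m.succ_ne_zero l
    push_cast at this
    rw [← add_assoc, ← add_assoc] at this
    exact this

/-- The morphism of the target category given by a function. -/
def thom : ∀ {a b : FreeAdj} {N M : ℕ} (φ : ℤ → ℤ), Adm a b N M φ → (tobj a N ⟶ tobj b M)
  | _, _, _ + 1, _ + 1, φ, h => WithTerminal.incl.map (WithInitial.incl.map (h.hom φ))
  | _, .one, _, 0, _, _ => WithTerminal.starTerminal.from _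
  | .zero, .zero, 0, 0, _, _ => 𝟙 _
  | .zero, _, 0, m + 1, _, _ => WithTerminal.incl.map (WithInitial.starInitial.to _)
  | _, .zero, n + 1, 0, _, h => by cases h.target rfl n.succ_ne_zero
  | .one, .zero, 0, 0, _, h => by cases (h.source rfl rfl).2
  | .one, _, 0, m + 1, _, h => by cases (h.source rfl rfl).1

theorem thom_congr {a b : FreeAdj} {N M : ℕ} {φ ψ : ℤ → ℤ} (h : Adm a b N M φ) (h' : Adm a b N M ψ)
    (e : N ≠ 0 → M ≠ 0 → φ = ψ) : thom φ h = thom ψ h' := by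
  by_cases hN : N = 0
  · subst hN
    cases a <;> cases b <;> cases M <;> rfl
  · by_cases hM : M = 0
    · subst hM
      obtain rfl := h.target rfl hN
      obtain ⟨n, rfl⟩ := Nat.exists_eq_succ_of_ne_zero hN
      cases a <;> rfl
    · obtain rfl := e hN hM
      rfl

instance (b : FreeAdj) (M : ℕ) : Subsingleton (tobj .zero 0 ⟶ tobj b M) := by
  have h (X : WithInitial Paracyclic) : ∀ f g : (.star : WithInitial Paracyclic) ⟶ X, f = g :=
    fun f g => WithInitial.starInitial.hom_ext f g
  cases M with
  | zero =>
    cases b with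
    | zero => exact ⟨h .star⟩
    | one => exact ⟨fun _ _ => WithTerminal.starTerminal.hom_ext _ _⟩
  | succ m => cases b <;> exact ⟨h (.of ⟨m⟩)⟩

instance (X : Target) : Subsingleton (X ⟶ tobj .one 0) :=
  ⟨fun _ _ => WithTerminal.starTerminal.hom_ext _ _⟩

theorem subsingleton_hom_of_initial {a b : FreeAdj} {N M : ℕ} (ha : a = .zero) (hN : N = 0) :
    Subsingleton (tobj a N ⟶ tobj b M) := by
  subst ha hN; infer_instance

theorem subsingleton_hom_of_terminal {b : FreeAdj} {X : Target} {M : ℕ} (hb : b = .one)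
    (hM : M = 0) : Subsingleton (X ⟶ tobj b M) := by
  subst hb hM; infer_instance

theorem adm_id (a : FreeAdj) (N : ℕ) : Adm a a N N id where
  mono _ _ := monotone_id
  shift _ _ _ := rfl
  target h h' := absurd h h'
  source h h' := ⟨h, h'⟩

theorem thom_id (a : FreeAdj) (N : ℕ) : thom id (adm_id a N) = 𝟙 (tobj a N) := by
  cases N with
  | zero => cases a <;> exact Subsingleton.elim _ _
  | succ n => cases a <;> rfl

theorem Adm.comp {a b c : FreeAdj} {N M K : ℕ} {φ ψ : ℤ → ℤ} (h : Adm a b N M φ)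
    (h' : Adm b c M K ψ) : Adm a c N K (ψ ∘ φ) := by
  by_cases hM : M = 0
  · subst hM
    by_cases hN : N = 0
    · refine ⟨fun h => absurd hN h, fun h => absurd hN h, fun _ h => absurd hN h, fun _ ha => ?_⟩
      exact h'.source rfl (h.source hN ha).2
    · obtain ⟨rfl, rfl⟩ := h'.source rfl (h.target rfl hN)
      exact ⟨fun _ h => absurd rfl h, fun _ h => absurd rfl h, fun _ _ => rfl,
        fun _ _ => ⟨rfl, rfl⟩⟩
  · refine ⟨fun hN hK => (h'.mono hM hK).comp (h.mono hN hM), fun hN hK l => ?_,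
      fun hK _ => h'.target hK hM, fun hN ha => absurd (h.source hN ha).1 hM⟩
    simp only [Function.comp_apply]
    rw [h.shift hN hM, h'.shift hM hK]

theorem thom_comp {a b c : FreeAdj} {N M K : ℕ} {φ ψ : ℤ → ℤ} (h : Adm a b N M φ)
    (h' : Adm b c M K ψ) : thom φ h ≫ thom ψ h' = thom (ψ ∘ φ) (h.comp h') := by
  cases N with
  | zero =>
    cases a with
    | zero => exact Subsingleton.elim _ _
    | one =>
      obtain ⟨rfl, rfl⟩ := h.source rfl rfl
      obtain ⟨rfl, rfl⟩ := h'.source rfl rfl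
      exact Subsingleton.elim _ _
  | succ n =>
    cases M with
    | zero =>
      obtain rfl := h.target rfl n.succ_ne_zero
      obtain ⟨rfl, rfl⟩ := h'.source rfl rfl
      exact Subsingleton.elim _ _
    | succ m =>
      cases K with
      | zero =>
        obtain rfl := h'.target rfl m.succ_ne_zero
        exact Subsingleton.elim _ _
      | succ k => cases a <;> cases b <;> cases c <;> rfl

theorem eq_of_thom_eq {a b : FreeAdj} {N M : ℕ} {φ ψ : ℤ → ℤ} (h : Adm a b N M φ)
    (h' : Adm a b N M ψ) (hN : N ≠ 0) (hM : M ≠ 0) (e : thom φ h = thom ψ h') : φ = ψ := by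
  obtain ⟨n, rfl⟩ := Nat.exists_eq_succ_of_ne_zero hN
  obtain ⟨m, rfl⟩ := Nat.exists_eq_succ_of_ne_zero hM
  have e' : h.hom φ = h'.hom ψ := by cases a <;> cases b <;> exact e
  exact congrArg Paracyclic.Hom.toFun e'

theorem exists_thom_eq {a b : FreeAdj} {N M : ℕ} (hN : N ≠ 0) (hM : M ≠ 0)
    (f : tobj a N ⟶ tobj b M) : ∃ (φ : ℤ → ℤ) (h : Adm a b N M φ), f = thom φ h := by
  obtain ⟨n, rfl⟩ := Nat.exists_eq_succ_of_ne_zero hN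
  obtain ⟨m, rfl⟩ := Nat.exists_eq_succ_of_ne_zero hM
  have key : ∀ g : (⟨n⟩ : Paracyclic) ⟶ ⟨m⟩, Adm a b (n + 1) (m + 1) g.toFun := fun g =>
    ⟨fun _ _ => g.monotone, fun _ _ l => by
      have := g.shift l
      push_cast
      rw [← add_assoc, ← add_assoc]
      exact this, fun h => absurd h hM, fun h => absurd h hN⟩
  cases a <;> cases b <;>
  exact ⟨Paracyclic.Hom.toFun (X := ⟨n⟩) (Y := ⟨m⟩) f, key f, rfl⟩

/-- There is no morphism from a non-initial object to the initial object. -/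
theorem isEmpty_hom_initial {a b : FreeAdj} {N M : ℕ} (h : N ≠ 0 ∨ a = .one) (hb : b = .zero)
    (hM : M = 0) : IsEmpty (tobj a N ⟶ tobj b M) := by
  subst hb hM
  cases N with
  | zero =>
    obtain h | rfl := h
    · exact absurd rfl h
    · exact ⟨fun f => WithTerminal.false_of_from_star f⟩
  | succ n =>
    cases a <;> exact ⟨fun f => WithInitial.false_of_to_star (X := (⟨n⟩ : Paracyclic)) f⟩

/-- There is no morphism from the terminal object to a non-terminal object. -/
theorem isEmpty_hom_terminal {a b : FreeAdj} {N M : ℕ} (ha : a = .one) (hN : N = 0)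
    (h : M ≠ 0 ∨ b = .zero) : IsEmpty (tobj a N ⟶ tobj b M) := by
  subst ha hN
  cases M with
  | zero =>
    obtain h | rfl := h
    · exact absurd rfl h
    · exact ⟨fun f => WithTerminal.false_of_from_star f⟩
  | succ n => cases b <;> exact ⟨fun f => WithTerminal.false_of_from_star f⟩

/-! ### Periodic functions -/

theorem periodic_mul {N M : ℕ} {φ : ℤ → ℤ} (h : ∀ l, φ (l + N) = φ l + M) (l k : ℤ) :
    φ (l + k * N) = φ l + k * M := by
  induction k with
  | zero => simp
  | succ i ih => rw [add_one_mul, ← add_assoc, h, ih]; ring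
  | pred i ih =>
    have := h (l + (-(i : ℤ) - 1) * N)
    rw [show l + (-(i : ℤ) - 1) * N + N = l + -(i : ℤ) * N by ring, ih] at this
    linarith

theorem eq_of_periodic {N M : ℕ} (hN : N ≠ 0) {φ ψ : ℤ → ℤ} (h : ∀ l, φ (l + N) = φ l + M)
    (h' : ∀ l, ψ (l + N) = ψ l + M) (e : ∀ l : ℤ, 0 ≤ l → l < N → φ l = ψ l) : φ = ψ := by
  funext l
  have hl : l = l % N + l / N * N := by rw [mul_comm]; exact (Int.emod_add_mul_ediv l N).symm
  rw [hl, periodic_mul h, periodic_mul h', e _ (Int.emod_nonneg _ (by omega))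
    (Int.emod_lt_of_pos _ (by omega))]

/-- The periodic function which agrees with a given function on the interval from `0` to `N`. -/
def per (N M : ℕ) (φ : ℤ → ℤ) (l : ℤ) : ℤ := φ (l % N) + l / N * M

theorem per_shift {N M : ℕ} (hN : N ≠ 0) (φ : ℤ → ℤ) (l : ℤ) :
    per N M φ (l + N) = per N M φ l + M := by
  have h₁ : (l + N) % N = l % N := by simp
  have h₂ : (l + N) / N = l / N + 1 := Int.add_ediv_of_dvd_right (dvd_refl _) |>.trans (by
    rw [Int.ediv_self (by omega)])
  rw [per, per, h₁, h₂]; ring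

theorem per_of_lt {N M : ℕ} (φ : ℤ → ℤ) {l : ℤ} (h₀ : 0 ≤ l) (h : l < N) : per N M φ l = φ l := by
  rw [per, Int.emod_eq_of_lt h₀ h, Int.ediv_eq_zero_of_lt h₀ h]; ring

theorem per_self {N M : ℕ} (hN : N ≠ 0) (φ : ℤ → ℤ) : per N M φ N = φ 0 + M := by
  have := per_shift (M := M) hN φ 0
  rw [zero_add] at this
  rw [this, per_of_lt φ le_rfl (by omega)]

theorem per_id {N : ℕ} (hN : N ≠ 0) : per N N id = id :=
  eq_of_periodic hN (per_shift hN id) (fun _ => rfl) fun _ h₀ h => per_of_lt id h₀ h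

theorem Good.monotone_per {a b : FreeAdj} {N M : ℕ} {φ : ℤ → ℤ} (h : Good a b N M φ) (hN : N ≠ 0) :
    Monotone (per N M φ) := by
  refine monotone_int_of_le_succ fun l => ?_
  have hl : l = l % N + l / N * N := by rw [mul_comm]; exact (Int.emod_add_mul_ediv l N).symm
  have h₀ := Int.emod_nonneg l (show (N : ℤ) ≠ 0 by omega)
  have h₁ := Int.emod_lt_of_pos l (show (0 : ℤ) < N by omega)
  generalize l % N = r at hl h₀ h₁
  generalize l / N = q at hl
  subst hl
  rw [show r + q * N + 1 = r + 1 + q * N by ring, periodic_mul (per_shift hN φ),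
    periodic_mul (per_shift hN φ), per_of_lt φ h₀ h₁]
  by_cases h₂ : r + 1 < N
  · rw [per_of_lt φ (by omega) h₂]
    have := h.mono (show r ≤ r + 1 by omega)
    omega
  · rw [show r + 1 = N by omega, per_self hN]
    have h₃ := h.nonneg 0 le_rfl
    have h₄ := h.le h₁.le
    omega

theorem Good.adm {a : FreeAdj} {N M : ℕ} {φ : ℤ → ℤ} (h : Good a a N M φ) :
    Adm a a N M (per N M φ) where
  mono hN _ := h.monotone_per hN
  shift hN _ := per_shift hN φ
  target hM hN := by
    cases a with
    | zero =>
      have h₁ := h.lt rfl 0 (by omega)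
      have h₂ := h.nonneg 0 le_rfl
      omega
    | one => rfl
  source hN ha := by
    have h₁ := h.zero ha
    have h₂ := h.ge 0 (by omega)
    exact ⟨by omega, ha⟩

theorem Good.per_apply {a : FreeAdj} {N M : ℕ} {φ : ℤ → ℤ} (h : Good a a N M φ) (hN : N ≠ 0)
    {l : ℤ} (h₀ : 0 ≤ l) (h₁ : l ≤ N) (h₂ : a = .zero → l < N) : per N M φ l = φ l := by
  by_cases hl : l < N
  · exact per_of_lt φ h₀ hl
  · cases a with
    | zero => exact absurd (h₂ rfl) hl
    | one =>
      obtain rfl : l = N := by omega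
      rw [per_self hN, h.ge _ le_rfl, h.zero rfl]; omega

theorem Good.per_comp {a : FreeAdj} {N M K : ℕ} {φ ψ : ℤ → ℤ} (h : Good a a N M φ)
    (h' : Good a a M K ψ) (hN : N ≠ 0) (hM : M ≠ 0) :
    per N K (ψ ∘ φ) = per M K ψ ∘ per N M φ := by
  refine eq_of_periodic (N := N) (M := K) hN (per_shift hN _) (fun l => ?_) fun l h₀ h₁ => ?_
  · simp only [Function.comp_apply]
    rw [per_shift hN, per_shift hM]
  · simp only [Function.comp_apply]
    rw [per_of_lt _ h₀ h₁, per_of_lt φ h₀ h₁, h'.per_apply hM (h.nonneg l h₀) (h.le h₁.le)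
      fun ha => h.lt ha l h₁]
    rfl

/-- The functor from the words on an object to the target category. -/
def wordFunctor (a : FreeAdj) : Word a a ⥤ Target where
  obj p := tobj a (wt p)
  map α := thom _ (good α).adm
  map_id p := (thom_congr _ _ fun hN _ => (congrArg (per _ _) (fn_id p)).trans (per_id hN)).trans
    (thom_id a (wt p))
  map_comp {p q r} α β := by
    rw [thom_comp]
    refine thom_congr _ _ fun hN hK => ?_
    rw [fn_comp]
    by_cases hM : wt q = 0
    · cases a with
      | zero => cases (good α).adm.target hM hN
      | one => exact absurd ((good β).adm.source hM rfl).1 hK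
    · exact (good α).per_comp (good β) hN hM

theorem adm_rotate {a b : FreeAdj} (p : Word a b) (q : Word b a) :
    Adm a b (wt (p.comp q)) (wt (q.comp p)) (fun l => l + wt q) where
  mono _ _ l l' h := by simpa using h
  shift _ _ l := by simp only [wt_comp]; push_cast; ring
  target h h' := by rw [wt_comp] at h h'; omega
  source h ha := by
    subst ha
    rw [wt_comp] at h
    obtain rfl | ⟨h', -⟩ := eq_of_wt_eq_zero p (by omega)
    · rw [wt_comp]; exact ⟨by omega, rfl⟩
    · cases h'

theorem adm_rotate_symm {a b : FreeAdj} (p : Word a b) (q : Word b a) :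
    Adm b a (wt (q.comp p)) (wt (p.comp q)) (fun l => l - wt q) where
  mono _ _ l l' h := by simpa using h
  shift _ _ l := by simp only [wt_comp]; push_cast; ring
  target h h' := by rw [wt_comp] at h h'; omega
  source h ha := by
    subst ha
    rw [wt_comp] at h
    obtain rfl | ⟨h', -⟩ := eq_of_wt_eq_zero q (by omega)
    · rw [wt_comp]; exact ⟨by omega, rfl⟩
    · cases h'

/-- The rotation of words, as a translation of the integers. -/
def rotateIso {a b : FreeAdj} (p : Word a b) (q : Word b a) :
    tobj a (wt (p.comp q)) ≅ tobj b (wt (q.comp p)) where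
  hom := thom _ (adm_rotate p q)
  inv := thom _ (adm_rotate_symm p q)
  hom_inv_id := by
    rw [thom_comp, ← thom_id]
    exact thom_congr _ _ fun _ _ => funext fun l => by simp
  inv_hom_id := by
    rw [thom_comp, ← thom_id]
    exact thom_congr _ _ fun _ _ => funext fun l => by simp

theorem rotateIso_naturality {a b : FreeAdj} {p p' : Word a b} {q q' : Word b a} (α : p ⟶ p')
    (β : q ⟶ q') :
    (wordFunctor a).map (whiskerR α q ≫ whiskerL p' β) ≫ (rotateIso p' q').hom =
      (rotateIso p q).hom ≫ (wordFunctor b).map (whiskerR β p ≫ whiskerL q' α) := by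
  refine (thom_comp _ _).trans (Eq.trans ?_ (thom_comp _ _).symm)
  refine thom_congr _ _ fun hN hM => ?_
  have hN' : wt (q.comp p) ≠ 0 := by rw [wt_comp] at hN ⊢; omega
  refine eq_of_periodic (N := wt (p.comp q)) (M := wt (q'.comp p')) hN ?_ ?_ fun l h₀ h₁ => ?_
  · intro l
    simp only [Function.comp_apply]
    rw [per_shift hN]
    simp only [wt_comp]; push_cast; ring
  · intro l
    simp only [Function.comp_apply]
    rw [show l + (wt (p.comp q) : ℤ) + wt q = l + wt q + wt (q.comp p) by
      simp only [wt_comp]; push_cast; ring, per_shift hN']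
  · simp only [Function.comp_apply]
    rw [per_of_lt _ h₀ h₁]
    simp only [fn_comp, fn_whiskerL, fn_whiskerR, Function.comp_apply]
    have hα := good α
    have hβ := good β
    by_cases hl : l < wt p
    · rw [per_of_lt _ (by omega) (by simp only [wt_comp]; push_cast; omega)]
      have h₂ : fn β (fn α l - wt p') = fn α l - wt p' := by
        have h₃ := hα.le (l := l) (by omega)
        by_cases h₄ : fn α l < wt p'
        · exact hβ.neg _ (by omega)
        · cases b with
          | zero => exact absurd (hα.lt rfl l hl) h₄
          | one => rw [show fn α l - wt p' = 0 by omega]; exact hβ.zero rfl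
      simp only [Function.comp_apply]
      rw [h₂, hβ.ge (l + wt q) (by omega)]
      ring_nf
    · rw [wt_comp] at h₁
      push_cast at h₁
      have h₂ : l + wt q = l - wt p + wt (q.comp p) := by simp only [wt_comp]; push_cast; ring
      rw [h₂, per_shift hN', per_of_lt _ (by omega) (by simp only [wt_comp]; push_cast; omega)]
      have h₃ : fn α (fn β (l - wt p) - wt q') = fn β (l - wt p) - wt q' := by
        have h₃ := hβ.le (l := l - wt p) (by omega)
        by_cases h₄ : fn β (l - wt p) < wt q'
        · exact hα.neg _ (by omega)
        · cases a with
          | zero => exact absurd (hβ.lt rfl (l - wt p) (by omega)) h₄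
          | one => rw [show fn β (l - wt p) - wt q' = 0 by omega]; exact hα.zero rfl
      simp only [Function.comp_apply]
      rw [h₃, hα.ge l (by omega), wt_comp]
      push_cast
      ring_nf

theorem wordFunctor_map_eqToHom {a : FreeAdj} {p q : Word a a} (h : p = q) :
    (wordFunctor a).map (eqToHom h) = thom id (by subst h; exact adm_id _ _) := by
  subst h
  exact ((wordFunctor a).map_id p).trans (thom_id _ _).symm

/-- The rotations of words give a functor on the Hochschild homology of the free adjunction. -/
def cocone : BiHH.CyclicCocone FreeAdj Target where
  Φ := wordFunctor
  τ p q := rotateIso p q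
  naturality α β := rotateIso_naturality α β
  hexagon {a b c} p q r := by
    have h₁ := wordFunctor_map_eqToHom (Quiver.Path.comp_assoc p q r)
    have h₂ := wordFunctor_map_eqToHom (Quiver.Path.comp_assoc q r p)
    have h₃ := wordFunctor_map_eqToHom (Quiver.Path.comp_assoc r p q).symm
    refine (congrArg₂ (fun x y => x ≫ (rotateIso p (q.comp r)).hom ≫ y) h₁ h₂).trans ?_
    refine Eq.trans ?_ (congrArg (fun x => (rotateIso (p.comp q) r).hom ≫ x ≫
      (rotateIso (r.comp p) q).hom) h₃).symm
    refine (congrArg (_ ≫ ·) (thom_comp _ _)).trans ((thom_comp _ _).trans ?_)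
    refine Eq.trans ?_ ((congrArg (_ ≫ ·) (thom_comp _ _)).trans (thom_comp _ _)).symm
    refine thom_congr _ _ fun _ _ => funext fun l => ?_
    simp only [Function.comp_apply, id, wt_comp]
    push_cast; ring
  unit {a} p := by
    have h := wordFunctor_map_eqToHom (show p.comp .nil = Quiver.Path.nil.comp p from
      (Quiver.Path.nil_comp p).symm)
    refine Eq.trans ?_ (h.symm.trans (congrArg (wordFunctor a).map ?_))
    · exact thom_congr _ _ fun _ _ => funext fun l => add_zero l
    · exact (eqToHom_trans (Quiver.Path.comp_nil p) (Quiver.Path.nil_comp p).symm).symm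

/-- The functor from the Hochschild homology of the free adjunction to the target category. -/
def toTarget : biHH FreeAdj ⥤ Target := cocone.functor

end FreeAdj

namespace FreeAdj

open Quiver.Path (nil)

/-! ### Rotations of words -/

/-- The horizontal composite of two `2`-cells, with source and target given up to equality. -/
def hc {a b c : FreeAdj} {p p' : Word a b} {q q' : Word b c} (α : p ⟶ p') (β : q ⟶ q')
    {x x' : Word a c} (hx : x = p.comp q) (hx' : x' = p'.comp q') : x ⟶ x' :=
  eqToHom hx ≫ (whiskerR α q ≫ whiskerL p' β) ≫ eqToHom hx'.symm

theorem hc_rfl {a b c : FreeAdj} {p p' : Word a b} {q q' : Word b c} (α : p ⟶ p') (β : q ⟶ q') :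
    hc α β rfl rfl = whiskerR α q ≫ whiskerL p' β := by
  simp [hc]

theorem hc_nil_left {a b : FreeAdj} {q q' : Word a b} (β : q ⟶ q') :
    hc (𝟙 nil) β (Quiver.Path.nil_comp q).symm (Quiver.Path.nil_comp q').symm = β := by
  simp [hc, whiskerR_id, whiskerL_nil]

theorem hc_nil_right {a b : FreeAdj} {q q' : Word a b} (β : q ⟶ q') :
    hc β (𝟙 nil) rfl rfl = β := by
  rw [hc_rfl, whiskerL_id, whiskerR_nil]
  exact Category.comp_id β

theorem exists_hc_of_target {a b c : FreeAdj} (hb : b = .zero) {x : Word a c} {p : Word a b}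
    {q : Word b c} {y : Word a c} (hy : y = p.comp q) (α : x ⟶ y) :
    ∃ (p' : Word a b) (q' : Word b c) (h : x = p'.comp q') (α₁ : p' ⟶ p) (α₂ : q' ⟶ q),
      α = hc α₁ α₂ h hy := by
  subst hb hy
  obtain ⟨p', q', rfl, α₁, α₂, h⟩ := exists_split_target α
  exact ⟨p', q', rfl, α₁, α₂, by rw [h, hc_rfl, eqToHom_refl, Category.id_comp]⟩

theorem exists_hc_of_source {a b c : FreeAdj} (hb : b = .one) {y : Word a c} {p : Word a b}
    {q : Word b c} {x : Word a c} (hx : x = p.comp q) (α : x ⟶ y) :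
    ∃ (p' : Word a b) (q' : Word b c) (h : y = p'.comp q') (α₁ : p ⟶ p') (α₂ : q ⟶ q'),
      α = hc α₁ α₂ hx h := by
  subst hb hx
  obtain ⟨p', q', rfl, α₁, α₂, h⟩ := exists_split_source α
  exact ⟨p', q', rfl, α₁, α₂, by rw [h, hc_rfl, eqToHom_refl, Category.comp_id]⟩

/-- A system of rotations on the words of the free adjunction, for a family `o` of objects: functors
`Φ j` on the words on `o j`, and isomorphisms from `p q` to `q p` which satisfy a hexagon identity
and a unit identity. The source and the target of a rotation are given up to equality, so that no
associators are needed. -/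
structure Rotations {J : Type*} (o : J → FreeAdj) (D : Type*) [Category* D] where
  /-- the functors on the words -/
  Φ (j : J) : Word (o j) (o j) ⥤ D
  /-- the rotations -/
  τ {i j : J} (p : Word (o i) (o j)) (q : Word (o j) (o i)) {x : Word (o i) (o i)}
    {y : Word (o j) (o j)} (hx : x = p.comp q) (hy : y = q.comp p) : (Φ i).obj x ≅ (Φ j).obj y
  naturality {i j : J} {p p' : Word (o i) (o j)} {q q' : Word (o j) (o i)} (α : p ⟶ p')
    (β : q ⟶ q') {x x' : Word (o i) (o i)} {y y' : Word (o j) (o j)} (hx : x = p.comp q)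
    (hy : y = q.comp p) (hx' : x' = p'.comp q') (hy' : y' = q'.comp p') :
    (Φ i).map (hc α β hx hx') ≫ (τ p' q' hx' hy').hom =
      (τ p q hx hy).hom ≫ (Φ j).map (hc β α hy hy')
  hexagon {i j k : J} (p : Word (o i) (o j)) (q : Word (o j) (o k)) (r : Word (o k) (o i))
    {s : Word (o j) (o i)} {t : Word (o i) (o k)} {u : Word (o k) (o j)} (hs : s = q.comp r)
    (ht : t = p.comp q) (hu : u = r.comp p) {x : Word (o i) (o i)} {y : Word (o j) (o j)}
    {z : Word (o k) (o k)} (h₁ : x = p.comp s) (h₂ : y = s.comp p) (h₃ : x = t.comp r)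
    (h₄ : z = r.comp t) (h₅ : z = u.comp q) (h₆ : y = q.comp u) :
    (τ p s h₁ h₂).hom = (τ t r h₃ h₄).hom ≫ (τ u q h₅ h₆).hom
  unit {j : J} (p : Word (o j) (o j)) {x : Word (o j) (o j)} (hx : x = p.comp nil)
    (hx' : x = nil.comp p) : (τ p nil hx hx').hom = 𝟙 ((Φ j).obj x)

namespace Rotations

variable {J : Type*} {o : J → FreeAdj} {D : Type*} [Category* D] (R : Rotations o D)

/-- The full rotation of a word, an automorphism which commutes with all morphisms generated by
`2`-cells and rotations. -/
def full (j : J) (x : Word (o j) (o j)) : (R.Φ j).obj x ≅ (R.Φ j).obj x :=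
  R.τ nil x (Quiver.Path.nil_comp x).symm rfl

theorem full_naturality (j : J) {x y : Word (o j) (o j)} (α : x ⟶ y) :
    (R.Φ j).map α ≫ (R.full j y).hom = (R.full j x).hom ≫ (R.Φ j).map α := by
  have h := R.naturality (𝟙 (nil : Word (o j) (o j))) α (Quiver.Path.nil_comp x).symm rfl
    (Quiver.Path.nil_comp y).symm rfl
  rwa [hc_nil_left, hc_nil_right] at h

variable {R}

theorem τ_comp_τ {i j : J} (p : Word (o i) (o j)) (q : Word (o j) (o i)) {x : Word (o i) (o i)}
    {y : Word (o j) (o j)} (hx : x = p.comp q) (hy : y = q.comp p) :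
    (R.τ p q hx hy).hom ≫ (R.τ q p hy hx).hom = (R.full i x).hom :=
  (R.hexagon nil p q hx (Quiver.Path.nil_comp p).symm rfl _ _ _ _ _ _).symm

theorem full_comp_τ {i j : J} (p : Word (o i) (o j)) (q : Word (o j) (o i)) {x : Word (o i) (o i)}
    {y : Word (o j) (o j)} (hx : x = p.comp q) (hy : y = q.comp p) :
    (R.full i x).hom ≫ (R.τ p q hx hy).hom = (R.τ p q hx hy).hom ≫ (R.full j y).hom := by
  rw [← τ_comp_τ p q hx hy, ← τ_comp_τ q p hy hx, Category.assoc]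

theorem τ_inv {i j : J} (p : Word (o i) (o j)) (q : Word (o j) (o i)) {x : Word (o i) (o i)}
    {y : Word (o j) (o j)} (hx : x = p.comp q) (hy : y = q.comp p) :
    (R.τ p q hx hy).inv = (R.τ q p hy hx).hom ≫ (R.full i x).inv := by
  rw [Iso.eq_comp_inv, Iso.inv_comp_eq, τ_comp_τ]

variable (R)

/-- The morphisms are generated by the `2`-cells and by the rotations: the corresponding induction
principle. -/
def Generates : Prop :=
  ∀ C : ∀ {i j : J} {x : Word (o i) (o i)} {y : Word (o j) (o j)},
      ((R.Φ i).obj x ⟶ (R.Φ j).obj y) → Prop,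
    (∀ {i : J} {x y : Word (o i) (o i)} (α : x ⟶ y), C ((R.Φ i).map α)) →
    (∀ {i j : J} (p : Word (o i) (o j)) (q : Word (o j) (o i)) {x : Word (o i) (o i)}
      {y : Word (o j) (o j)} (hx : x = p.comp q) (hy : y = q.comp p), C (R.τ p q hx hy).hom) →
    (∀ {i j : J} (p : Word (o i) (o j)) (q : Word (o j) (o i)) {x : Word (o i) (o i)}
      {y : Word (o j) (o j)} (hx : x = p.comp q) (hy : y = q.comp p), C (R.τ p q hx hy).inv) →
    (∀ {i j k : J} {x : Word (o i) (o i)} {y : Word (o j) (o j)} {z : Word (o k) (o k)}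
      (f : (R.Φ i).obj x ⟶ (R.Φ j).obj y) (g : (R.Φ j).obj y ⟶ (R.Φ k).obj z),
      C f → C g → C (f ≫ g)) →
    ∀ {i j : J} {x : Word (o i) (o i)} {y : Word (o j) (o j)}
      (f : (R.Φ i).obj x ⟶ (R.Φ j).obj y), C f

variable {R}

theorem Generates.full_comp (hR : R.Generates) {i j : J} {x : Word (o i) (o i)}
    {y : Word (o j) (o j)} (f : (R.Φ i).obj x ⟶ (R.Φ j).obj y) :
    (R.full i x).hom ≫ f = f ≫ (R.full j y).hom := by
  refine hR (fun {i j x y} f => (R.full i x).hom ≫ f = f ≫ (R.full j y).hom)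
    (fun α => (R.full_naturality _ α).symm) full_comp_τ (fun p q x y hx hy => ?_)
    (fun f g hf hg => ?_) f
  · rw [Iso.eq_inv_comp, ← Category.assoc, Iso.comp_inv_eq, full_comp_τ]
  · rw [reassoc_of% hf, hg, Category.assoc]

theorem Generates.comp_τ_inv (hR : R.Generates) {i j k : J} (p : Word (o i) (o j))
    (q : Word (o j) (o i)) {x : Word (o i) (o i)} {y : Word (o j) (o j)} (hx : x = p.comp q)
    (hy : y = q.comp p) {w : Word (o k) (o k)} (f : (R.Φ k).obj w ⟶ (R.Φ j).obj y) :
    f ≫ (R.τ p q hx hy).inv = (R.full k w).inv ≫ f ≫ (R.τ q p hy hx).hom := by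
  rw [Iso.eq_inv_comp, ← Category.assoc, hR.full_comp, ← τ_comp_τ q p hy hx]
  simp

theorem Generates.τ_inv_comp (hR : R.Generates) {i j k : J} (p : Word (o i) (o j))
    (q : Word (o j) (o i)) {x : Word (o i) (o i)} {y : Word (o j) (o j)} (hx : x = p.comp q)
    (hy : y = q.comp p) {w : Word (o k) (o k)} (f : (R.Φ i).obj x ⟶ (R.Φ k).obj w) :
    (R.τ p q hx hy).inv ≫ f = ((R.τ q p hy hx).hom ≫ f) ≫ (R.full k w).inv := by
  rw [Iso.eq_comp_inv, τ_inv, Category.assoc, Category.assoc, ← hR.full_comp,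
    Iso.inv_hom_id_assoc]

/-! ### Rotations on one object -/

/-- The word on an object with a given number of generators `g`. -/
def _root_.FreeAdj.pow : ∀ (a : FreeAdj) (_ : ℕ), Word a a
  | _, 0 => nil
  | .zero, n + 1 => ((pow .zero n).cons Arrow.f : Word _ .one).cons Arrow.g
  | .one, n + 1 => ((pow .one n).cons Arrow.g : Word _ .zero).cons Arrow.f

@[simp]
theorem _root_.FreeAdj.wt_pow (a : FreeAdj) (n : ℕ) : wt (pow a n) = n := by
  induction n with
  | zero => rfl
  | succ n ih => cases a <;> simp [pow, ih]

variable (R)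

/-- The rotation of a word on an object by one step. (If the word is empty, this is the rotation by
zero steps.) -/
def step (j : J) (x : Word (o j) (o j)) : Aut ((R.Φ j).obj x) :=
  R.τ (pow _ (wt x - 1)) (pow _ (wt x - (wt x - 1)))
    (eq_of_wt_eq _ _ (by simp only [wt_comp, wt_pow]; omega))
    (eq_of_wt_eq _ _ (by simp only [wt_comp, wt_pow]; omega))

variable {R}

/-- All rotations of words on one object are powers of the rotation by one step. -/
theorem τ_eq_step_zpow {j : J} (p q : Word (o j) (o j)) {x : Word (o j) (o j)} (hx : x = p.comp q)
    (hy : x = q.comp p) : (R.τ p q hx hy).hom = (R.step j x ^ (wt q : ℤ)).hom := by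
  rw [zpow_natCast]
  induction h : wt q generalizing p q with
  | zero =>
    obtain rfl := eq_nil_of_wt_eq_zero q h
    rw [R.unit]; rfl
  | succ n ih =>
    -- by the hexagon identity, split off one of the last `n + 1` letters `g`
    have hxw : wt x = wt p + (n + 1) := by rw [hx, wt_comp, h]
    have h₁ : q = (pow _ n).comp (pow _ 1) := eq_of_wt_eq _ _ (by simp [h])
    have h₂ : x = ((pow _ 1).comp p).comp (pow _ n) :=
      eq_of_wt_eq _ _ (by simp only [wt_comp, wt_pow]; omega)
    have h₃ : x = (pow _ n).comp ((pow _ 1).comp p) :=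
      eq_of_wt_eq _ _ (by simp only [wt_comp, wt_pow]; omega)
    have h₄ : p.comp (pow _ n) = pow (o j) (wt x - 1) :=
      eq_of_wt_eq _ _ (by simp only [wt_comp, wt_pow]; omega)
    have h₅ : pow (o j) 1 = pow (o j) (wt x - (wt x - 1)) :=
      eq_of_wt_eq _ _ (by simp only [wt_pow]; omega)
    have h₆ : x = (pow (o j) (wt x - 1)).comp (pow (o j) 1) :=
      eq_of_wt_eq _ _ (by simp only [wt_comp, wt_pow]; omega)
    have h₇ : x = (pow (o j) 1).comp (pow (o j) (wt x - 1)) :=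
      eq_of_wt_eq _ _ (by simp only [wt_comp, wt_pow]; omega)
    have key (s : Word (o j) (o j)) (hs : pow (o j) 1 = s) (h₆) (h₇) :
      (R.τ (pow (o j) (wt x - 1)) (pow (o j) 1) (x := x) (y := x) h₆ h₇) =
        R.τ (pow (o j) (wt x - 1)) s (hs ▸ h₆) (hs ▸ h₇) := by subst hs; rfl
    rw [R.hexagon p (pow _ n) (pow _ 1) h₁ h₄.symm rfl hx hy h₆ h₇ h₂ h₃,
      ih _ _ h₂ h₃ (wt_pow _ _), key _ h₅, pow_succ]
    rfl

theorem full_eq_step_zpow (j : J) (x : Word (o j) (o j)) :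
    (R.full j x).hom = (R.step j x ^ (wt x : ℤ)).hom :=
  τ_eq_step_zpow _ _ _ _

theorem full_inv_eq_step_zpow (j : J) (x : Word (o j) (o j)) :
    (R.full j x).inv = (R.step j x ^ (-(wt x : ℤ))).hom := by
  have h : R.full j x = R.step j x ^ (wt x : ℤ) := Iso.ext (full_eq_step_zpow j x)
  rw [zpow_neg, ← h]; rfl

theorem step_zpow_comp (j : J) (x : Word (o j) (o j)) (k l : ℤ) :
    (R.step j x ^ k).hom ≫ (R.step j x ^ l).hom = (R.step j x ^ (k + l)).hom := by
  rw [add_comm, zpow_add]; rfl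

theorem step_of_wt_eq_zero {j : J} {x : Word (o j) (o j)} (h : wt x = 0) (k : ℤ) :
    (R.step j x ^ k).hom = 𝟙 _ := by
  have h₁ : R.step j x = 1 := by
    refine Iso.ext ?_
    obtain rfl := eq_nil_of_wt_eq_zero x h
    exact R.unit nil rfl rfl
  rw [h₁, one_zpow]; rfl

variable (R)

/-- The morphisms of the form `step ^ k ≫ α`. -/
def StepCell {j : J} {x y : Word (o j) (o j)} (f : (R.Φ j).obj x ⟶ (R.Φ j).obj y) : Prop :=
  ∃ (k : ℤ) (α : x ⟶ y), f = (R.step j x ^ k).hom ≫ (R.Φ j).map α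

/-- The morphisms of the form `α ≫ step ^ k`. -/
def CellStep {j : J} {x y : Word (o j) (o j)} (f : (R.Φ j).obj x ⟶ (R.Φ j).obj y) : Prop :=
  ∃ (k : ℤ) (α : x ⟶ y), f = (R.Φ j).map α ≫ (R.step j y ^ k).hom

variable {R}

theorem stepCell_map {j : J} {x y : Word (o j) (o j)} (α : x ⟶ y) : R.StepCell ((R.Φ j).map α) :=
  ⟨0, α, (Category.id_comp _).symm⟩

theorem cellStep_map {j : J} {x y : Word (o j) (o j)} (α : x ⟶ y) : R.CellStep ((R.Φ j).map α) :=
  ⟨0, α, (Category.comp_id _).symm⟩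

theorem StepCell.step_comp {j : J} {x y : Word (o j) (o j)} {f : (R.Φ j).obj x ⟶ (R.Φ j).obj y}
    (hf : R.StepCell f) (k : ℤ) : R.StepCell ((R.step j x ^ k).hom ≫ f) := by
  obtain ⟨l, α, rfl⟩ := hf
  exact ⟨k + l, α, by rw [← Category.assoc, step_zpow_comp]⟩

theorem CellStep.comp_step {j : J} {x y : Word (o j) (o j)} {f : (R.Φ j).obj x ⟶ (R.Φ j).obj y}
    (hf : R.CellStep f) (k : ℤ) : R.CellStep (f ≫ (R.step j y ^ k).hom) := by
  obtain ⟨l, α, rfl⟩ := hf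
  exact ⟨l + k, α, by rw [Category.assoc, step_zpow_comp]⟩

theorem StepCell.comp_map {j : J} {x y z : Word (o j) (o j)} {f : (R.Φ j).obj x ⟶ (R.Φ j).obj y}
    (hf : R.StepCell f) (α : y ⟶ z) : R.StepCell (f ≫ (R.Φ j).map α) := by
  obtain ⟨k, β, rfl⟩ := hf
  exact ⟨k, β ≫ α, by rw [Category.assoc, Functor.map_comp]⟩

theorem CellStep.map_comp {j : J} {x y z : Word (o j) (o j)} {f : (R.Φ j).obj y ⟶ (R.Φ j).obj z}
    (hf : R.CellStep f) (α : x ⟶ y) : R.CellStep ((R.Φ j).map α ≫ f) := by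
  obtain ⟨k, β, rfl⟩ := hf
  exact ⟨k, α ≫ β, by rw [Functor.map_comp, Category.assoc]⟩

/-- A rotation after a `2`-cell can be moved to the front, since `2`-cells split at an occurrence of
the object `0` in the target. -/
theorem StepCell.comp_τ {j : J} (hj : o j = .zero) {x y : Word (o j) (o j)}
    {f : (R.Φ j).obj x ⟶ (R.Φ j).obj y} (hf : R.StepCell f) (p q : Word (o j) (o j))
    {z : Word (o j) (o j)} (hy : y = p.comp q) (hz : z = q.comp p) :
    R.StepCell (f ≫ (R.τ p q hy hz).hom) := by
  obtain ⟨k, α, rfl⟩ := hf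
  obtain ⟨p', q', h, α₁, α₂, rfl⟩ := exists_hc_of_target hj hy α
  have h' : x = q'.comp p' := eq_of_wt_eq _ _ (by rw [h, wt_comp, wt_comp, add_comm])
  rw [Category.assoc, R.naturality α₁ α₂ h h' hy hz, τ_eq_step_zpow]
  exact ((stepCell_map _).step_comp _).step_comp _

/-- A rotation before a `2`-cell can be moved to the end, since `2`-cells split at an occurrence of
the object `1` in the source. -/
theorem CellStep.τ_comp {j : J} (hj : o j = .one) {y z : Word (o j) (o j)}
    {f : (R.Φ j).obj y ⟶ (R.Φ j).obj z} (hf : R.CellStep f) (p q : Word (o j) (o j))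
    {x : Word (o j) (o j)} (hx : x = p.comp q) (hy : y = q.comp p) :
    R.CellStep ((R.τ p q hx hy).hom ≫ f) := by
  obtain ⟨k, α, rfl⟩ := hf
  obtain ⟨q', p', h, α₁, α₂, rfl⟩ := exists_hc_of_source hj hy α
  have h' : z = p'.comp q' := eq_of_wt_eq _ _ (by rw [h, wt_comp, wt_comp, add_comm])
  rw [← Category.assoc, ← R.naturality α₂ α₁ hx hy h' h, τ_eq_step_zpow]
  exact ((cellStep_map _).comp_step _).comp_step _

end Rotations

end FreeAdj

namespace FreeAdj

open Quiver.Path (nil)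

/-! ### Rotations and the paracyclic category -/

theorem adm_rotate_of_eq {a b : FreeAdj} (p : Word a b) (q : Word b a) {x : Word a a} {y : Word b b}
    (hx : x = p.comp q) (hy : y = q.comp p) : Adm a b (wt x) (wt y) (fun l => l + wt q) := by
  subst hx hy; exact adm_rotate p q

theorem adm_add (a : FreeAdj) (N : ℕ) (k : ℤ) : Adm a a N N (fun l => l + k) where
  mono _ _ _ _ h := by simpa using h
  shift _ _ _ := by ring
  target h h' := absurd h h'
  source h h' := ⟨h, h'⟩

namespace Rotations

variable {J : Type*} {o : J → FreeAdj} {D : Type*} [Category* D]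

/-- A functor to the target category which sends the `2`-cells and the rotations to the morphisms
given by their functions. -/
structure Realization (R : Rotations o D) (K : D ⥤ Target) where
  /-- the isomorphisms which identify the images of the words -/
  κ (j : J) (x : Word (o j) (o j)) : K.obj ((R.Φ j).obj x) ≅ tobj (o j) (wt x)
  map_cell {j : J} {x y : Word (o j) (o j)} (α : x ⟶ y) :
    K.map ((R.Φ j).map α) ≫ (κ j y).hom = (κ j x).hom ≫ thom _ (good α).adm
  map_τ {i j : J} (p : Word (o i) (o j)) (q : Word (o j) (o i)) {x : Word (o i) (o i)}
    {y : Word (o j) (o j)} (hx : x = p.comp q) (hy : y = q.comp p) :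
    K.map (R.τ p q hx hy).hom ≫ (κ j y).hom =
      (κ i x).hom ≫ thom _ (adm_rotate_of_eq p q hx hy)

namespace Realization

variable {R : Rotations o D} {K : D ⥤ Target} (V : R.Realization K)

/-- The functor `K` sends the morphism `f` to the morphism given by the function `φ`. -/
def Rep {i j : J} {x : Word (o i) (o i)} {y : Word (o j) (o j)}
    (f : (R.Φ i).obj x ⟶ (R.Φ j).obj y) (φ : ℤ → ℤ) : Prop :=
  ∃ h : Adm (o i) (o j) (wt x) (wt y) φ, K.map f ≫ (V.κ j y).hom = (V.κ i x).hom ≫ thom φ h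

variable {V}

theorem Rep.comp {i j k : J} {x : Word (o i) (o i)} {y : Word (o j) (o j)} {z : Word (o k) (o k)}
    {f : (R.Φ i).obj x ⟶ (R.Φ j).obj y} {g : (R.Φ j).obj y ⟶ (R.Φ k).obj z} {φ ψ : ℤ → ℤ}
    (hf : V.Rep f φ) (hg : V.Rep g ψ) : V.Rep (f ≫ g) (ψ ∘ φ) := by
  obtain ⟨h, e⟩ := hf
  obtain ⟨h', e'⟩ := hg
  exact ⟨h.comp h', by rw [K.map_comp, Category.assoc, e', reassoc_of% e, thom_comp]⟩

theorem rep_id (j : J) (x : Word (o j) (o j)) : V.Rep (𝟙 ((R.Φ j).obj x)) id :=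
  ⟨adm_id _ _, by rw [K.map_id, thom_id, Category.id_comp, Category.comp_id]⟩

theorem Rep.congr {i j : J} {x : Word (o i) (o i)} {y : Word (o j) (o j)}
    {f : (R.Φ i).obj x ⟶ (R.Φ j).obj y} {φ ψ : ℤ → ℤ} (hf : V.Rep f φ)
    (h : Adm (o i) (o j) (wt x) (wt y) ψ) (e : wt x ≠ 0 → wt y ≠ 0 → φ = ψ) : V.Rep f ψ := by
  obtain ⟨h', e'⟩ := hf
  exact ⟨h, by rw [e', thom_congr h' h e]⟩

theorem rep_step (j : J) (x : Word (o j) (o j)) : V.Rep (R.step j x).hom (fun l => l + 1) := by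
  have h : V.Rep (R.step j x).hom _ := ⟨_, V.map_τ _ _ _ _⟩
  refine h.congr (adm_add _ _ 1) fun hx _ => funext fun l => ?_
  simp only [wt_pow]
  omega

theorem Rep.inv {j : J} {x : Word (o j) (o j)} {e : (R.Φ j).obj x ≅ (R.Φ j).obj x} {φ ψ : ℤ → ℤ}
    (he : V.Rep e.hom φ) (hψ : Adm (o j) (o j) (wt x) (wt x) ψ) (h : ψ ∘ φ = id) :
    V.Rep e.inv ψ := by
  obtain ⟨h₁, h₂⟩ := he
  refine ⟨hψ, ?_⟩
  rw [← cancel_epi (K.map e.hom), ← Category.assoc, ← K.map_comp, reassoc_of% h₂, thom_comp,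
    Iso.hom_inv_id, K.map_id, Category.id_comp, thom_congr _ (adm_id _ _) (fun _ _ => h), thom_id,
    Category.comp_id]

theorem rep_step_inv (j : J) (x : Word (o j) (o j)) :
    V.Rep (R.step j x).inv (fun l => l + (-1)) :=
  (V.rep_step j x).inv (adm_add _ _ _) (funext fun l => add_neg_cancel_right l 1)

theorem rep_step_zpow (j : J) (x : Word (o j) (o j)) (k : ℤ) :
    V.Rep (R.step j x ^ k).hom (fun l => l + k) := by
  induction k with
  | zero =>
    exact (V.rep_id j x).congr (adm_add _ _ 0) fun _ _ => funext fun l => (add_zero l).symm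
  | succ k ih =>
    rw [← step_zpow_comp, zpow_one]
    exact (ih.comp (V.rep_step j x)).congr (adm_add _ _ _) fun _ _ => funext fun l =>
      add_assoc l k 1
  | pred k ih =>
    rw [sub_eq_add_neg, ← step_zpow_comp, zpow_neg_one]
    exact (ih.comp (V.rep_step_inv j x)).congr (adm_add _ _ _) fun _ _ => funext fun l =>
      add_assoc l _ _

theorem rep_map {j : J} {x y : Word (o j) (o j)} (α : x ⟶ y) :
    V.Rep ((R.Φ j).map α) (per (wt x) (wt y) (fn α)) :=
  ⟨_, V.map_cell α⟩

theorem Rep.eq {i j : J} {x : Word (o i) (o i)} {y : Word (o j) (o j)}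
    {f g : (R.Φ i).obj x ⟶ (R.Φ j).obj y} {φ ψ : ℤ → ℤ} (hf : V.Rep f φ) (hg : V.Rep g ψ)
    (h : K.map f = K.map g) (hx : wt x ≠ 0) (hy : wt y ≠ 0) : φ = ψ := by
  obtain ⟨h₁, e₁⟩ := hf
  obtain ⟨h₂, e₂⟩ := hg
  refine eq_of_thom_eq h₁ h₂ hx hy ?_
  rw [← cancel_epi (V.κ i x).hom, ← e₁, ← e₂, h]

theorem Rep.map_eq {i j : J} {x : Word (o i) (o i)} {y : Word (o j) (o j)}
    {f : (R.Φ i).obj x ⟶ (R.Φ j).obj y} {φ ψ : ℤ → ℤ} (hf : V.Rep f φ)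
    {g : K.obj ((R.Φ i).obj x) ⟶ K.obj ((R.Φ j).obj y)}
    {h : Adm (o i) (o j) (wt x) (wt y) ψ}
    (e : (V.κ i x).inv ≫ g ≫ (V.κ j y).hom = thom ψ h) (hφ : φ = ψ) : K.map f = g := by
  subst hφ
  obtain ⟨h', e'⟩ := hf
  rw [← cancel_mono (V.κ j y).hom, e', ← e, Iso.hom_inv_id_assoc]

end Realization

/-- Two `2`-cells with the same periodic function are equal. -/
theorem _root_.FreeAdj.eq_of_per_eq {a : FreeAdj} {x y : Word a a} {α β : x ⟶ y}
    (h : wt x ≠ 0 → per (wt x) (wt y) (fn α) = per (wt x) (wt y) (fn β)) : α = β := by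
  refine fn_injective (funext fun l => ?_)
  by_cases h₀ : l < 0
  · rw [(good α).neg l h₀, (good β).neg l h₀]
  by_cases h₁ : l < wt x
  · rw [← per_of_lt (M := wt y) (fn α) (not_lt.1 h₀) h₁,
      ← per_of_lt (M := wt y) (fn β) (not_lt.1 h₀) h₁, h (by omega)]
  · rw [(good α).ge l (not_lt.1 h₁), (good β).ge l (not_lt.1 h₁)]

/-- The function of a `2`-cell, recovered from a function on an interval. -/
def _root_.FreeAdj.cut (N M : ℕ) (φ : ℤ → ℤ) (l : ℤ) : ℤ :=
  if l < 0 then l else if l < N then φ l else l - N + M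

/-- The bounds say that the function maps the regions of a source with `N` letters `g` to the
regions of a target with `M` letters `g`. -/
theorem _root_.FreeAdj.good_cut {a : FreeAdj} {N M : ℕ} {φ : ℤ → ℤ} (mono : Monotone φ)
    (nonneg : 0 ≤ φ 0) (le : ∀ l < (N : ℤ), φ l ≤ M) (zero : a = .one → φ 0 = 0 ∧ (N = 0 → M = 0))
    (lt : a = .zero → ∀ l < (N : ℤ), φ l < M) : Good a a N M (cut N M φ) where
  mono l l' h := by
    have h₀ : ∀ l, 0 ≤ l → 0 ≤ φ l := fun l hl => nonneg.trans (mono hl)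
    have h₁ := mono h
    have h₂ := h₀ l'
    have h₃ := le l
    simp only [cut]
    split_ifs <;> omega
  neg l h := by simp [cut, h]
  nonneg l h := by
    have h₂ := nonneg.trans (mono h)
    simp only [cut]; split_ifs <;> omega
  zero h := by
    obtain ⟨h₁, h₂⟩ := zero h
    simp only [cut]; split_ifs <;> omega
  ge l h := by simp only [cut]; split_ifs <;> omega
  lt h l hl := by
    have := lt h l hl
    simp only [cut]; split_ifs <;> omega

/-- A periodic monotone function whose values on one period are bounded like those of a `2`-cell is
the periodic function of a `2`-cell. -/
theorem _root_.FreeAdj.exists_per_eq {a : FreeAdj} {x y : Word a a} (hx : wt x ≠ 0) {φ : ℤ → ℤ}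
    (h : ∀ l, φ (l + wt x) = φ l + wt y) (mono : Monotone φ)
    (nonneg : 0 ≤ φ 0) (le : ∀ l < (wt x : ℤ), φ l ≤ wt y) (zero : a = .one → φ 0 = 0)
    (lt : a = .zero → ∀ l < (wt x : ℤ), φ l < wt y) :
    ∃ α : x ⟶ y, per (wt x) (wt y) (fn α) = φ := by
  obtain ⟨α, hα⟩ := exists_fn_eq x y
    (good_cut mono nonneg le (fun h => ⟨zero h, fun h => absurd h hx⟩) lt)
  refine ⟨α, eq_of_periodic hx (per_shift hx _) h fun l h₀ h₁ => ?_⟩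
  rw [per_of_lt _ h₀ h₁, hα]
  simp only [cut]
  split_ifs <;> omega

/-- There is a `2`-cell from the empty word on the object `0` to every word. -/
theorem _root_.FreeAdj.exists_cell_of_wt_eq_zero {a : FreeAdj} (ha : a = .zero) {x : Word a a}
    (hx : wt x = 0) (y : Word a a) : Nonempty (x ⟶ y) := by
  obtain ⟨α, -⟩ := exists_fn_eq x y (good_cut (φ := fun l => if l < 0 then l else l)
    (a := a) (fun l l' h => by simpa using h) (by simp) (fun l hl => by simp; omega)
    (fun h => by cases ha.symm.trans h) fun _ l hl => by simp; omega)
  exact ⟨α⟩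

/-- There is a `2`-cell from every word to the empty word on the object `1`. -/
theorem _root_.FreeAdj.exists_cell_to_wt_eq_zero {a : FreeAdj} (ha : a = .one) (x : Word a a)
    {y : Word a a} (hy : wt y = 0) : Nonempty (x ⟶ y) := by
  obtain ⟨α, -⟩ := exists_fn_eq x y (good_cut (φ := fun l => if l < 0 then l else 0)
    (a := a) (fun l l' h => by simp only; split_ifs <;> omega) (by simp)
    (fun l hl => by split_ifs <;> omega) (fun _ => by simp [hy])
    (fun h => by cases ha.symm.trans h))
  exact ⟨α⟩

theorem _root_.FreeAdj.cell_to_wt_eq_zero_ext {a : FreeAdj} {x y : Word a a} (hy : wt y = 0)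
    (α β : x ⟶ y) : α = β := by
  refine eq_of_per_eq fun hx =>
    eq_of_periodic hx (per_shift hx _) (per_shift hx _) fun l h₀ h₁ => ?_
  have := (good α).nonneg l h₀
  have := (good α).le h₁.le
  have := (good β).nonneg l h₀
  have := (good β).le h₁.le
  rw [per_of_lt _ h₀ h₁, per_of_lt _ h₀ h₁]
  omega

theorem _root_.FreeAdj.per_nonneg_iff {a : FreeAdj} (ha : a = .zero) {x y : Word a a} (α : x ⟶ y)
    (hx : wt x ≠ 0) (l : ℤ) : 0 ≤ per (wt x) (wt y) (fn α) l ↔ 0 ≤ l := by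
  have mono := (good α).monotone_per hx
  constructor
  · intro h
    by_contra! hl
    have h₁ := per_shift (M := wt y) hx (fn α) (-1)
    rw [per_of_lt _ (by omega) (by omega)] at h₁
    have h₂ := (good α).lt ha (-1 + wt x) (by omega)
    have h₃ := mono (show l ≤ -1 by omega)
    omega
  · intro h
    have h₁ := mono h
    rw [per_of_lt _ le_rfl (by omega)] at h₁
    exact ((good α).nonneg 0 le_rfl).trans h₁

variable {R : Rotations o D} {K : D ⥤ Target}

theorem StepCell.rep (V : R.Realization K) {j : J} {x y : Word (o j) (o j)} (k : ℤ) (α : x ⟶ y) :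
    V.Rep ((R.step j x ^ k).hom ≫ (R.Φ j).map α) (fun l => per (wt x) (wt y) (fn α) (l + k)) :=
  (V.rep_step_zpow j x k).comp (V.rep_map α)

theorem CellStep.rep (V : R.Realization K) {j : J} {x y : Word (o j) (o j)} (k : ℤ) (α : x ⟶ y) :
    V.Rep ((R.Φ j).map α ≫ (R.step j y ^ k).hom) (fun l => per (wt x) (wt y) (fn α) l + k) :=
  (V.rep_map α).comp (V.rep_step_zpow j y k)

/-- On the object `0`, a function determines the number of steps: the functions of `2`-cells
preserve and reflect being nonnegative. -/
theorem StepCell.eq_of_map_eq (V : R.Realization K) {j : J} (hj : o j = .zero)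
    {x y : Word (o j) (o j)} {f g : (R.Φ j).obj x ⟶ (R.Φ j).obj y} (hf : R.StepCell f)
    (hg : R.StepCell g) (h : K.map f = K.map g) : f = g := by
  obtain ⟨k, α, rfl⟩ := hf
  obtain ⟨l, β, rfl⟩ := hg
  by_cases hx : wt x = 0
  · rw [step_of_wt_eq_zero hx, step_of_wt_eq_zero hx,
      eq_of_per_eq (α := α) (β := β) fun h => absurd hx h]
  by_cases hy : wt y = 0
  · cases hj.symm.trans ((good α).adm.target hy hx)
  have e := Realization.Rep.eq (StepCell.rep V k α) (StepCell.rep V l β) h hx hy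
  have e₁ : ∀ n : ℤ, 0 ≤ n + k ↔ 0 ≤ n + l := fun n => by
    have := congrFun e n
    rw [← per_nonneg_iff hj α hx, ← per_nonneg_iff hj β hx (n + l)]
    exact iff_of_eq (congrArg (0 ≤ ·) this)
  obtain rfl : k = l := by
    have := e₁ (-k)
    have := e₁ (-l)
    omega
  rw [eq_of_per_eq (α := α) (β := β) fun _ => funext fun n => ?_]
  have := congrFun e (n - k)
  simpa using this

/-- On the object `0`, every function comes from a `2`-cell and a number of steps. -/
theorem exists_map_eq_of_zero (V : R.Realization K) {j : J} (hj : o j = .zero)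
    {x y : Word (o j) (o j)} (g : K.obj ((R.Φ j).obj x) ⟶ K.obj ((R.Φ j).obj y)) :
    ∃ f, K.map f = g := by
  by_cases hx : wt x = 0
  · obtain ⟨α⟩ := exists_cell_of_wt_eq_zero hj hx y
    refine ⟨(R.Φ j).map α, ?_⟩
    rw [← cancel_epi (V.κ j x).inv, ← cancel_mono (V.κ j y).hom]
    have : Subsingleton (tobj (o j) (wt x) ⟶ tobj (o j) (wt y)) :=
      subsingleton_hom_of_initial hj hx
    exact Subsingleton.elim _ _
  by_cases hy : wt y = 0
  · exact (isEmpty_hom_initial (.inl hx) hj hy).elim ((V.κ j x).inv ≫ g ≫ (V.κ j y).hom)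
  obtain ⟨φ, h, e⟩ := exists_thom_eq hx hy ((V.κ j x).inv ≫ g ≫ (V.κ j y).hom)
  have mono := h.mono hx hy
  have shift := h.shift hx hy
  -- the number of steps is determined by the least argument at which `φ` is nonnegative
  obtain ⟨k, hk, hk'⟩ : ∃ k, 0 ≤ φ k ∧ ∀ l, 0 ≤ φ l → k ≤ l := by
    refine Int.exists_least_of_bdd ⟨-(|φ 0| + 1) * wt x, fun l hl => ?_⟩
      ⟨|φ 0| * wt x, ?_⟩
    · by_contra! hlt
      have h₁ := mono hlt.le
      have h₂ := periodic_mul shift 0 (-(|φ 0| + 1))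
      rw [zero_add] at h₂
      have : (1 : ℤ) ≤ wt y := by omega
      nlinarith [le_abs_self (φ 0), abs_nonneg (φ 0)]
    · have h₂ := periodic_mul shift 0 |φ 0|
      rw [zero_add] at h₂
      have : (1 : ℤ) ≤ wt y := by omega
      nlinarith [neg_abs_le (φ 0), abs_nonneg (φ 0)]
  have lt : ∀ l < (wt x : ℤ), φ (l + k) < wt y := fun l hl => by
    by_contra! h₁
    have h₂ := shift (l + k - wt x)
    rw [sub_add_cancel] at h₂
    have := hk' (l + k - wt x) (by omega)
    omega
  obtain ⟨α, hα⟩ := exists_per_eq (x := x) (y := y) hx (φ := fun l => φ (l + k))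
    (fun l => by rw [add_right_comm, shift]) (fun l l' hl => mono (by omega)) (by simpa using hk)
    (fun l hl => (lt l hl).le) (fun h => by cases hj.symm.trans h) (fun _ => lt)
  refine ⟨_, Realization.Rep.map_eq (StepCell.rep V (-k) α) e ?_⟩
  rw [hα]
  exact funext fun l => by simp

/-- On the object `1`, a function determines the number of steps: the functions of `2`-cells
preserve `0`. -/
theorem CellStep.eq_of_map_eq (V : R.Realization K) {j : J} (hj : o j = .one)
    {x y : Word (o j) (o j)} {f g : (R.Φ j).obj x ⟶ (R.Φ j).obj y} (hf : R.CellStep f)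
    (hg : R.CellStep g) (h : K.map f = K.map g) : f = g := by
  obtain ⟨k, α, rfl⟩ := hf
  obtain ⟨l, β, rfl⟩ := hg
  by_cases hy : wt y = 0
  · rw [step_of_wt_eq_zero hy, step_of_wt_eq_zero hy, cell_to_wt_eq_zero_ext hy α β]
  by_cases hx : wt x = 0
  · exact absurd ((good α).adm.source hx hj).1 hy
  have e := Realization.Rep.eq (CellStep.rep V k α) (CellStep.rep V l β) h hx hy
  obtain rfl : k = l := by
    have := congrFun e 0
    simp only [per_of_lt (fn _) le_rfl (show (0 : ℤ) < wt x by omega), (good _).zero hj] at this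
    omega
  rw [eq_of_per_eq (α := α) (β := β) fun _ => funext fun n => ?_]
  have := congrFun e n
  simpa using this

/-- On the object `1`, every function comes from a `2`-cell and a number of steps. -/
theorem exists_map_eq_of_one (V : R.Realization K) {j : J} (hj : o j = .one)
    {x y : Word (o j) (o j)} (g : K.obj ((R.Φ j).obj x) ⟶ K.obj ((R.Φ j).obj y)) :
    ∃ f, K.map f = g := by
  by_cases hy : wt y = 0
  · obtain ⟨α⟩ := exists_cell_to_wt_eq_zero hj x hy
    refine ⟨(R.Φ j).map α, ?_⟩
    rw [← cancel_epi (V.κ j x).inv, ← cancel_mono (V.κ j y).hom]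
    have : Subsingleton (tobj (o j) (wt x) ⟶ tobj (o j) (wt y)) :=
      subsingleton_hom_of_terminal hj hy
    exact Subsingleton.elim _ _
  by_cases hx : wt x = 0
  · exact (isEmpty_hom_terminal hj hx (.inl hy)).elim ((V.κ j x).inv ≫ g ≫ (V.κ j y).hom)
  obtain ⟨φ, h, e⟩ := exists_thom_eq hx hy ((V.κ j x).inv ≫ g ≫ (V.κ j y).hom)
  have mono := h.mono hx hy
  have shift := h.shift hx hy
  obtain ⟨α, hα⟩ := exists_per_eq (x := x) (y := y) hx (φ := fun l => φ l - φ 0)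
    (fun l => by rw [shift]; ring) (fun l l' hl => by simpa using mono hl) (by simp)
    (fun l hl => by
      have h₁ := mono hl.le
      have h₂ := shift 0
      rw [zero_add] at h₂
      omega) (fun h => sub_self _) (fun h => by cases hj.symm.trans h)
  refine ⟨_, Realization.Rep.map_eq (CellStep.rep V (φ 0) α) e ?_⟩
  rw [hα]
  exact funext fun l => by simp

/-- A functor is bijective on the morphisms between two objects. -/
abbrev _root_.CategoryTheory.Functor.BijOn {D E : Type*} [Category* D] [Category* E] (K : D ⥤ E)
    (x y : D) : Prop :=
  Function.Bijective (fun f : x ⟶ y => K.map f)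

theorem bijOn_of_zero (V : R.Realization K) {j : J} (hj : o j = .zero) {x y : Word (o j) (o j)}
    (h : ∀ f : (R.Φ j).obj x ⟶ (R.Φ j).obj y, R.StepCell f) :
    K.BijOn ((R.Φ j).obj x) ((R.Φ j).obj y) :=
  ⟨fun f g e => (h f).eq_of_map_eq V hj (h g) e, exists_map_eq_of_zero V hj⟩

theorem bijOn_of_one (V : R.Realization K) {j : J} (hj : o j = .one) {x y : Word (o j) (o j)}
    (h : ∀ f : (R.Φ j).obj x ⟶ (R.Φ j).obj y, R.CellStep f) :
    K.BijOn ((R.Φ j).obj x) ((R.Φ j).obj y) :=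
  ⟨fun f g e => (h f).eq_of_map_eq V hj (h g) e, exists_map_eq_of_one V hj⟩

/-! ### Morphisms between words on a single object -/

section Single

variable {a : FreeAdj} {R : Rotations (fun _ : Unit => a) D}

/-- An inverse of a rotation is a rotation up to a full rotation, which is natural and can be moved
to the front. -/
theorem stepCell_of_generates (hR : R.Generates) (ha : a = .zero) {x y : Word a a}
    (f : (R.Φ ()).obj x ⟶ (R.Φ ()).obj y) : R.StepCell (j := ()) f := by
  have key := hR (fun {_ _ x y} f => ∀ (w : Word a a) (g : (R.Φ ()).obj w ⟶ (R.Φ ()).obj x),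
    R.StepCell (j := ()) g → R.StepCell (j := ()) (x := w) (y := y) (g ≫ f))
    (fun α w g hg => hg.comp_map α)
    (fun p q _ _ hx hy w g hg => hg.comp_τ ha p q hx hy)
    (fun p q x y hx hy w g hg => ?_)
    (fun f₁ f₂ h₁ h₂ w g hg => by
      have := h₂ w _ (h₁ w g hg)
      rwa [Category.assoc] at this) f
  · have := key x (𝟙 _) (by
      rw [← CategoryTheory.Functor.map_id]
      exact stepCell_map (R := R) (j := ()) (𝟙 x))
    rwa [Category.id_comp] at this
  · have h : g ≫ (R.τ (i := ()) (j := ()) p q hx hy).inv = (R.full () w).inv ≫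
        g ≫ (R.τ (i := ()) (j := ()) q p hy hx).hom :=
      hR.comp_τ_inv (i := ()) (j := ()) (k := ()) p q hx hy g
    rw [h, full_inv_eq_step_zpow]
    exact (hg.comp_τ ha q p hy hx).step_comp _

/-- An inverse of a rotation is a rotation up to a full rotation, which is natural and can be moved
to the end. -/
theorem cellStep_of_generates (hR : R.Generates) (ha : a = .one) {x y : Word a a}
    (f : (R.Φ ()).obj x ⟶ (R.Φ ()).obj y) : R.CellStep (j := ()) f := by
  have key := hR (fun {_ _ x y} f => ∀ (z : Word a a) (g : (R.Φ ()).obj y ⟶ (R.Φ ()).obj z),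
    R.CellStep (j := ()) g → R.CellStep (j := ()) (x := x) (y := z) (f ≫ g))
    (fun α z g hg => hg.map_comp α)
    (fun p q _ _ hx hy z g hg => hg.τ_comp ha p q hx hy)
    (fun p q x y hx hy z g hg => ?_)
    (fun f₁ f₂ h₁ h₂ z g hg => by
      have := h₁ z _ (h₂ z g hg)
      rwa [← Category.assoc] at this) f
  · have := key y (𝟙 _) (by
      rw [← CategoryTheory.Functor.map_id]
      exact cellStep_map (R := R) (j := ()) (𝟙 y))
    rwa [Category.comp_id] at this
  · have h : (R.τ (i := ()) (j := ()) p q hx hy).inv ≫ g =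
        ((R.τ (i := ()) (j := ()) q p hy hx).hom ≫ g) ≫ (R.full () z).inv :=
      hR.τ_inv_comp (i := ()) (j := ()) (k := ()) p q hx hy g
    rw [h, full_inv_eq_step_zpow]
    exact (hg.τ_comp ha q p hy hx).comp_step _

end Single

end Rotations

end FreeAdj

namespace FreeAdj

open Quiver.Path (nil)

/-! ### Morphisms between words on both objects -/

namespace Rotations

variable {D : Type*} [Category* D] (R : Rotations (fun a : FreeAdj => a) D)

/-- The normal forms of the morphisms whose source is a word on the object `0`: if the target is a
word on `0`, they are composites of steps and a `2`-cell, and if the target is a word on `1`, they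
are composites of such a morphism, a rotation, and a `2`-cell. -/
def NormalForm {x : Word .zero .zero} : ∀ {j : FreeAdj} {y : Word j j},
    ((R.Φ .zero).obj x ⟶ (R.Φ j).obj y) → Prop
  | .zero, _, f => R.StepCell f
  | .one, y, f => ∃ (p : Word .zero .one) (q : Word .one .zero) (x' : Word .zero .zero)
      (y' : Word .one .one) (hx : x' = p.comp q) (hy : y' = q.comp p)
      (g : (R.Φ .zero).obj x ⟶ (R.Φ .zero).obj x') (β : y' ⟶ y),
      R.StepCell (j := .zero) g ∧ f = g ≫ (R.τ p q hx hy).hom ≫ (R.Φ .one).map β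

variable {R}

theorem NormalForm.comp_map {x : Word .zero .zero} {j : FreeAdj} {y z : Word j j}
    {f : (R.Φ .zero).obj x ⟶ (R.Φ j).obj y} (hf : R.NormalForm f) (α : y ⟶ z) :
    R.NormalForm (f ≫ (R.Φ j).map α) := by
  cases j with
  | zero =>
    have hf' : R.StepCell (j := FreeAdj.zero) f := hf
    exact hf'.comp_map α
  | one =>
    obtain ⟨p, q, x', y', hx, hy, g, β, hg, rfl⟩ := hf
    exact ⟨p, q, x', y', hx, hy, g, β ≫ α, hg, by
      rw [Category.assoc, Category.assoc, Functor.map_comp]⟩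

theorem NormalForm.step_comp {x : Word .zero .zero} {j : FreeAdj} {y : Word j j}
    {f : (R.Φ .zero).obj x ⟶ (R.Φ j).obj y} (hf : R.NormalForm f) (k : ℤ) :
    R.NormalForm ((R.step .zero x ^ k).hom ≫ f) := by
  cases j with
  | zero =>
    have hf' : R.StepCell (j := FreeAdj.zero) f := hf
    exact hf'.step_comp k
  | one =>
    obtain ⟨p, q, x', y', hx, hy, g, β, hg, rfl⟩ := hf
    exact ⟨p, q, x', y', hx, hy, _, β, hg.step_comp k, by rw [Category.assoc]⟩

theorem NormalForm.comp_full (hR : R.Generates) {x : Word .zero .zero} {j : FreeAdj} {y : Word j j}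
    {f : (R.Φ .zero).obj x ⟶ (R.Φ j).obj y} (hf : R.NormalForm f) :
    R.NormalForm (f ≫ (R.full j y).hom) := by
  rw [← hR.full_comp, full_eq_step_zpow]
  exact hf.step_comp _

theorem NormalForm.full_inv_comp {x : Word .zero .zero} {j : FreeAdj} {y : Word j j}
    {f : (R.Φ .zero).obj x ⟶ (R.Φ j).obj y} (hf : R.NormalForm f) :
    R.NormalForm ((R.full .zero x).inv ≫ f) := by
  rw [full_inv_eq_step_zpow]
  exact hf.step_comp _

theorem NormalForm.comp_τ_zero_one {x : Word .zero .zero} {y : Word .zero .zero}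
    {f : (R.Φ .zero).obj x ⟶ (R.Φ .zero).obj y} (hf : R.NormalForm f) (p : Word .zero .one)
    (q : Word .one .zero) {z : Word .one .one} (hy : y = p.comp q) (hz : z = q.comp p) :
    R.NormalForm (f ≫ (R.τ p q hy hz).hom) :=
  ⟨p, q, y, z, hy, hz, f, 𝟙 z, hf, by
    rw [CategoryTheory.Functor.map_id, Category.comp_id]⟩

/-- A rotation of a word on the object `1` to a word on the object `0` is moved past the `2`-cell
by splitting the latter at an occurrence of `0`. The two rotations which meet are combined by the
hexagon identity. -/
theorem NormalForm.comp_τ_one_zero (hR : R.Generates) {x : Word .zero .zero} {y : Word .one .one}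
    {f : (R.Φ .zero).obj x ⟶ (R.Φ .one).obj y} (hf : R.NormalForm f) (p : Word .one .zero)
    (q : Word .zero .one) {z : Word .zero .zero} (hy : y = p.comp q) (hz : z = q.comp p) :
    R.NormalForm (f ≫ (R.τ p q hy hz).hom) := by
  obtain ⟨p₀, q₀, x', y', hx', hy', g, β, hg, rfl⟩ := hf
  obtain ⟨q₁, p₁, h, β₁, β₂, rfl⟩ := exists_hc_of_target rfl hy β
  rw [Category.assoc, Category.assoc, R.naturality β₁ β₂ h rfl hy hz]
  suffices H : R.NormalForm (g ≫ (R.τ p₀ q₀ hx' hy').hom ≫ (R.τ q₁ p₁ h rfl).hom) by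
    have := H.comp_map (hc β₂ β₁ rfl hz)
    rwa [Category.assoc, Category.assoc] at this
  obtain ⟨s, rfl, rfl⟩ | ⟨s, rfl, rfl⟩ := comp_eq_comp (hy'.symm.trans h)
  · have e := R.hexagon (i := .zero) (j := .zero) (k := .one) s p₁ q₀ rfl rfl rfl
      (hx'.trans (Quiver.Path.comp_assoc _ _ _)) (Quiver.Path.comp_assoc _ _ _).symm hx' hy' h rfl
    rw [← e]
    exact hg.comp_τ rfl _ _ _ _
  · have hxx : x' = (s.comp p₀).comp q₁ := by
      refine eq_of_wt_eq _ _ ?_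
      rw [hx']; simp only [wt_comp]; omega
    have e := R.hexagon (i := .zero) (j := .one) (k := .zero) p₀ q₁ s rfl rfl rfl hx' hy'
      (hx'.trans (Quiver.Path.comp_assoc _ _ _).symm)
      (eq_of_wt_eq _ _ (by rw [hx']; simp only [wt_comp]; omega)) hxx h
    rw [e, Category.assoc, ← Category.assoc]
    have e' := τ_comp_τ (R := R) (i := .zero) (j := .one) (s.comp p₀) q₁ hxx h
    have h₁ : R.NormalForm (g ≫ (R.τ (i := .zero) (j := .zero) (p₀.comp q₁) s
      (hx'.trans (Quiver.Path.comp_assoc _ _ _).symm)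
      (eq_of_wt_eq _ _ (by rw [hx']; simp only [wt_comp]; omega) : x' = _)).hom) :=
      hg.comp_τ rfl _ _ _ _
    obtain rfl : (s.comp p₀).comp q₁ = x' := hxx.symm
    rw [e']
    exact h₁.comp_full hR

theorem NormalForm.comp_τ_one_one (hR : R.Generates) {x : Word .zero .zero} {y : Word .one .one}
    {f : (R.Φ .zero).obj x ⟶ (R.Φ .one).obj y} (hf : R.NormalForm f) (p : Word .one .one)
    (q : Word .one .one) {z : Word .one .one} (hy : y = p.comp q) (hz : z = q.comp p) :
    R.NormalForm (f ≫ (R.τ p q hy hz).hom) := by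
  cases p with
  | nil =>
    obtain rfl : z = y := by rw [hy, hz, Quiver.Path.nil_comp]; rfl
    obtain rfl : q = z := hz.symm
    exact hf.comp_full hR
  | cons p e =>
    change Arrow _ _ at e
    cases e
    -- a rotation by a word through the object `0` is a composite of two rotations via `0`
    have e := R.hexagon (i := .one) (j := .zero) (k := .one) p wf q rfl rfl rfl
      (x := y) (y := (wf.comp q).comp p) (z := z)
      (hy.trans (Quiver.Path.comp_assoc p wf q)) rfl hy hz
      (hz.trans (Quiver.Path.comp_assoc q p wf).symm) (Quiver.Path.comp_assoc _ _ _)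
    rw [← Iso.comp_inv_eq] at e
    refine (congrArg (fun m => R.NormalForm (f ≫ m)) e).mp ?_
    rw [← Category.assoc, hR.comp_τ_inv]
    exact ((hf.comp_τ_one_zero hR _ _ _ _).comp_τ_zero_one _ _ _ _).full_inv_comp

theorem NormalForm.comp_τ (hR : R.Generates) {x : Word .zero .zero} {j k : FreeAdj} {y : Word j j}
    {f : (R.Φ .zero).obj x ⟶ (R.Φ j).obj y} (hf : R.NormalForm f) (p : Word j k)
    (q : Word k j) {z : Word k k} (hy : y = p.comp q) (hz : z = q.comp p) :
    R.NormalForm (f ≫ (R.τ p q hy hz).hom) := by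
  cases j <;> cases k
  · have hf' : R.StepCell (j := FreeAdj.zero) f := hf
    exact hf'.comp_τ rfl _ _ _ _
  · exact hf.comp_τ_zero_one _ _ _ _
  · exact hf.comp_τ_one_zero hR _ _ _ _
  · exact hf.comp_τ_one_one hR _ _ _ _

theorem normalForm_of_generates (hR : R.Generates) {x : Word .zero .zero} {j : FreeAdj}
    {y : Word j j} (f : (R.Φ .zero).obj x ⟶ (R.Φ j).obj y) : R.NormalForm f := by
  have key := hR (fun {i j y z} f => ∀ (w : Word .zero .zero)
      (g : (R.Φ .zero).obj w ⟶ (R.Φ i).obj y), R.NormalForm g → R.NormalForm (g ≫ f))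
    (fun α w g hg => hg.comp_map α)
    (fun p q _ _ hx hy w g hg => hg.comp_τ hR p q hx hy)
    (fun p q x y hx hy w g hg => by
      rw [hR.comp_τ_inv]
      exact (hg.comp_τ hR q p hy hx).full_inv_comp)
    (fun f₁ f₂ h₁ h₂ w g hg => by
      rw [← Category.assoc]
      exact h₂ w _ (h₁ w g hg)) f
  have := key x (𝟙 _) (by
    rw [← CategoryTheory.Functor.map_id]
    exact stepCell_map (R := R) (j := .zero) (𝟙 x))
  rwa [Category.id_comp] at this

/-! ### The terminal object -/

/-- The `2`-cell from a word on the object `1` to the empty word. -/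
noncomputable def _root_.FreeAdj.toNil (x : Word .one .one) : x ⟶ (nil : Word .one .one) :=
  (exists_cell_to_wt_eq_zero rfl x rfl).some

theorem _root_.FreeAdj.comp_toNil {x y : Word .one .one} (α : x ⟶ y) :
    α ≫ toNil y = toNil x :=
  cell_to_wt_eq_zero_ext rfl _ _

variable (R)

/-- The morphisms from the words to the empty word on the object `1`. -/
noncomputable def toTerminal : ∀ (j : FreeAdj) (x : Word j j),
    (R.Φ j).obj x ⟶ (R.Φ .one).obj (nil : Word .one .one)
  | .zero, x => (R.Φ .zero).map (unitEnd x) ≫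
      (R.τ (i := .zero) (j := .one) (x.cons Arrow.f) wg rfl rfl).hom ≫ (R.Φ .one).map (toNil _)
  | .one, x => (R.Φ .one).map (toNil x)

variable {R}

theorem toTerminal_one (x : Word .one .one) :
    R.toTerminal .one x = (R.Φ .one).map (toNil x) := rfl

theorem map_comp_toTerminal_one {x y : Word .one .one} (α : x ⟶ y) :
    (R.Φ .one).map α ≫ R.toTerminal .one y = R.toTerminal .one x := by
  rw [toTerminal_one, toTerminal_one, ← Functor.map_comp, comp_toNil]

theorem τ_comp_toTerminal_one_one (p q : Word .one .one) {x y : Word .one .one}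
    (hx : x = p.comp q) (hy : y = q.comp p) :
    (R.τ (i := .one) (j := .one) p q hx hy).hom ≫ R.toTerminal .one y = R.toTerminal .one x := by
  have e := R.naturality (i := .one) (j := .one) (toNil p) (toNil q) hx hy
    (rfl : (nil : Word .one .one) = nil.comp nil) rfl
  have e := (Category.comp_id _).symm.trans
    ((congrArg (_ ≫ ·) (R.unit (j := .one) nil rfl rfl)).symm.trans e)
  rw [← map_comp_toTerminal_one (hc (toNil q) (toNil p) hy rfl), ← Category.assoc]
  exact (congrArg (· ≫ _) e.symm).trans (map_comp_toTerminal_one _)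

/-- The composite of a rotation and the `2`-cell to the empty word does not depend on the choice of
the rotation. -/
theorem τ_comp_toTerminal_indep {p p' : Word .zero .one} {q q' : Word .one .zero}
    {x : Word .zero .zero} {y y' : Word .one .one} (hx : x = p.comp q) (hy : y = q.comp p)
    (hx' : x = p'.comp q') (hy' : y' = q'.comp p') :
    (R.τ (i := .zero) (j := .one) p q hx hy).hom ≫ R.toTerminal .one y =
      (R.τ (i := .zero) (j := .one) p' q' hx' hy').hom ≫ R.toTerminal .one y' := by
  have key : ∀ {p p' : Word .zero .one} {q q' : Word .one .zero} {y y' : Word .one .one}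
      (hx : x = p.comp q) (hy : y = q.comp p) (hx' : x = p'.comp q') (hy' : y' = q'.comp p')
      (s : Word .one .one) (_ : p' = p.comp s) (_ : q = s.comp q'),
      (R.τ (i := .zero) (j := .one) p q hx hy).hom ≫ R.toTerminal .one y =
        (R.τ (i := .zero) (j := .one) p' q' hx' hy').hom ≫ R.toTerminal .one y' := by
    intro p p' q q' y y' hx hy hx' hy' s h₁ h₂
    have e := R.hexagon (i := .zero) (j := .one) (k := .one) p s q' h₂ h₁ rfl hx hy hx' hy'
      (by rw [hy', h₁]; exact (Quiver.Path.comp_assoc _ _ _).symm)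
      (by rw [hy, h₂]; exact Quiver.Path.comp_assoc _ _ _)
    rw [e, Category.assoc, τ_comp_toTerminal_one_one]
  obtain ⟨s, h₁, h₂⟩ | ⟨s, h₁, h₂⟩ := comp_eq_comp (hx.symm.trans hx')
  · exact key hx hy hx' hy' s h₁ h₂
  · exact (key hx' hy' hx hy s h₁ h₂).symm

theorem map_comp_toTerminal_zero {x y : Word .zero .zero} (α : x ⟶ y) :
    (R.Φ .zero).map α ≫ R.toTerminal .zero y = R.toTerminal .zero x := by
  have h₁ : α ≫ unitEnd y = unitEnd x ≫ hc (p := x.cons Arrow.f) (p' := y.cons Arrow.f)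
      (wr α .f) (𝟙 wg) rfl rfl := by
    rw [unitEnd_naturality]
    exact congrArg (_ ≫ ·) ((hc_rfl _ _).trans ((congrArg (_ ≫ ·) (whiskerL_id _ _)).trans
      (Category.comp_id _))).symm
  have e := R.naturality (i := .zero) (j := .one) (p := x.cons Arrow.f) (p' := y.cons Arrow.f)
    (wr α .f) (𝟙 wg) rfl rfl rfl rfl
  refine (Category.assoc _ _ _).symm.trans ?_
  refine (congrArg (· ≫ _) (((R.Φ .zero).map_comp _ _).symm.trans
    ((congrArg (R.Φ .zero).map h₁).trans ((R.Φ .zero).map_comp _ _)))).trans ?_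
  refine (Category.assoc _ _ _).trans (congrArg (_ ≫ ·) ?_)
  refine (Category.assoc _ _ _).symm.trans ((congrArg (· ≫ _) e).trans ?_)
  exact (Category.assoc _ _ _).trans (congrArg (_ ≫ ·) (map_comp_toTerminal_one _))

theorem τ_comp_toTerminal_zero_one (p : Word .zero .one) (q : Word .one .zero)
    {x : Word .zero .zero} {y : Word .one .one} (hx : x = p.comp q) (hy : y = q.comp p) :
    (R.τ (i := .zero) (j := .one) p q hx hy).hom ≫ R.toTerminal .one y =
      R.toTerminal .zero x := by
  subst hx hy
  have h : hc (𝟙 p) (unitEnd q) rfl rfl = unitEnd (p.comp q) := by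
    rw [hc_rfl, whiskerR_id, whiskerL_unitEnd]
    exact Category.id_comp _
  have e := R.naturality (i := .zero) (j := .one) (𝟙 p) (unitEnd q) rfl rfl rfl rfl
  rw [← map_comp_toTerminal_one (hc (unitEnd q) (𝟙 p) rfl rfl), ← Category.assoc]
  refine (congrArg (· ≫ _) e.symm).trans ?_
  rw [h, Category.assoc]
  exact congrArg (_ ≫ ·) (τ_comp_toTerminal_indep _ _ _ _)

theorem τ_comp_toTerminal_one_zero (q : Word .one .zero) (p : Word .zero .one)
    {x : Word .one .one} {y : Word .zero .zero} (hx : x = q.comp p) (hy : y = p.comp q) :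
    (R.τ (i := .one) (j := .zero) q p hx hy).hom ≫ R.toTerminal .zero y =
      R.toTerminal .one x := by
  rw [← τ_comp_toTerminal_zero_one p q hy hx, ← Category.assoc, τ_comp_τ]
  exact τ_comp_toTerminal_one_one _ _ _ _

/-- A rotation which factors through the object `1` is compatible with the morphisms to the empty
word. For an arbitrary rotation, such a factorization exists after insertion of a unit. -/
theorem τ_comp_toTerminal_of_comp (p : Word .zero .one) (q : Word .one .zero) {t : Word .zero .zero}
    (ht : t = p.comp q) (r : Word .zero .zero) {x y : Word .zero .zero} (hx : x = t.comp r)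
    (hy : y = r.comp t) :
    (R.τ (i := .zero) (j := .zero) t r hx hy).hom ≫ R.toTerminal .zero y =
      R.toTerminal .zero x := by
  have h : x = p.comp (q.comp r) := by rw [hx, ht]; exact Quiver.Path.comp_assoc _ _ _
  have h' : y = (r.comp p).comp q := by rw [hy, ht]; exact (Quiver.Path.comp_assoc _ _ _).symm
  have h'' : (q.comp r).comp p = q.comp (r.comp p) := Quiver.Path.comp_assoc _ _ _
  have e := R.hexagon (i := .zero) (j := .one) (k := .zero) p q r rfl ht rfl h h''.symm hx hy h' rfl
  rw [← τ_comp_toTerminal_zero_one (r.comp p) q h' rfl, ← Category.assoc, ← e,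
    τ_comp_toTerminal_zero_one]

theorem τ_comp_toTerminal_zero_zero (p q : Word .zero .zero) {x y : Word .zero .zero}
    (hx : x = p.comp q) (hy : y = q.comp p) :
    (R.τ (i := .zero) (j := .zero) p q hx hy).hom ≫ R.toTerminal .zero y =
      R.toTerminal .zero x := by
  subst hx hy
  have h : hc (𝟙 q) (unitEnd p) rfl rfl = unitEnd (q.comp p) := by
    rw [hc_rfl, whiskerR_id, whiskerL_unitEnd]
    exact Category.id_comp _
  have e := R.naturality (i := .zero) (j := .zero) (unitEnd p) (𝟙 q) rfl rfl rfl rfl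
  rw [← map_comp_toTerminal_zero (unitEnd (q.comp p)), ← h, ← Category.assoc]
  refine (congrArg (· ≫ _) e.symm).trans ((Category.assoc _ _ _).trans ?_)
  refine Eq.trans (congrArg (_ ≫ ·) ?_) (map_comp_toTerminal_zero (hc (unitEnd p) (𝟙 q) rfl rfl))
  exact τ_comp_toTerminal_of_comp (p.cons Arrow.f) wg rfl q rfl rfl

/-- The morphisms to the empty word on the object `1` are natural. -/
theorem comp_toTerminal (hR : R.Generates) {i j : FreeAdj} {x : Word i i} {y : Word j j}
    (f : (R.Φ i).obj x ⟶ (R.Φ j).obj y) : f ≫ R.toTerminal j y = R.toTerminal i x := by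
  have hτ {i j : FreeAdj} (p : Word i j) (q : Word j i) {x : Word i i} {y : Word j j}
      (hx : x = p.comp q) (hy : y = q.comp p) :
      (R.τ p q hx hy).hom ≫ R.toTerminal j y = R.toTerminal i x := by
    cases i <;> cases j
    · exact τ_comp_toTerminal_zero_zero _ _ _ _
    · exact τ_comp_toTerminal_zero_one _ _ _ _
    · exact τ_comp_toTerminal_one_zero _ _ _ _
    · exact τ_comp_toTerminal_one_one _ _ _ _
  refine hR (fun {i j x y} f => f ≫ R.toTerminal j y = R.toTerminal i x) (fun {i x y} α => ?_)
    hτ (fun p q x y hx hy => ?_) (fun f g hf hg => ?_) f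
  · cases i
    · exact map_comp_toTerminal_zero α
    · exact map_comp_toTerminal_one α
  · rw [Iso.inv_comp_eq]
    exact (hτ p q hx hy).symm
  · rw [Category.assoc, hg, hf]

/-- The empty word on the object `1` is terminal. -/
theorem eq_toTerminal (hR : R.Generates) {i : FreeAdj} {x : Word i i}
    (f : (R.Φ i).obj x ⟶ (R.Φ .one).obj (nil : Word .one .one)) : f = R.toTerminal i x := by
  have h : R.toTerminal .one nil = 𝟙 _ := by
    refine Eq.trans (congrArg (R.Φ .one).map ?_) ((R.Φ .one).map_id _)
    exact cell_to_wt_eq_zero_ext rfl _ _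
  have := comp_toTerminal hR f
  rwa [h, Category.comp_id] at this

theorem bijOn_nil_one (hR : R.Generates) {K : D ⥤ Target} (V : R.Realization K) {i : FreeAdj}
    (x : Word i i) : K.BijOn ((R.Φ i).obj x) ((R.Φ .one).obj (nil : Word .one .one)) := by
  refine ⟨fun f g _ => (eq_toTerminal hR f).trans (eq_toTerminal hR g).symm, fun g =>
    ⟨R.toTerminal i x, ?_⟩⟩
  rw [← cancel_mono (V.κ .one nil).hom]
  exact (subsingleton_hom_of_terminal rfl rfl).elim _ _

theorem bijOn_nil_one_zero {K : D ⥤ Target} (V : R.Realization K)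
    (x : Word .zero .zero) : K.BijOn ((R.Φ .one).obj (nil : Word .one .one))
      ((R.Φ .zero).obj x) := by
  have h : IsEmpty (K.obj ((R.Φ .one).obj (nil : Word .one .one)) ⟶ K.obj ((R.Φ .zero).obj x)) :=
    ⟨fun g => (isEmpty_hom_terminal rfl rfl (.inr rfl)).elim
      ((V.κ .one nil).inv ≫ g ≫ (V.κ .zero x).hom)⟩
  exact ⟨fun f => (h.false (K.map f)).elim, fun g => (h.false g).elim⟩

/-- A word on the object `1` is empty or, by a rotation, isomorphic to a word on the object `0`. -/
theorem exists_iso_zero (x : Word .one .one) : x = nil ∨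
    ∃ y : Word .zero .zero, Nonempty ((R.Φ .one).obj x ≅ (R.Φ .zero).obj y) := by
  cases x with
  | nil => exact .inl rfl
  | cons x e =>
    change Arrow _ _ at e
    cases e
    exact .inr ⟨wf.comp x, ⟨R.τ (i := .one) (j := .zero) x wf rfl rfl⟩⟩

end Rotations

end FreeAdj

/-! ### The rotations of the Hochschild homology -/

namespace BiHH

section

variable {B : Type u} [Bicategory.{w, v} B] {C : Type u} [Bicategory.{w, v} C]
  (P : Pseudofunctor B C)

theorem map_map_endo {X : B} {F G : X ⟶ X} (α : F ⟶ G) :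
    (map P).map ((endo X).map α) = (endo (P.obj X)).map (P.map₂ α) :=
  Category.id_comp _

theorem map_map_glue {k l : Lvl} (a : Op k l) (x : Level B k) :
    (map P).map ((glueIso B a).hom.app x) =
      (glueIso C a).hom.app ((levelMap P k).obj x) ≫ (ι C l).map ((opIso P a).hom.app x) :=
  Category.id_comp _

theorem map_map_unglue {k l : Lvl} (a : Op k l) (x : Level B k) :
    (map P).map ((glueIso B a).inv.app x) =
      (ι C l).map ((opIso P a).inv.app x) ≫ (glueIso C a).inv.app ((levelMap P k).obj x) :=
  Category.id_comp _

theorem map_map_tau {X Y : B} (F : X ⟶ Y) (G : Y ⟶ X) :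
    (map P).map (tau F G).hom =
      ((endo (P.obj X)).map (P.mapComp F G).hom ≫ (tau (P.map F) (P.map G)).hom) ≫
        (endo (P.obj Y)).map (P.mapComp G F).inv := by
  refine ((map P).map_comp _ _).trans ((congrArg₂ (· ≫ ·)
    (map_map_unglue P .d10 ⟨(X, Y), F, G⟩) (map_map_glue P .d11 ⟨(X, Y), F, G⟩)).trans ?_)
  change ((endo (P.obj X)).map (P.mapComp F G).hom ≫ (glueD10 (P.map F) (P.map G)).inv) ≫
    (glueD11 (P.map F) (P.map G)).hom ≫ (endo (P.obj Y)).map (P.mapComp G F).inv = _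
  simp [tau]

end

end BiHH

namespace FreeAdj

open BiHH

/-- The rotation of a composite word, in the Hochschild homology of the free adjunction. -/
def rotation {a b : FreeAdj} (p : Word a b) (q : Word b a) :
    (endo (B := FreeAdj) a).obj (p.comp q) ≅ (endo (B := FreeAdj) b).obj (q.comp p) :=
  tau (B := FreeAdj) p q

/-- The rotations of the Hochschild homology of the free adjunction. -/
def rotations : Rotations (fun a : FreeAdj => a) (biHH FreeAdj) where
  Φ a := endo a
  τ {a b} p q {x y} hx hy := (endo (B := FreeAdj) a).mapIso (eqToIso hx) ≪≫ rotation p q ≪≫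
    (endo (B := FreeAdj) b).mapIso (eqToIso hy.symm)
  naturality {a b p p' q q'} α β {x x' y y'} hx hy hx' hy' := by
    subst hx hy hx' hy'
    have h : (endo (B := FreeAdj) a).map (hc α β rfl rfl) ≫ (rotation p' q').hom =
        (rotation p q).hom ≫ (endo (B := FreeAdj) b).map (hc β α rfl rfl) := by
      rw [hc_rfl, hc_rfl]
      exact tau_naturality (B := FreeAdj) (X := a) (Y := b) α β
    simpa using h
  hexagon {a b c} p q r {s t u} hs ht hu {x y z} h₁ h₂ h₃ h₄ h₅ h₆ := by
    subst hs ht hu h₃ h₄ h₆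
    have h : (endo (B := FreeAdj) a).map (eqToHom h₁) ≫ (rotation p (q.comp r)).hom ≫
        (endo (B := FreeAdj) b).map (eqToHom h₂.symm) = (rotation (p.comp q) r).hom ≫
          (endo (B := FreeAdj) c).map (eqToHom h₅) ≫ (rotation (r.comp p) q).hom :=
      tau_hexagon (B := FreeAdj) p q r
    simpa using h
  unit {a} p {x} hx hx' := by
    obtain rfl : p = x := hx.symm
    have h : (rotation p .nil).hom = (endo (B := FreeAdj) a).map
        (eqToHom (Quiver.Path.nil_comp p).symm) := by
      refine (tau_unit (B := FreeAdj) p).trans (congrArg (endo (B := FreeAdj) a).map ?_)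
      exact eqToHom_trans (Quiver.Path.comp_nil p) (Quiver.Path.nil_comp p).symm
    refine (congrArg (fun m => (endo (B := FreeAdj) a).map (𝟙 p) ≫ m ≫
      (endo (B := FreeAdj) a).map (eqToHom hx'.symm)) h).trans ?_
    rw [← CategoryTheory.Functor.map_comp, ← CategoryTheory.Functor.map_comp, eqToHom_trans]
    exact (congrArg (endo (B := FreeAdj) a).map (Category.id_comp (𝟙 p))).trans
      (CategoryTheory.Functor.map_id _ _)

theorem rotations_τ {a b : FreeAdj} (p : Word a b) (q : Word b a) :
    rotations.τ (i := a) (j := b) p q rfl rfl = rotation p q := by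
  refine Iso.ext ?_
  change (endo (B := FreeAdj) a).map (𝟙 _) ≫ (rotation p q).hom ≫
    (endo (B := FreeAdj) b).map (𝟙 _) = _
  rw [CategoryTheory.Functor.map_id, CategoryTheory.Functor.map_id, Category.id_comp,
    Category.comp_id]

theorem rotations_generates : rotations.Generates := by
  intro C cell tau tau_inv comp i j x y f
  have key {x y : Level FreeAdj .zero} {f : (ι FreeAdj .zero).obj x ⟶ (ι FreeAdj .zero).obj y}
      (hf : Zig f) : C (i := x.1) (j := y.1) (x := x.2) (y := y.2) f := by
    induction hf with
    | cell f =>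
      obtain ⟨α⟩ := f
      exact cell α
    | tau p q =>
      exact (congrArg (fun e => C e.hom) (rotations_τ p q)).mp (tau p q rfl rfl)
    | tau_inv p q =>
      exact (congrArg (fun e => C e.inv) (rotations_τ p q)).mp (tau_inv p q rfl rfl)
    | comp _ _ h h' => exact comp _ _ h h'
  exact key (zig (x := ⟨i, x⟩) (y := ⟨j, y⟩) f)

/-- The functor `toTarget` sends cells and rotations to the functions which belong to them. -/
def realization : rotations.Realization toTarget where
  κ a p := Iso.refl _
  map_cell α := (Category.comp_id _).trans
    ((cocone.functor_map_endo α).trans (Category.id_comp _).symm)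
  map_τ {a b} p q x y hx hy := by
    subst hx hy
    refine (Category.comp_id _).trans (Eq.trans ?_ (Category.id_comp _).symm)
    rw [rotations_τ]
    exact cocone.functor_map_tau p q

end FreeAdj

namespace FreeAdj

open BiHH

/-! ### The full sub-`2`-categories on one object -/

/-- The full sub-`2`-category of the free adjunction on an object. -/
abbrev Sub (a : FreeAdj) : Type := InducedBicategory FreeAdj (fun _ : Unit => a)

namespace Sub

variable (a : FreeAdj)

/-- The object of the sub-`2`-category. -/
abbrev pt : Sub a := ()

/-- The functor which regards the words on the object as `1`-cells of the sub-`2`-category. -/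
def wordFunctor : Word a a ⥤ (pt a ⟶ pt a) where
  obj p := InducedBicategory.mkHom p
  map α := InducedBicategory.mkHom₂ α

/-- The functor from the words on the object to the Hochschild homology. -/
def endo : Word a a ⥤ biHH (Sub a) := wordFunctor a ⋙ BiHH.endo (pt a)

variable {a}

/-- The rotation of a composite word, in the Hochschild homology of the sub-`2`-category. -/
def rotation (p q : Word a a) : (endo a).obj (p.comp q) ≅ (endo a).obj (q.comp p) :=
  tau (B := Sub a) (X := pt a) (Y := pt a) (InducedBicategory.mkHom p) (InducedBicategory.mkHom q)

variable (a)

/-- The rotations of the Hochschild homology of the sub-`2`-category. -/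
def rotations : Rotations (fun _ : Unit => a) (biHH (Sub a)) where
  Φ _ := endo a
  τ {_ _} p q {_ _} hx hy := (endo a).mapIso (eqToIso hx) ≪≫ rotation p q ≪≫
    (endo a).mapIso (eqToIso hy.symm)
  naturality {_ _ p p' q q'} α β {x x' y y'} hx hy hx' hy' := by
    subst hx hy hx' hy'
    have h : (endo a).map (hc α β rfl rfl) ≫ (rotation p' q').hom =
        (rotation p q).hom ≫ (endo a).map (hc β α rfl rfl) := by
      rw [hc_rfl, hc_rfl]
      exact tau_naturality (B := Sub a) (X := pt a) (Y := pt a)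
        (InducedBicategory.mkHom₂ α) (InducedBicategory.mkHom₂ β)
    simpa using h
  hexagon {_ _ _} p q r {s t u} hs ht hu {x y z} h₁ h₂ h₃ h₄ h₅ h₆ := by
    subst hs ht hu h₃ h₄ h₆
    have h : (endo a).map (eqToHom h₁) ≫ (rotation p (q.comp r)).hom ≫
        (endo a).map (eqToHom h₂.symm) = (rotation (p.comp q) r).hom ≫
          (endo a).map (eqToHom h₅) ≫ (rotation (r.comp p) q).hom :=
      tau_hexagon (B := Sub a) (X := pt a) (Y := pt a) (Z := pt a) (InducedBicategory.mkHom p)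
        (InducedBicategory.mkHom q) (InducedBicategory.mkHom r)
    simpa using h
  unit {_} p {x} hx hx' := by
    obtain rfl : p = x := hx.symm
    have h : (rotation p .nil).hom = (endo a).map (eqToHom (Quiver.Path.nil_comp p).symm) := by
      refine (tau_unit (B := Sub a) (X := pt a) (InducedBicategory.mkHom p)).trans
        (congrArg (endo a).map ?_)
      exact eqToHom_trans (Quiver.Path.comp_nil p) (Quiver.Path.nil_comp p).symm
    refine (congrArg (fun m => (endo a).map (𝟙 p) ≫ m ≫
      (endo a).map (eqToHom hx'.symm)) h).trans ?_
    rw [← CategoryTheory.Functor.map_comp, ← CategoryTheory.Functor.map_comp, eqToHom_trans]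
    exact (congrArg (endo a).map (Category.id_comp (𝟙 p))).trans
      (CategoryTheory.Functor.map_id _ _)

variable {a}

theorem rotations_τ (p q : Word a a) :
    (rotations a).τ (i := ()) (j := ()) p q rfl rfl = rotation p q := by
  refine Iso.ext ?_
  change (endo a).map (𝟙 _) ≫ (rotation p q).hom ≫ (endo a).map (𝟙 _) = _
  rw [CategoryTheory.Functor.map_id, CategoryTheory.Functor.map_id, Category.id_comp,
    Category.comp_id]

theorem rotations_generates : (rotations a).Generates := by
  intro C cell tau tau_inv comp i j x y f
  have key {x y : Level (Sub a) .zero} {f : (ι (Sub a) .zero).obj x ⟶ (ι (Sub a) .zero).obj y}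
      (hf : Zig f) : C (i := x.1) (j := y.1) (x := x.2.hom) (y := y.2.hom) f := by
    induction hf with
    | cell f =>
      obtain ⟨α⟩ := f
      exact cell (i := ()) α.hom
    | tau p q =>
      exact (congrArg (fun e => C (i := ()) (j := ()) e.hom) (rotations_τ p.hom q.hom)).mp
        (tau (i := ()) (j := ()) p.hom q.hom rfl rfl)
    | tau_inv p q =>
      exact (congrArg (fun e => C (i := ()) (j := ()) e.inv) (rotations_τ p.hom q.hom)).mp
        (tau_inv (i := ()) (j := ()) p.hom q.hom rfl rfl)
    | comp _ _ h h' => exact comp _ _ h h'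
  exact key (zig (B := Sub a) (x := ⟨i, InducedBicategory.mkHom (X := pt a) (Y := pt a) x⟩)
    (y := ⟨j, InducedBicategory.mkHom (X := pt a) (Y := pt a) y⟩) f)

variable (a)

/-- The inclusion of the sub-`2`-category. -/
abbrev incl : Pseudofunctor (Sub a) FreeAdj := InducedBicategory.forget.toPseudofunctor

variable {a}

theorem map_incl_map_endo {p q : Word a a} (α : p ⟶ q) :
    (BiHH.map (incl a)).map ((endo a).map α) = (BiHH.endo (B := FreeAdj) a).map α :=
  map_map_endo (incl a) (X := pt a) (InducedBicategory.mkHom₂ α)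

theorem map_incl_map_rotation (p q : Word a a) :
    (BiHH.map (incl a)).map (rotation p q).hom = (FreeAdj.rotation p q).hom := by
  refine (map_map_tau (incl a) (X := pt a) (Y := pt a) (InducedBicategory.mkHom p)
    (InducedBicategory.mkHom q)).trans ?_
  change ((BiHH.endo (B := FreeAdj) a).map (𝟙 (p.comp q)) ≫ (FreeAdj.rotation p q).hom) ≫
    (BiHH.endo (B := FreeAdj) a).map (𝟙 (q.comp p)) = _
  rw [CategoryTheory.Functor.map_id, CategoryTheory.Functor.map_id, Category.id_comp,
    Category.comp_id]

variable (a) in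
/-- The composite of the functor induced by the inclusion and of `toTarget` sends cells and
rotations to the functions which belong to them. -/
def realization : (rotations a).Realization (BiHH.map (incl a) ⋙ toTarget) where
  κ _ p := Iso.refl (tobj a (wt p))
  map_cell α := (Category.comp_id _).trans (((congrArg toTarget.map (map_incl_map_endo α)).trans
    (cocone.functor_map_endo α)).trans (Category.id_comp _).symm)
  map_τ p q x y hx hy := by
    subst hx hy
    refine (Category.comp_id _).trans (Eq.trans ?_ (Category.id_comp _).symm)
    refine (congrArg (fun e => toTarget.map ((BiHH.map (incl a)).map e.hom))
      (rotations_τ p q)).trans ?_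
    exact (congrArg toTarget.map (map_incl_map_rotation p q)).trans (cocone.functor_map_tau p q)

end Sub

end FreeAdj

/-! ### Full faithfulness -/

namespace CategoryTheory.Functor

variable {D E : Type*} [Category* D] [Category* E] {K : D ⥤ E}

theorem BijOn.of_iso {v v' w w' : D} (e : v ≅ v') (e' : w ≅ w') (h : K.BijOn v' w') :
    K.BijOn v w := by
  refine ⟨fun f g hfg => ?_, fun g => ?_⟩
  · have h₁ : e.inv ≫ f ≫ e'.hom = e.inv ≫ g ≫ e'.hom :=
      h.1 (by simpa using congrArg (fun m => K.map e.inv ≫ m ≫ K.map e'.hom) hfg)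
    simpa using h₁
  · obtain ⟨f, hf⟩ := h.2 (K.map e.inv ≫ g ≫ K.map e'.hom)
    refine ⟨e.hom ≫ f ≫ e'.inv, ?_⟩
    simp only at hf
    simp only [map_comp, hf, Category.assoc]
    simp

theorem full_of_bijOn (h : ∀ v w, K.BijOn v w) : K.Full :=
  ⟨fun {v w} => (h v w).2⟩

theorem faithful_of_bijOn (h : ∀ v w, K.BijOn v w) : K.Faithful :=
  ⟨fun {v w} => @(h v w).1⟩

end CategoryTheory.Functor

namespace FreeAdj

open BiHH

theorem exists_iso_rotations (v : biHH FreeAdj) :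
    (∃ x : Word .zero .zero, Nonempty (v ≅ (rotations.Φ .zero).obj x)) ∨
      Nonempty (v ≅ (rotations.Φ .one).obj (Quiver.Path.nil : Word .one .one)) := by
  have e := baseObjIso v
  generalize baseObj v = b at e
  obtain ⟨a, x⟩ := b
  cases a with
  | zero => exact .inl ⟨x, ⟨e⟩⟩
  | one =>
    obtain h | ⟨y, ⟨e'⟩⟩ := Rotations.exists_iso_zero (R := rotations) x
    · subst h
      exact .inr ⟨e⟩
    · exact .inl ⟨y, ⟨e ≪≫ e'⟩⟩

theorem bijOn_toTarget (v w : biHH FreeAdj) : toTarget.BijOn v w := by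
  obtain ⟨y, ⟨e'⟩⟩ | ⟨⟨e'⟩⟩ := exists_iso_rotations w
  · obtain ⟨x, ⟨e⟩⟩ | ⟨⟨e⟩⟩ := exists_iso_rotations v
    · exact .of_iso e e' (Rotations.bijOn_of_zero (j := FreeAdj.zero) realization rfl
        fun f => Rotations.normalForm_of_generates rotations_generates f)
    · exact .of_iso e e' (Rotations.bijOn_nil_one_zero realization y)
  · obtain ⟨x, ⟨e⟩⟩ | ⟨⟨e⟩⟩ := exists_iso_rotations v
    · exact .of_iso e e' (Rotations.bijOn_nil_one rotations_generates realization x)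
    · exact .of_iso e e' (Rotations.bijOn_nil_one rotations_generates realization _)

instance : toTarget.Full := Functor.full_of_bijOn bijOn_toTarget

instance : toTarget.Faithful := Functor.faithful_of_bijOn bijOn_toTarget

/-- The objects of the target category are the images of the powers of words. -/
theorem tobj_wt_pow (a : FreeAdj) (N : ℕ) :
    toTarget.obj ((rotations.Φ a).obj (pow a N)) = tobj a N :=
  congrArg (tobj a) (wt_pow a N)

instance : toTarget.EssSurj where
  mem_essImage X := by
    match X with
    | .star => exact ⟨_, ⟨eqToIso (tobj_wt_pow .one 0)⟩⟩
    | .of .star => exact ⟨_, ⟨eqToIso (tobj_wt_pow .zero 0)⟩⟩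
    | .of (.of n) => exact ⟨_, ⟨eqToIso (tobj_wt_pow .zero (n.deg + 1))⟩⟩

instance : toTarget.IsEquivalence where

namespace Sub

theorem exists_iso {a : FreeAdj} (v : biHH (Sub a)) :
    ∃ x : Word a a, Nonempty (v ≅ (endo a).obj x) :=
  ⟨(baseObj v).2.hom, ⟨baseObjIso v⟩⟩

theorem bijOn_zero (v w : biHH (Sub .zero)) :
    (BiHH.map (incl .zero) ⋙ toTarget).BijOn v w := by
  obtain ⟨x, ⟨e⟩⟩ := exists_iso v
  obtain ⟨y, ⟨e'⟩⟩ := exists_iso w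
  exact .of_iso e e' (Rotations.bijOn_of_zero (j := ()) (realization .zero) rfl
    fun f => Rotations.stepCell_of_generates rotations_generates rfl f)

theorem bijOn_one (v w : biHH (Sub .one)) :
    (BiHH.map (incl .one) ⋙ toTarget).BijOn v w := by
  obtain ⟨x, ⟨e⟩⟩ := exists_iso v
  obtain ⟨y, ⟨e'⟩⟩ := exists_iso w
  exact .of_iso e e' (Rotations.bijOn_of_one (j := ()) (realization .one) rfl
    fun f => Rotations.cellStep_of_generates rotations_generates rfl f)

instance (a : FreeAdj) : (BiHH.map (incl a) ⋙ toTarget).Full :=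
  Functor.full_of_bijOn (by cases a; exacts [bijOn_zero, bijOn_one])

instance (a : FreeAdj) : (BiHH.map (incl a) ⋙ toTarget).Faithful :=
  Functor.faithful_of_bijOn (by cases a; exacts [bijOn_zero, bijOn_one])

instance (a : FreeAdj) : (BiHH.map (incl a)).Full := .of_comp_faithful _ toTarget

instance (a : FreeAdj) : (BiHH.map (incl a)).Faithful := .of_comp _ toTarget

theorem obj_endo {a : FreeAdj} (x : Word a a) :
    (BiHH.map (incl a) ⋙ toTarget).obj ((endo a).obj x) = tobj a (wt x) := rfl

end Sub

end FreeAdj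

/-! ### The duality of the paracyclic category -/

namespace Paracyclic

instance : duality.Faithful where
  map_injective {X Y φ ψ} h := by
    refine Quiver.Hom.unop_inj (hom_ext fun l => eq_of_forall_le_iff fun j => ?_)
    have h' : dualFun φ.unop j = dualFun ψ.unop j :=
      congrFun (congrArg (Hom.toFun (X := X.unop) (Y := Y.unop)) h) j
    rw [← dualFun_le_iff, ← dualFun_le_iff, h']

/-- The right adjoint of a morphism of the paracyclic category, that is, `i ↦ max {j | ψ j ≤ i}`,
expressed in terms of the left adjoint. -/
noncomputable def rightAdjoint {X Y : Paracyclic} (ψ : X ⟶ Y) : Y ⟶ X where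
  toFun i := dualFun ψ (i + 1) - 1
  monotone i i' h := sub_le_sub_right ((dual ψ).monotone (by omega)) 1
  shift i := by
    have h : dualFun ψ (i + 1 + Y.deg + 1) = dualFun ψ (i + 1) + X.deg + 1 :=
      (dual ψ).shift (i + 1)
    rw [show i + Y.deg + 1 + 1 = i + 1 + Y.deg + 1 by ring, h]
    ring

theorem le_rightAdjoint_iff {X Y : Paracyclic} (ψ : X ⟶ Y) (j i : ℤ) :
    j ≤ (rightAdjoint ψ).toFun i ↔ ψ.toFun j ≤ i := by
  have h := dualFun_le_iff ψ (i + 1) j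
  change j ≤ dualFun ψ (i + 1) - 1 ↔ _
  omega

theorem dual_rightAdjoint {X Y : Paracyclic} (ψ : X ⟶ Y) : dual (rightAdjoint ψ) = ψ :=
  hom_ext fun j => eq_of_forall_ge_iff fun i =>
    (dualFun_le_iff _ j i).trans (le_rightAdjoint_iff ψ j i)

instance : duality.Full where
  map_surjective {X Y} ψ :=
    ⟨(rightAdjoint (X := X.unop) (Y := Y.unop) ψ).op,
      dual_rightAdjoint (X := X.unop) (Y := Y.unop) ψ⟩

end Paracyclic

namespace CategoryTheory.WithTerminal

variable {C D : Type*} [Category* C] [Category* D] (F : C ⥤ D)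

instance [F.Full] : (WithTerminal.map F).Full where
  map_surjective {X Y} f :=
    match X, Y, f with
    | .of _, .of _, f => F.map_surjective f
    | .of _, .star, _ => ⟨PUnit.unit, rfl⟩
    | .star, .star, _ => ⟨PUnit.unit, rfl⟩

instance [F.Faithful] : (WithTerminal.map F).Faithful where
  map_injective {X Y} f g h :=
    match X, Y, f, g, h with
    | .of _, .of _, _, _, h => F.map_injective h
    | .of _, .star, _, _, _ => rfl
    | .star, .star, _, _, _ => rfl

end CategoryTheory.WithTerminal

/-! ### The equivalences -/

/-- A fully faithful functor `I` to the target of an equivalence `E` lifts to an equivalence along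
a fully faithful functor `G` which has the same essential image. -/
theorem CategoryTheory.Functor.exists_equivalence_of_essImage {A X Y W : Type*} [Category* A]
    [Category* X] [Category* Y] [Category* W] (G : X ⥤ Y) [G.Full] [G.Faithful] (E : Y ⥤ W)
    [E.IsEquivalence] (I : A ⥤ W) [I.Full] [I.Faithful]
    (h : ∀ a, (G ⋙ E).essImage (I.obj a)) (h' : ∀ x, I.essImage ((G ⋙ E).obj x)) :
    ∃ e : A ≌ X, Nonempty (e.functor ⋙ G ≅ I ⋙ E.inv) := by
  let F := essImage.liftFunctor I (G ⋙ E) h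
  let α : F ⋙ G ⋙ E ≅ I := essImage.liftFunctorCompIso I (G ⋙ E) h
  have : F.Full := .of_comp_faithful_iso α
  have : F.Faithful := .of_comp_iso α
  have : F.EssSurj := ⟨fun x => by
    obtain ⟨a, ⟨e⟩⟩ := h' x
    exact ⟨a, ⟨(G ⋙ E).preimageIso (α.app a ≪≫ e)⟩⟩⟩
  have : F.IsEquivalence := {}
  exact ⟨F.asEquivalence, ⟨(isoWhiskerLeft (F ⋙ G) E.asEquivalence.unitIso : _) ≪≫
    isoWhiskerRight α E.inv⟩⟩

theorem FreeAdj.tobj_mem_essImage {a : FreeAdj} (N : ℕ) :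
    (BiHH.map (Sub.incl a) ⋙ toTarget).essImage (tobj a N) :=
  ⟨_, ⟨eqToIso ((Sub.obj_endo (pow a N)).trans (by rw [wt_pow]))⟩⟩

theorem mainTheorem5 :
    ∃ (eMon : WithInitial Paracyclic ≌ biHH FreeMon)
      (eAdj : WithTerminal (WithInitial Paracyclic) ≌ biHH FreeAdj)
      (eCoMon : WithTerminal Paracyclicᵒᵖ ≌ biHH FreeCoMon),
      Nonempty (eMon.functor ⋙ BiHH.map FreeMon.incl ≅ WithTerminal.incl ⋙ eAdj.functor) ∧
      Nonempty (eCoMon.functor ⋙ BiHH.map FreeCoMon.incl ≅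
        WithTerminal.map (Paracyclic.duality ⋙ WithInitial.incl) ⋙ eAdj.functor) ∧
      ((BiHH.map FreeMon.incl).Full ∧ (BiHH.map FreeMon.incl).Faithful) ∧
      ((BiHH.map FreeCoMon.incl).Full ∧ (BiHH.map FreeCoMon.incl).Faithful) := by
  have iso (a : FreeAdj) (x : biHH (FreeAdj.Sub a)) : ∃ N, Nonempty
      (FreeAdj.tobj a N ≅ (BiHH.map (FreeAdj.Sub.incl a) ⋙ FreeAdj.toTarget).obj x) := by
    obtain ⟨p, ⟨e⟩⟩ := FreeAdj.Sub.exists_iso x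
    exact ⟨FreeAdj.wt p, ⟨((BiHH.map (FreeAdj.Sub.incl a) ⋙ FreeAdj.toTarget).mapIso e).symm⟩⟩
  obtain ⟨eMon, hMon⟩ := Functor.exists_equivalence_of_essImage
    (BiHH.map (FreeAdj.Sub.incl .zero)) FreeAdj.toTarget
    (WithTerminal.incl (C := WithInitial Paracyclic))
    (fun
      | .star => FreeAdj.tobj_mem_essImage (a := .zero) 0
      | .of n => FreeAdj.tobj_mem_essImage (a := .zero) (n.deg + 1))
    (fun x => by
      obtain ⟨N, ⟨e⟩⟩ := iso .zero x
      cases N with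
      | zero => exact ⟨.star, ⟨e⟩⟩
      | succ n => exact ⟨.of ⟨n⟩, ⟨e⟩⟩)
  obtain ⟨eCoMon, hCoMon⟩ := Functor.exists_equivalence_of_essImage
    (BiHH.map (FreeAdj.Sub.incl .one)) FreeAdj.toTarget
    (WithTerminal.map (Paracyclic.duality ⋙ WithInitial.incl))
    (fun
      | .star => FreeAdj.tobj_mem_essImage (a := .one) 0
      | .of n => FreeAdj.tobj_mem_essImage (a := .one) (n.unop.deg + 1))
    (fun x => by
      obtain ⟨N, ⟨e⟩⟩ := iso .one x
      cases N with
      | zero => exact ⟨.star, ⟨e⟩⟩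
      | succ n => exact ⟨.of (.op ⟨n⟩), ⟨e⟩⟩)
  exact ⟨eMon, FreeAdj.toTarget.asEquivalence.symm, eCoMon, hMon, hCoMon,
    ⟨inferInstanceAs (BiHH.map (FreeAdj.Sub.incl .zero)).Full,
      inferInstanceAs (BiHH.map (FreeAdj.Sub.incl .zero)).Faithful⟩,
    ⟨inferInstanceAs (BiHH.map (FreeAdj.Sub.incl .one)).Full,
      inferInstanceAs (BiHH.map (FreeAdj.Sub.incl .one)).Faithful⟩⟩
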